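/- Let $\mathbf M=\{z\in\mathbb C^3:\ z_1^2+z_2^2+z_3^2=0,\ z\neq0,\ |z|<1\}$ be the unit ball of the two-dimensional Kepler manifold, where $|z|$ is the Euclidean norm. A function $u>0$ on $\mathbf M$, smooth and such that $\log\frac1u$ is strictly plurisubharmonic, is called balanced if there is a constant $c$ with $K(z,z)=c/u(z)^3$ for all $z\in\mathbf M$, where $K$ is the reproducing kernel of the space of all holomorphic functions on $\mathbf M$ that are square integrable with respect to the measure $u^3\,\bigwedge^2\big(\tfrac i2\partial\bar\partial\log\tfrac1u\big)$. (i) Let $f$ be a real function that is real-analytic in a neighbourhood of $1$ and satisfies $f(1)=0$ and $f'(1)=-1$. Then $u(z)=f(|z|^2)$ is not balanced on $\mathbf M$. (ii) Consequently, there is no radial balanced $u(z)=f(|z|^2)$ on $\mathbf M$ that vanishes precisely to first order at the boundary (i.e. $f(1^-)=0$ and $f'(1^-)$ exists and is nonzero) and is real-analytic up to the boundary $|z|=1$ (i.e. near each point of $\{z\in\mathbb C^3: z_1^2+z_2^2+z_3^2=0,\ |z|=1\}$ it is the restriction to $\mathbf M$ of a real-analytic function). -/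

import Mathlib

open Set Filter Topology MeasureTheory
open scoped ContDiff ComplexOrder

noncomputable section

/-- The unit ball `M^n = {z ∈ ℂ^{n+1} : z·z = 0, z ≠ 0, |z| < 1}` of the Kepler manifold, where
`z·z = ∑ z_j ^ 2` and `|z|` is the Euclidean norm. -/
def keplerBall (n : ℕ) : Set (EuclideanSpace ℂ (Fin (n + 1))) :=
  {z | ∑ j, z j ^ 2 = 0 ∧ z ≠ 0 ∧ ‖z‖ < 1}

/-- The outer boundary `{z ∈ ℂ^{n+1} : z·z = 0, |z| = 1}` of `M^n`. -/
def keplerSphere (n : ℕ) : Set (EuclideanSpace ℂ (Fin (n + 1))) :=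
  {z | ∑ j, z j ^ 2 = 0 ∧ ‖z‖ = 1}

/-- The Wirtinger derivative `∂g/∂z_j = (∂g/∂x_j - i ∂g/∂y_j) / 2`. -/
def wirtinger {n : ℕ} (j : Fin n) (g : (Fin n → ℂ) → ℂ) (x : Fin n → ℂ) : ℂ :=
  (fderiv ℝ g x (Pi.single j 1) - Complex.I * fderiv ℝ g x (Pi.single j Complex.I)) / 2

/-- The Wirtinger derivative `∂g/∂z̄_j = (∂g/∂x_j + i ∂g/∂y_j) / 2`. -/
def wirtingerBar {n : ℕ} (j : Fin n) (g : (Fin n → ℂ) → ℂ) (x : Fin n → ℂ) : ℂ :=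
  (fderiv ℝ g x (Pi.single j 1) + Complex.I * fderiv ℝ g x (Pi.single j Complex.I)) / 2

/-- The complex Hessian `(∂²φ/∂z_j∂z̄_k)_{j,k}` of a real function `φ` on (an open set of) `ℂ^n`. -/
def complexHessian {n : ℕ} (φ : (Fin n → ℂ) → ℝ) (x : Fin n → ℂ) : Matrix (Fin n) (Fin n) ℂ :=
  Matrix.of fun j k => wirtinger j (wirtingerBar k fun y => (φ y : ℂ)) x

/-- `ψ : U → M` is a local holomorphic parametrization (the inverse of a holomorphic chart) of the
`n`-dimensional complex submanifold `M` of `ℂ^N`: an injective holomorphic immersion of an open set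
`U ⊆ ℂ^n` into `M`. Since `dim M = n`, the inverse function theorem shows that `ψ(U)` is open
in `M` and that `ψ` is biholomorphic onto `ψ(U)`. -/
structure IsHolParam {n N : ℕ} (M : Set (EuclideanSpace ℂ (Fin N))) (U : Set (Fin n → ℂ))
    (ψ : (Fin n → ℂ) → EuclideanSpace ℂ (Fin N)) : Prop where
  isOpen : IsOpen U
  holomorphic : DifferentiableOn ℂ ψ U
  injOn : InjOn ψ U
  immersion : ∀ x ∈ U, Function.Injective (fderiv ℂ ψ x)
  mapsTo : MapsTo ψ U M

/-- `g` is a holomorphic function on the `n`-dimensional complex submanifold `M` of `ℂ^N`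
(only the values of `g` on `M` matter). -/
def IsHolomorphicOn (n : ℕ) {N : ℕ} (M : Set (EuclideanSpace ℂ (Fin N)))
    (g : EuclideanSpace ℂ (Fin N) → ℂ) : Prop :=
  ∀ (U : Set (Fin n → ℂ)) (ψ : (Fin n → ℂ) → EuclideanSpace ℂ (Fin N)),
    IsHolParam M U ψ → DifferentiableOn ℂ (fun x => g (ψ x)) U

/-- `u` is a `C^∞` function on the `n`-dimensional complex submanifold `M` of `ℂ^N`. -/
def IsSmoothOn (n : ℕ) {N : ℕ} (M : Set (EuclideanSpace ℂ (Fin N)))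
    (u : EuclideanSpace ℂ (Fin N) → ℝ) : Prop :=
  ∀ (U : Set (Fin n → ℂ)) (ψ : (Fin n → ℂ) → EuclideanSpace ℂ (Fin N)),
    IsHolParam M U ψ → ContDiffOn ℝ ∞ (fun x => u (ψ x)) U

/-- The (smooth) function `Φ` on the `n`-dimensional complex submanifold `M` of `ℂ^N` is strictly
plurisubharmonic: in local coordinates, its complex Hessian is positive definite. -/
def IsStrictlyPsh (n : ℕ) {N : ℕ} (M : Set (EuclideanSpace ℂ (Fin N)))
    (Φ : EuclideanSpace ℂ (Fin N) → ℝ) : Prop :=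
  ∀ (U : Set (Fin n → ℂ)) (ψ : (Fin n → ℂ) → EuclideanSpace ℂ (Fin N)),
    IsHolParam M U ψ → ∀ x ∈ U, (complexHessian (fun y => Φ (ψ y)) x).PosDef

/-- The volume `∧^n ω`, `ω = (i/2) ∂∂̄Φ`, on the `n`-dimensional complex submanifold `M` of `ℂ^N`
(as a measure on `ℂ^N` carried by `M`), for `Φ` smooth and strictly plurisubharmonic on `M`.
In local coordinates it is `det (∂²Φ/∂z_j∂z̄_k)` times Lebesgue measure, the constant `n!` being
normalized to `1`. These local expressions agree on overlaps of coordinate patches, so the least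
measure that dominates all of them is the global measure which restricts to each of them. -/
def kahlerVolume (n : ℕ) {N : ℕ} (M : Set (EuclideanSpace ℂ (Fin N)))
    (Φ : EuclideanSpace ℂ (Fin N) → ℝ) : Measure (EuclideanSpace ℂ (Fin N)) :=
  ⨆ (U : Set (Fin n → ℂ)) (ψ : (Fin n → ℂ) → EuclideanSpace ℂ (Fin N)) (_ : IsHolParam M U ψ),
    ((volume.restrict U).withDensity fun x =>
      ENNReal.ofReal (complexHessian (fun y => Φ (ψ y)) x).det.re).map ψ

/-- Membership in the weighted Bergman space `L²_hol(M, μ)` of holomorphic functions on `M` that are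
square integrable with respect to `μ`. -/
def MemBergman (n : ℕ) {N : ℕ} (M : Set (EuclideanSpace ℂ (Fin N)))
    (μ : Measure (EuclideanSpace ℂ (Fin N))) (g : EuclideanSpace ℂ (Fin N) → ℂ) : Prop :=
  IsHolomorphicOn n M g ∧ MemLp g 2 μ

/-- `K` is the reproducing kernel of the weighted Bergman space `L²_hol(M, μ)`. -/
def IsBergmanKernel (n : ℕ) {N : ℕ} (M : Set (EuclideanSpace ℂ (Fin N)))
    (μ : Measure (EuclideanSpace ℂ (Fin N)))
    (K : EuclideanSpace ℂ (Fin N) → EuclideanSpace ℂ (Fin N) → ℂ) : Prop :=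
  ∀ y ∈ M, MemBergman n M μ (fun x => K x y) ∧
    ∀ g, MemBergman n M μ g → g y = ∫ x, g x * starRingEnd ℂ (K x y) ∂μ

/-- The weighted volume `u^{n+1} ∧^n ((i/2) ∂∂̄ log (1/u))` on `M`. -/
def balancedWeight (n : ℕ) {N : ℕ} (M : Set (EuclideanSpace ℂ (Fin N)))
    (u : EuclideanSpace ℂ (Fin N) → ℝ) : Measure (EuclideanSpace ℂ (Fin N)) :=
  (kahlerVolume n M fun z => Real.log (1 / u z)).withDensity fun z =>
    ENNReal.ofReal (u z ^ (n + 1))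

/-- The balanced condition on the `n`-dimensional complex submanifold `M` of `ℂ^N`:
`u = e^{-Φ}` with `Φ = log (1/u)` smooth and strictly plurisubharmonic on `M`, and the reproducing
kernel `K` of the weighted Bergman space with the weight `u^{n+1} ∧^n ((i/2) ∂∂̄ log (1/u))`
satisfies `K(z,z) = c / u(z)^{n+1}` for all `z ∈ M`, with some constant `c`. -/
def IsBalanced (n : ℕ) {N : ℕ} (M : Set (EuclideanSpace ℂ (Fin N)))
    (u : EuclideanSpace ℂ (Fin N) → ℝ) : Prop :=
  (∀ z ∈ M, 0 < u z) ∧ IsSmoothOn n M u ∧ IsStrictlyPsh n M (fun z => Real.log (1 / u z)) ∧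
    ∃ K, IsBergmanKernel n M (balancedWeight n M u) K ∧
      ∃ c : ℝ, ∀ z ∈ M, K z z = ((c / u z ^ (n + 1) : ℝ) : ℂ)

/-- `u`, defined on `M^n`, is real-analytic up to the boundary `|z| = 1`: near each point of the
outer boundary, it is the restriction to `M^n` of a real-analytic function. -/
def IsAnalyticUpToBoundary (n : ℕ) (u : EuclideanSpace ℂ (Fin (n + 1)) → ℝ) : Prop :=
  ∀ p ∈ keplerSphere n, ∃ G : EuclideanSpace ℂ (Fin (n + 1)) → ℝ,
    AnalyticAt ℝ G p ∧ ∀ᶠ z in 𝓝[keplerBall n] p, u z = G z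

end

/-! In the chart (ξ, ζ) ↦ ξ(1 - ζ², i(1 + ζ²), 2ζ), which misses only a null set, |z|² = 2|ξ|²(1 +
|ζ|²)². Put L(t) = t (log 1/f)'(t). The weighted volume has Lebesgue density 2f³(L²)' at t = |z|²,
so it is invariant under rotations of ξ and of ζ. Averaging over these rotations shows that at a
point (w, 0) the kernel sees only the powers ξ^m. With μ_m = ∫₀¹ t^m f³(L²)' dt, the squared norm of
ξ^m is π² μ_m / (2^m (2m+1)) for m ≥ 0 and infinite for m < 0. Hence (`hasSum_kernel`) a balanced
radial u satisfies Σ (2m+1)/μ_m t^m = C/f(t)³, where an infinite μ_m contributes zero.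

Let f agree to the left of 1 with an analytic function that has a simple zero at 1, let m be the
least index with μ_m finite, and let b_j = (2(m+j)+1)/μ_{m+j}. Then p(t) = (1-t)³ Σ b_j t^j extends
to a function analytic and zero-free on [0,1]. So V = t^m f³(L²)', which is rational in t, p, p',
p'', is analytic there too, and b_j ∫ t^j V = 2(m+j)+1.

This relation is rigid (`quadratic_of_moments`). Subtract from b_j the quadratic q_j given by the
second-order Taylor polynomial of p at 1; what is left are the coefficients of a function p₃
analytic up to 1. Integration by parts gives (b_j - q_j) ∫ t^j V = d₁(j+1) + d₀ - ∫ t^j W, where W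
is an Euler operator applied to V. The left sides are the coefficients of ∫ p₃(rt)V(t) dt, which is
bounded for r < 1. As the harmonic series diverges, such coefficients cannot be asymptotic to a
nonzero multiple of j+1, of 1 or of 1/(j+1). So d₁ = d₀ = 0; repeating the last exclusion after
further integrations by parts, W vanishes to infinite order at 1. Hence W = 0 and b_j = q_j.

Now p is a polynomial Q of degree at most two, and V, an analytic solution at 0 of an Euler
equation, is a polynomial. The formula for V in terms of p becomes a polynomial identity: degree two
fails by counting degrees, degree one by evaluating at the root of Q, and for constant Q the first
two moments give 4m = 3. Part (ii) reduces to the same argument by restricting the analytic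
extension to a ray. -/

/-! ### Moments on [0,1] and coefficients of power series. -/

/-- Moments of an analytic function on `[0,1]`: integration by parts. -/
theorem moment_by_parts {X : ℝ → ℝ} (hX : AnalyticOnNhd ℝ X (Icc 0 1)) (j : ℕ) :
    ((j : ℝ) + 1) * ∫ t in (0 : ℝ)..1, t ^ j * X t
      = X 1 - ∫ t in (0 : ℝ)..1, t ^ j * (t * deriv X t) := by
  have h1 : ∀ x ∈ uIcc (0 : ℝ) 1, HasDerivAt X (deriv X x) x := fun x hx =>
    (hX x (by simpa using hx)).differentiableAt.hasDerivAt
  have h2 : ∀ x ∈ uIcc (0 : ℝ) 1, HasDerivAt (fun t : ℝ => t ^ (j + 1)) ((j + 1) * x ^ j) x :=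
    fun x _ => by simpa using hasDerivAt_pow (j + 1) x
  have hd : ContinuousOn (deriv X) (Icc 0 1) := hX.deriv.continuousOn
  have h3 := intervalIntegral.integral_mul_deriv_eq_deriv_mul h1 h2
    (ContinuousOn.intervalIntegrable (by simpa using hd))
    (Continuous.intervalIntegrable (by fun_prop) _ _)
  rw [← intervalIntegral.integral_const_mul]
  calc _ = ∫ t in (0 : ℝ)..1, X t * ((j + 1) * t ^ j) := by congr 1; ext t; ring
    _ = _ := by
      rw [h3]; simp only [one_pow, mul_one]
      congr 1
      · simp
      · congr 1; ext t; ring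

theorem abs_moment_le {X : ℝ → ℝ} {M : ℝ} (hM : ∀ t ∈ Icc (0 : ℝ) 1, |X t| ≤ M)
    (j : ℕ) :
    |∫ t in (0 : ℝ)..1, t ^ j * X t| ≤ M / (j + 1) := by
  have h := intervalIntegral.norm_integral_le_of_norm_le (μ := volume) (a := (0:ℝ)) (b := 1)
    (f := fun t => t ^ j * X t) (g := fun t => t ^ j * M) zero_le_one
    (Eventually.of_forall fun t ht => by
      have ht' : 0 ≤ t := ht.1.le
      rw [norm_mul, Real.norm_eq_abs, Real.norm_eq_abs, abs_of_nonneg (by positivity)]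
      exact mul_le_mul_of_nonneg_left (hM t ⟨ht', ht.2⟩) (by positivity))
    (Continuous.intervalIntegrable (by fun_prop) _ _)
  rw [intervalIntegral.integral_mul_const, integral_pow] at h
  rw [Real.norm_eq_abs] at h
  refine h.trans (le_of_eq ?_)
  simp; ring

theorem AnalyticOnNhd.exists_abs_le_Icc {X : ℝ → ℝ} (hX : AnalyticOnNhd ℝ X (Icc 0 1)) :
    ∃ M, ∀ t ∈ Icc (0 : ℝ) 1, |X t| ≤ M := by
  obtain ⟨M, hM⟩ := isCompact_Icc.exists_bound_of_continuousOn hX.continuousOn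
  exact ⟨M, hM⟩

theorem tendsto_moment_zero {X : ℝ → ℝ} (hX : AnalyticOnNhd ℝ X (Icc 0 1)) :
    Tendsto (fun j : ℕ => ∫ t in (0 : ℝ)..1, t ^ j * X t) atTop (𝓝 0) := by
  obtain ⟨M, hM⟩ := hX.exists_abs_le_Icc
  refine squeeze_zero_norm (fun j => abs_moment_le hM j) ?_
  have := tendsto_one_div_add_atTop_nhds_zero_nat (𝕜 := ℝ)
  simpa [div_eq_mul_inv] using this.const_mul M

/-- One integration by parts leaves X(1) minus a moment of tX', and moments tend to zero. -/
theorem tendsto_succ_mul_moment {X : ℝ → ℝ} (hX : AnalyticOnNhd ℝ X (Icc 0 1)) :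
    Tendsto (fun j : ℕ => ((j : ℝ) + 1) * ∫ t in (0 : ℝ)..1, t ^ j * X t) atTop (𝓝 (X 1)) := by
  have h : AnalyticOnNhd ℝ (fun t => t * deriv X t) (Icc 0 1) := analyticOnNhd_id.mul hX.deriv
  simp_rw [moment_by_parts hX]
  simpa using (tendsto_moment_zero h).const_sub (X 1)

/-- A power series whose coefficients dominate those of the logarithm is unbounded on `(0,1)`. -/
theorem not_bounded_of_le_coeff {s : ℕ → ℝ} {S : ℝ → ℝ} {B c : ℝ} (hc : 0 < c)
    (hS : ∀ r ∈ Ioo (0 : ℝ) 1, HasSum (fun j => s j * r ^ j) (S r))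
    (hB : ∀ r ∈ Ioo (0 : ℝ) 1, S r ≤ B) (hs : ∀ᶠ j : ℕ in atTop, c / ((j : ℝ) + 1) ≤ s j) :
    False := by
  obtain ⟨N, hN⟩ := eventually_atTop.1 hs
  -- Terms past N are nonnegative, so for n ≥ N the partial sums at r < 1 are at most S r ≤ B; let r
  -- tend to 1.
  have h1 : ∀ n ≥ N, ∑ j ∈ Finset.range n, s j ≤ B := by
    intro n hn
    have h2 : ∀ᶠ r in 𝓝[<] (1 : ℝ), ∑ j ∈ Finset.range n, s j * r ^ j ≤ B := by
      filter_upwards [Ioo_mem_nhdsLT (zero_lt_one (α := ℝ))] with r hr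
      refine (sum_le_hasSum _ (fun j hj => ?_) (hS r hr)).trans (hB r hr)
      have hj' : N ≤ j := by simp at hj; omega
      have := hN j hj'
      have h3 : 0 ≤ c / ((j : ℝ) + 1) := by positivity
      exact mul_nonneg (h3.trans this) (pow_nonneg hr.1.le _)
    have h3 : Tendsto (fun r : ℝ => ∑ j ∈ Finset.range n, s j * r ^ j) (𝓝[<] 1)
        (𝓝 (∑ j ∈ Finset.range n, s j * 1 ^ j)) :=
      ((Continuous.tendsto (by fun_prop) 1).mono_left nhdsWithin_le_nhds)
    simpa using le_of_tendsto h3 h2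
  have h4 : ∀ n ≥ N, c * ∑ j ∈ Finset.range n, (1 : ℝ) / (j + 1)
      ≤ B - ∑ j ∈ Finset.range N, s j + c * ∑ j ∈ Finset.range N, (1 : ℝ) / (j + 1) := by
    intro n hn
    have h5 := h1 n hn
    rw [← Finset.sum_range_add_sum_Ico _ hn] at h5 ⊢
    have : c * ∑ j ∈ Finset.Ico N n, (1 : ℝ) / (j + 1) ≤ ∑ j ∈ Finset.Ico N n, s j := by
      rw [Finset.mul_sum]
      refine Finset.sum_le_sum fun j hj => ?_
      have := hN j (Finset.mem_Ico.1 hj).1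
      rwa [mul_one_div]
    rw [mul_add]; linarith
  have h6 := (Real.tendsto_sum_range_one_div_nat_succ_atTop.const_mul_atTop hc)
  obtain ⟨n, hn, hn'⟩ := ((h6.eventually_gt_atTop _).and (eventually_ge_atTop N)).exists
  exact absurd hn (not_lt.2 (h4 n hn'))

/-- For l > 0 the coefficients would eventually exceed (l/2)/(j+1), and S would be unbounded; for l
< 0 apply this to -s. It serves with w j = 1/(j+1), 1 and j+1. -/
theorem coeff_limit_eq_zero {s : ℕ → ℝ} {S : ℝ → ℝ} {B l : ℝ} {w : ℕ → ℝ}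
    (hw : ∀ j : ℕ, 1 / ((j : ℝ) + 1) ≤ w j)
    (hS : ∀ r ∈ Ioo (0 : ℝ) 1, HasSum (fun j => s j * r ^ j) (S r))
    (hB : ∀ r ∈ Ioo (0 : ℝ) 1, |S r| ≤ B) (hs : Tendsto (fun j => s j / w j) atTop (𝓝 l)) :
    l = 0 := by
  have hw0 : ∀ j, 0 < w j := fun j => lt_of_lt_of_le (by positivity) (hw j)
  have key : ∀ {s : ℕ → ℝ} {S : ℝ → ℝ} {l : ℝ},
      (∀ r ∈ Ioo (0 : ℝ) 1, HasSum (fun j => s j * r ^ j) (S r)) →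
      (∀ r ∈ Ioo (0 : ℝ) 1, |S r| ≤ B) → Tendsto (fun j => s j / w j) atTop (𝓝 l) → ¬ 0 < l := by
    intro s S l hS hB hs hl
    refine not_bounded_of_le_coeff (half_pos hl) hS (fun r hr => (le_abs_self _).trans (hB r hr)) ?_
    filter_upwards [hs.eventually_const_lt (half_lt_self hl)] with j hj
    rw [lt_div_iff₀ (hw0 j)] at hj
    refine le_trans ?_ hj.le
    rw [div_eq_mul_one_div]
    exact mul_le_mul_of_nonneg_left (hw j) (half_pos hl).le
  rcases lt_trichotomy l 0 with h | h | h
  · refine absurd (neg_pos.2 h) (key (s := fun j => - s j) (S := fun r => - S r) ?_ ?_ ?_)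
    · intro r hr; simpa using (hS r hr).neg
    · intro r hr; simpa using hB r hr
    · simpa [neg_div] using hs.neg
  · exact h
  · exact absurd h (key hS hB hs)

/-- Termwise differentiation of a real power series. -/
theorem hasDerivAt_powerSeries {e : ℕ → ℝ} (he : ∀ t ∈ Ioo (0 : ℝ) 1, Summable fun j => e j * t ^ j)
    {t : ℝ} (ht : |t| < 1) :
    HasDerivAt (fun t => ∑' j, e j * t ^ j) (∑' j : ℕ, e j * (j * t ^ (j - 1))) t ∧
      Summable (fun j : ℕ => e j * (j * t ^ (j - 1))) := by
  -- Radii |t| < r < ρ < 1: boundedness of e_j ρ^j and the ratio r/ρ < 1 give a summable bound for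
  -- the differentiated terms on (-r, r).
  obtain ⟨r, hr1, hr2⟩ := exists_between ht
  obtain ⟨ρ, hρ1, hρ2⟩ := exists_between hr2
  have hr0 : 0 < r := (abs_nonneg t).trans_lt hr1
  have hρ0 : 0 < ρ := hr0.trans hρ1
  have h1 := (he ρ ⟨hρ0, hρ2⟩).tendsto_atTop_zero
  obtain ⟨C, hC⟩ := h1.norm.bddAbove_range
  have hC' : ∀ j, |e j| * ρ ^ j ≤ C := fun j => by
    have h : ‖e j * ρ ^ j‖ ≤ C := hC (mem_range_self j)
    rwa [norm_mul, norm_pow, Real.norm_eq_abs, Real.norm_eq_abs, abs_of_pos hρ0] at h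
  have hu : Summable fun j : ℕ => C / r * ((j : ℝ) ^ 1 * (r / ρ) ^ j) := by
    have h2 : ‖r / ρ‖ < 1 := by
      rw [Real.norm_eq_abs, abs_of_pos (by positivity)]
      exact (div_lt_one hρ0).2 hρ1
    have h3 := summable_pow_mul_geometric_of_norm_lt_one 1 h2
    exact h3.mul_left (C / r)
  have hb : ∀ (j : ℕ) (y : ℝ), y ∈ Ioo (-r) r →
      ‖e j * (j * y ^ (j - 1))‖ ≤ C / r * ((j : ℝ) ^ 1 * (r / ρ) ^ j) := by
    intro j y hy
    rcases j with _ | j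
    · simp
    have hy' : |y| ≤ r := (abs_lt.2 hy).le
    simp only [Nat.add_sub_cancel, norm_mul, norm_pow, Real.norm_eq_abs, pow_one, Nat.abs_cast]
    have h2 := hC' (j + 1)
    have h3 : |e (j + 1)| ≤ C / ρ ^ (j + 1) := (le_div_iff₀ (by positivity)).2 h2
    have h4 : 0 ≤ C / ρ ^ (j + 1) := (abs_nonneg _).trans h3
    calc |e (j + 1)| * (((j + 1 : ℕ) : ℝ) * |y| ^ j)
        ≤ C / ρ ^ (j + 1) * (((j + 1 : ℕ) : ℝ) * r ^ j) := by gcongr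
      _ = _ := by rw [div_pow, pow_succ r j]; field_simp
  have hty : t ∈ Ioo (-r) r := abs_lt.1 hr1
  constructor
  · refine hasDerivAt_tsum_of_isPreconnected hu isOpen_Ioo isPreconnected_Ioo
      (fun j y hy => ?_) hb (y₀ := 0) ⟨by linarith, hr0⟩ ?_ hty
    · exact (hasDerivAt_pow j y).const_mul (e j)
    · refine summable_of_ne_finset_zero (s := {0}) fun j hj => ?_
      simp at hj; simp [hj]
  · exact Summable.of_norm_bounded hu (fun j => hb j t hty)

/-- The product of the coefficients of a power series with the moments of `V` is again the
coefficient sequence of a power series. -/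
theorem hasSum_mul_moment {e : ℕ → ℝ} {G V : ℝ → ℝ} (hV : AnalyticOnNhd ℝ V (Icc 0 1))
    (hG : ∀ t ∈ Ioo (0 : ℝ) 1, HasSum (fun j => e j * t ^ j) (G t)) {r : ℝ} (hr : r ∈ Ioo (0 : ℝ) 1) :
    HasSum (fun j => (e j * ∫ t in (0 : ℝ)..1, t ^ j * V t) * r ^ j)
      (∫ t in (0 : ℝ)..1, G (r * t) * V t) := by
  obtain ⟨M, hM⟩ := hV.exists_abs_le_Icc
  have hVc : ContinuousOn V (uIcc 0 1) := by simpa using hV.continuousOn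
  have hint : ∀ j : ℕ, IntervalIntegrable (fun t => e j * r ^ j * (t ^ j * V t)) volume 0 1 :=
    fun j => ContinuousOn.intervalIntegrable (by fun_prop)
  have h := intervalIntegral.hasSum_integral_of_dominated_convergence (μ := volume) (a := 0) (b := 1)
    (F := fun (j : ℕ) t => e j * r ^ j * (t ^ j * V t)) (f := fun t => G (r * t) * V t)
    (fun j _ => |e j * r ^ j| * M)
    (fun j => by rw [uIoc_of_le zero_le_one]; exact (hint j).1.aestronglyMeasurable)
    (fun j => Eventually.of_forall fun t ht => ?_)
    (Eventually.of_forall fun t _ => (hG r hr).summable.abs.mul_right M)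
    (intervalIntegrable_const)
    (Eventually.of_forall fun t ht => ?_)
  · simp_rw [intervalIntegral.integral_const_mul] at h
    exact h.congr_fun fun j => by ring
  · rw [uIoc_of_le zero_le_one] at ht
    rw [Real.norm_eq_abs, abs_mul (e j * r ^ j), abs_mul (t ^ j)]
    refine mul_le_mul_of_nonneg_left ?_ (abs_nonneg _)
    have h1 : |t ^ j| ≤ 1 := by
      rw [abs_of_nonneg (pow_nonneg ht.1.le _)]; exact pow_le_one₀ ht.1.le ht.2
    have h2 := hM t ⟨ht.1.le, ht.2⟩
    nlinarith [abs_nonneg (V t)]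
  · rw [uIoc_of_le zero_le_one] at ht
    have hrt : r * t ∈ Ioo (0 : ℝ) 1 :=
      ⟨mul_pos hr.1 ht.1, by nlinarith [hr.1, hr.2, ht.1, ht.2]⟩
    exact ((hG _ hrt).mul_right (V t)).congr_fun fun j => by ring

/-- Supplies the bound required by `coeff_limit_eq_zero` for the series of `hasSum_mul_moment`. -/
theorem abs_integral_comp_mul_le {G V : ℝ → ℝ} (hV : AnalyticOnNhd ℝ V (Icc 0 1))
    (hG : AnalyticOnNhd ℝ G (Icc 0 1)) :
    ∃ B, ∀ r ∈ Ioo (0 : ℝ) 1, |∫ t in (0 : ℝ)..1, G (r * t) * V t| ≤ B := by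
  obtain ⟨M, hM⟩ := hV.exists_abs_le_Icc
  obtain ⟨N, hN⟩ := hG.exists_abs_le_Icc
  refine ⟨N * M, fun r hr => ?_⟩
  have := intervalIntegral.norm_integral_le_of_norm_le_const (a := (0:ℝ)) (b := 1) (C := N * M)
    (f := fun t => G (r * t) * V t) ?_
  · simpa using this
  · intro t ht
    rw [uIoc_of_le zero_le_one] at ht
    rw [norm_mul]
    have h1 := hN (r * t) ⟨(mul_pos hr.1 ht.1).le, by nlinarith [hr.1, hr.2, ht.1, ht.2]⟩
    exact mul_le_mul h1 (hM t ⟨ht.1.le, ht.2⟩) (abs_nonneg _) ((abs_nonneg _).trans h1)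

/-- The operator G ↦ (tG)' multiplies coefficients by j+1 and keeps analyticity up to 1. On the
moment side it is matched by X ↦ -tX' when X(1) = 0. -/
theorem hasSum_succ_mul_coeff {e : ℕ → ℝ} {G : ℝ → ℝ}
    (hG : ∀ t ∈ Ioo (0 : ℝ) 1, HasSum (fun j => e j * t ^ j) (G t)) {t : ℝ}
    (ht : t ∈ Ioo (0 : ℝ) 1) :
    HasSum (fun j : ℕ => ((j : ℝ) + 1) * e j * t ^ j) (deriv (fun t => t * G t) t) := by
  have h1 := hasDerivAt_powerSeries (fun t ht => (hG t ht).summable) (t := t)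
    (by rw [abs_of_pos ht.1]; exact ht.2)
  have h2 : (fun t => ∑' j, e j * t ^ j) =ᶠ[𝓝 t] G := by
    filter_upwards [isOpen_Ioo.mem_nhds ht] with s hs using (hG s hs).tsum_eq
  have h3 : HasDerivAt G (∑' j : ℕ, e j * (j * t ^ (j - 1))) t := h1.1.congr_of_eventuallyEq h2.symm
  have h4 : deriv (fun t => t * G t) t = G t + t * ∑' j : ℕ, e j * (j * t ^ (j - 1)) := by
    have := (hasDerivAt_id t).mul h3
    simp only [id, one_mul] at this
    exact this.deriv
  rw [h4]
  refine ((hG t ht).add (h1.2.hasSum.mul_left t)).congr_fun fun j => ?_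
  rcases j with _ | j
  · simp
  · simp only [Nat.add_sub_cancel]; push_cast; ring

/-- If the coefficients of a power series that is analytic up to `1`, times the moments of `V`,
are the moments of `X`, then `X` vanishes to infinite order at `1`. -/
theorem not_finite_order_of_moment_eq {V : ℝ → ℝ} (hV : AnalyticOnNhd ℝ V (Icc 0 1)) (n : ℕ) :
    ∀ (e : ℕ → ℝ) (G X g : ℝ → ℝ), AnalyticOnNhd ℝ G (Icc 0 1) → AnalyticOnNhd ℝ X (Icc 0 1) →
      (∀ t ∈ Ioo (0 : ℝ) 1, HasSum (fun j => e j * t ^ j) (G t)) →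
      (∀ j : ℕ, e j * ∫ t in (0 : ℝ)..1, t ^ j * V t = ∫ t in (0 : ℝ)..1, t ^ j * X t) →
      AnalyticAt ℝ g 1 → g 1 ≠ 0 → ¬ X =ᶠ[𝓝 1] fun t => (t - 1) ^ n * g t := by
  induction n with
  | zero =>
    intro e G X g hGa hX hG h hg hg1 hXg
    -- If X(1) ≠ 0, the moments of X are asymptotic to X(1)/(j+1), too large for the coefficients of
    -- a bounded function.
    obtain ⟨B, hB⟩ := abs_integral_comp_mul_le hV hGa
    have := coeff_limit_eq_zero (w := fun j => 1 / ((j : ℝ) + 1)) (l := X 1) (fun _ => le_rfl)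
      (fun r hr => hasSum_mul_moment hV hG hr) hB ?_
    · rw [hXg.self_of_nhds] at this
      simp at this; exact hg1 this
    · refine (tendsto_succ_mul_moment hX).congr fun j => ?_
      rw [h]; field_simp
  | succ n ih =>
    intro e G X g hGa hX hG h hg hg1 hXg
    -- Since X(1) = 0, passing to ((j+1)e_j, (tG)', -tX') preserves the moment relation and lowers
    -- the order of vanishing by one.
    have hX1 : X 1 = 0 := by rw [hXg.self_of_nhds]; simp
    refine ih (fun j => ((j : ℝ) + 1) * e j) (deriv fun t => t * G t) (fun t => - (t * deriv X t))
      (fun t => - (t * ((n + 1) * g t + (t - 1) * deriv g t)))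
      (analyticOnNhd_id.mul hGa).deriv (analyticOnNhd_id.mul hX.deriv).neg
      (fun t ht => hasSum_succ_mul_coeff hG ht) (fun j => ?_) ?_ ?_ ?_
    · have h1 := moment_by_parts hX j
      rw [hX1, ← h j] at h1
      rw [mul_assoc, h1, zero_sub, ← intervalIntegral.integral_neg]
      congr 1; ext t; ring
    · have := hg.deriv; fun_prop
    · simp only [one_mul, sub_self, zero_mul, add_zero]
      exact neg_ne_zero.2 (mul_ne_zero (by positivity) hg1)
    · filter_upwards [hXg.eventuallyEq_nhds, hg.eventually_analyticAt] with t ht htg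
      have h2 : HasDerivAt (fun t => (t - 1) ^ (n + 1) * g t)
          (((n + 1 : ℕ) : ℝ) * (t - 1) ^ n * 1 * g t + (t - 1) ^ (n + 1) * deriv g t) t :=
        (((hasDerivAt_id t).sub_const 1).pow (n + 1)).mul htg.differentiableAt.hasDerivAt
      rw [ht.deriv_eq, h2.deriv]
      push_cast; ring

/-- An analytic X that is not zero near 1 has a finite order there, which
`not_finite_order_of_moment_eq` excludes; the identity theorem does the rest. -/
theorem eqOn_zero_of_moment_eq {V : ℝ → ℝ} (hV : AnalyticOnNhd ℝ V (Icc 0 1))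
    {e : ℕ → ℝ} {G X : ℝ → ℝ} (hGa : AnalyticOnNhd ℝ G (Icc 0 1)) (hX : AnalyticOnNhd ℝ X (Icc 0 1))
    (hG : ∀ t ∈ Ioo (0 : ℝ) 1, HasSum (fun j => e j * t ^ j) (G t))
    (h : ∀ j : ℕ, e j * ∫ t in (0 : ℝ)..1, t ^ j * V t = ∫ t in (0 : ℝ)..1, t ^ j * X t) :
    EqOn X 0 (Icc 0 1) := by
  have h1 : (1 : ℝ) ∈ Icc (0 : ℝ) 1 := by simp
  by_cases hz : ∀ᶠ t in 𝓝 (1 : ℝ), X t = 0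
  · exact hX.eqOn_zero_of_preconnected_of_eventuallyEq_zero isPreconnected_Icc h1 hz
  · obtain ⟨n, g, hg, hg1, hXg⟩ := (hX 1 h1).exists_eventuallyEq_pow_smul_nonzero_iff.2 hz
    exact absurd hXg (not_finite_order_of_moment_eq hV n e G X g hGa hX hG h hg hg1)

theorem AnalyticOnNhd.exists_eq_add_one_sub_mul {F : ℝ → ℝ} (hF : AnalyticOnNhd ℝ F (Icc 0 1)) :
    ∃ F₁ : ℝ → ℝ, AnalyticOnNhd ℝ F₁ (Icc 0 1) ∧ ∀ t, F t = F 1 + (1 - t) * F₁ t := by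
  refine ⟨fun t => - dslope F 1 t, AnalyticOnNhd.neg fun t ht => ?_, fun t => ?_⟩
  · by_cases h : t = 1
    · subst h
      obtain ⟨q, hq⟩ := hF 1 ht
      exact hq.has_fpower_series_dslope_fslope.analyticAt
    · have h1 : AnalyticAt ℝ (fun s => (s - 1)⁻¹ * (F s - F 1)) t :=
        ((analyticAt_id.sub analyticAt_const).inv (sub_ne_zero.2 h)).mul
          ((hF t ht).sub analyticAt_const)
      refine h1.congr ?_
      filter_upwards [isOpen_ne.mem_nhds h] with s hs
      rw [dslope_of_ne _ hs, slope_def_field]; field_simp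
  · have := sub_smul_dslope F 1 t
    simp only [smul_eq_mul] at this
    linarith

/-- The polar part at 1 of a function with a pole of order three has coefficients quadratic in j. -/
theorem hasSum_quadratic_mul_pow (k₀ k₁ k₂ : ℝ) {t : ℝ} (ht : |t| < 1) :
    HasSum (fun j : ℕ => (k₀ * ((j + 1) * (j + 2) / 2) + k₁ * (j + 1) + k₂) * t ^ j)
      ((k₀ + k₁ * (1 - t) + k₂ * (1 - t) ^ 2) / (1 - t) ^ 3) := by
  have h0 := hasSum_choose_mul_geometric_of_norm_lt_one (𝕜 := ℝ) 0 ht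
  have h1 := hasSum_choose_mul_geometric_of_norm_lt_one (𝕜 := ℝ) 1 ht
  have h2 := hasSum_choose_mul_geometric_of_norm_lt_one (𝕜 := ℝ) 2 ht
  have hne : (1 - t) ≠ 0 := by linarith [(abs_lt.1 ht).2]
  have h := ((h2.mul_left k₀).add (h1.mul_left k₁)).add (h0.mul_left k₂)
  have h3 : k₀ * (1 / (1 - t) ^ (2 + 1)) + k₁ * (1 / (1 - t) ^ (1 + 1)) + k₂ * (1 / (1 - t) ^ (0 + 1))
      = (k₀ + k₁ * (1 - t) + k₂ * (1 - t) ^ 2) / (1 - t) ^ 3 := by field_simp; ring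
  rw [h3] at h
  refine h.congr_fun fun j => ?_
  rw [Nat.cast_choose_two]
  simp
  ring

/-- If `∑ b_j t^j` has a pole of order three at `1`, and the product of `b_j` with the moments
of `V` is `2j + l`, then `b_j` is quadratic in `j` and `V` solves an Euler equation. -/
theorem quadratic_of_moments {b : ℕ → ℝ} {p V : ℝ → ℝ} {l : ℝ} (hl : 0 < l)
    (hp : AnalyticOnNhd ℝ p (Icc 0 1)) (hV : AnalyticOnNhd ℝ V (Icc 0 1))
    (hsum : ∀ t ∈ Ioo (0 : ℝ) 1, HasSum (fun j => b j * t ^ j) (p t / (1 - t) ^ 3))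
    (hmom : ∀ j : ℕ, b j * ∫ t in (0 : ℝ)..1, t ^ j * V t = 2 * j + l) :
    ∃ k₁ k₂ : ℝ, (∀ t ∈ Ioo (0 : ℝ) 1, p t = p 1 + k₁ * (1 - t) + k₂ * (1 - t) ^ 2) ∧
      (∀ j : ℕ, b j = p 1 * ((j + 1) * (j + 2) / 2) + k₁ * (j + 1) + k₂) ∧
      ∀ t ∈ Icc (0 : ℝ) 1, p 1 / 2 * (t * deriv (fun s => s * deriv V s) t - t * deriv V t)
        - k₁ * (t * deriv V t) + k₂ * V t = 0 := by
  -- Taylor expansion of p at 1 to second order in 1 - t; p₃ is the analytic remainder, with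
  -- coefficients b_j - q_j.
  obtain ⟨p₁, hp1, hpp1⟩ := hp.exists_eq_add_one_sub_mul
  obtain ⟨p₂, hp2, hpp2⟩ := hp1.exists_eq_add_one_sub_mul
  obtain ⟨p₃, hp3, hpp3⟩ := hp2.exists_eq_add_one_sub_mul
  set k₀ := p 1 with hk0
  set k₁ := p₁ 1
  set k₂ := p₂ 1
  have hpt : ∀ t, p t = k₀ + k₁ * (1 - t) + k₂ * (1 - t) ^ 2 + (1 - t) ^ 3 * p₃ t := by
    intro t; rw [hpp1, hpp2, hpp3]; ring
  let q : ℕ → ℝ := fun j => k₀ * ((j + 1) * (j + 2) / 2) + k₁ * (j + 1) + k₂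
  have hG : ∀ t ∈ Ioo (0 : ℝ) 1, HasSum (fun j => (b j - q j) * t ^ j) (p₃ t) := by
    intro t ht
    have h1 := (hsum t ht).sub (hasSum_quadratic_mul_pow k₀ k₁ k₂
      (t := t) (by rw [abs_of_pos ht.1]; exact ht.2))
    have hne : 1 - t ≠ 0 := by linarith [ht.2]
    have h2 : p t / (1 - t) ^ 3 - (k₀ + k₁ * (1 - t) + k₂ * (1 - t) ^ 2) / (1 - t) ^ 3 = p₃ t := by
      rw [hpt]; field_simp; ring
    rw [h2] at h1
    exact h1.congr_fun fun j => by ring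
  set Y : ℝ → ℝ := fun t => t * deriv V t with hYdef
  have hY : AnalyticOnNhd ℝ Y (Icc 0 1) := analyticOnNhd_id.mul hV.deriv
  set Z : ℝ → ℝ := fun t => t * deriv Y t with hZdef
  have hZ : AnalyticOnNhd ℝ Z (Icc 0 1) := analyticOnNhd_id.mul hY.deriv
  -- By parts, multiplying the moments of V by q_j amounts to applying this Euler operator to V. The
  -- boundary terms at 1, together with 2j + l, are collected in d₁ and d₀.
  set W : ℝ → ℝ := fun t => k₀ / 2 * (Z t - Y t) - k₁ * Y t + k₂ * V t with hWdef
  have hW : AnalyticOnNhd ℝ W (Icc 0 1) :=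
    (((analyticOnNhd_const.mul (hZ.sub hY))).sub (analyticOnNhd_const.mul hY)).add
      (analyticOnNhd_const.mul hV)
  have hii : ∀ {F : ℝ → ℝ}, AnalyticOnNhd ℝ F (Icc 0 1) → ∀ j : ℕ,
      IntervalIntegrable (fun t => t ^ j * F t) volume 0 1 := fun {F} hF j => by
    have : ContinuousOn F (uIcc 0 1) := by simpa using hF.continuousOn
    exact ContinuousOn.intervalIntegrable (by fun_prop)
  have hWm : ∀ j : ℕ, ∫ t in (0 : ℝ)..1, t ^ j * W t =
      k₀ / 2 * ((∫ t in (0 : ℝ)..1, t ^ j * Z t) - ∫ t in (0 : ℝ)..1, t ^ j * Y t)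
        - k₁ * (∫ t in (0 : ℝ)..1, t ^ j * Y t) + k₂ * ∫ t in (0 : ℝ)..1, t ^ j * V t := by
    intro j
    have hz := hii hZ j
    have hy := hii hY j
    have hv := hii hV j
    rw [← intervalIntegral.integral_sub hz hy, ← intervalIntegral.integral_const_mul,
      ← intervalIntegral.integral_const_mul, ← intervalIntegral.integral_const_mul,
      ← intervalIntegral.integral_sub ((hz.sub hy).const_mul _) (hy.const_mul _),
      ← intervalIntegral.integral_add (((hz.sub hy).const_mul _).sub (hy.const_mul _))
        (hv.const_mul _)]
    congr 1; ext t; simp only [hWdef]; ring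
  set d₁ : ℝ := 2 - k₀ * V 1 / 2 with hd1
  set d₀ : ℝ := l - 2 - k₀ * V 1 / 2 + k₀ * Y 1 / 2 - k₁ * V 1 with hd0
  have hrel : ∀ j : ℕ, (b j - q j) * ∫ t in (0 : ℝ)..1, t ^ j * V t
      = d₁ * (j + 1) + d₀ - ∫ t in (0 : ℝ)..1, t ^ j * W t := by
    intro j
    have h1 := moment_by_parts hV j
    have h2 := moment_by_parts hY j
    rw [sub_mul, hmom, hWm]
    change _ = V 1 - ∫ t in (0 : ℝ)..1, t ^ j * Y t at h1
    change _ = Y 1 - ∫ t in (0 : ℝ)..1, t ^ j * Z t at h2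
    simp only [q, hd1, hd0]
    linear_combination (-k₀ / 2 * (j + 2) - k₁) * h1 + k₀ / 2 * h2
  obtain ⟨B, hB⟩ := abs_integral_comp_mul_le hV hp3
  have hW0 := tendsto_moment_zero hW
  have hinv := tendsto_one_div_add_atTop_nhds_zero_nat (𝕜 := ℝ)
  have hd1' : d₁ = 0 := by
    refine coeff_limit_eq_zero (w := fun j => (j : ℝ) + 1) (fun j => ?_)
      (fun r hr => hasSum_mul_moment hV hG hr) hB ?_
    · rw [div_le_iff₀ (by positivity)]; nlinarith [(Nat.cast_nonneg j : (0 : ℝ) ≤ j)]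
    · have h1 : Tendsto (fun j : ℕ => d₁ + (d₀ - ∫ t in (0 : ℝ)..1, t ^ j * W t) * (1 / ((j : ℝ) + 1)))
          atTop (𝓝 (d₁ + (d₀ - 0) * 0)) := ((hW0.const_sub d₀).mul hinv).const_add d₁
      simp only [mul_zero, add_zero] at h1
      refine h1.congr fun j => ?_
      rw [hrel]
      have : (j : ℝ) + 1 ≠ 0 := by positivity
      field_simp; ring
  have hd0' : d₀ = 0 := by
    refine coeff_limit_eq_zero (w := fun j => 1) (fun j => ?_)
      (fun r hr => hasSum_mul_moment hV hG hr) hB ?_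
    · rw [div_le_iff₀ (by positivity)]; nlinarith [(Nat.cast_nonneg j : (0 : ℝ) ≤ j)]
    · have h1 : Tendsto (fun j : ℕ => d₀ - ∫ t in (0 : ℝ)..1, t ^ j * W t) atTop (𝓝 (d₀ - 0)) :=
        hW0.const_sub d₀
      rw [sub_zero] at h1
      refine h1.congr fun j => ?_
      rw [hrel, hd1']; ring
  have hWz : EqOn (fun t => - W t) 0 (Icc 0 1) := by
    refine eqOn_zero_of_moment_eq hV hp3 hW.neg hG fun j => ?_
    rw [hrel, hd1', hd0', zero_mul, zero_add, zero_sub, ← intervalIntegral.integral_neg]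
    congr 1; ext t; ring
  have hWz' : ∀ t ∈ Icc (0 : ℝ) 1, W t = 0 := fun t ht => neg_eq_zero.1 (hWz ht)
  have he : ∀ j, b j - q j = 0 := by
    intro j
    have h1 := hrel j
    have h2 : ∫ t in (0 : ℝ)..1, t ^ j * W t = 0 := by
      rw [intervalIntegral.integral_congr (g := fun _ => 0) (fun t ht => ?_)]
      · simp
      · rw [uIcc_of_le zero_le_one] at ht; simp [hWz' t ht]
    rw [hd1', hd0', h2] at h1
    -- Its product with b_j is 2j + l > 0.
    have h3 : (∫ t in (0 : ℝ)..1, t ^ j * V t) ≠ 0 := by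
      intro h
      have := hmom j
      rw [h, mul_zero] at this
      have : (0 : ℝ) < 2 * j + l := by positivity
      linarith
    simpa [h3] using h1
  refine ⟨k₁, k₂, fun t ht => ?_, fun j => sub_eq_zero.1 (he j), hWz'⟩
  have h1 := hG t ht
  simp_rw [he, zero_mul] at h1
  rw [hpt, h1.unique hasSum_zero]; ring

/-! ### Euler equations with analytic solutions. -/

theorem euler_deriv_pow_mul {F g : ℝ → ℝ} {n : ℕ} (hg : AnalyticAt ℝ g 0)
    (h : F =ᶠ[𝓝 0] fun t => t ^ n * g t) :
    (fun t => t * deriv F t) =ᶠ[𝓝 0] fun t => t ^ n * (n * g t + t * deriv g t) := by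
  filter_upwards [h.eventuallyEq_nhds, hg.eventually_analyticAt] with t ht hgt
  have h2 : HasDerivAt (fun t => t ^ n * g t) (n * t ^ (n - 1) * g t + t ^ n * deriv g t) t :=
    (hasDerivAt_pow n t).mul hgt.differentiableAt.hasDerivAt
  rw [ht.deriv_eq, h2.deriv]
  rcases n with _ | n
  · simp
  · simp only [Nat.add_sub_cancel]; ring

/-- The Euler operator `a (t d/dt)² + b (t d/dt) + c`. -/
noncomputable def eulerOp (a b c : ℝ) (F : ℝ → ℝ) (t : ℝ) : ℝ :=
  a * (t * deriv (fun s => s * deriv F s) t) + b * (t * deriv F t) + c * F t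

theorem eulerOp_pow_mul {F g : ℝ → ℝ} {n : ℕ} {a b c : ℝ} (hg : AnalyticAt ℝ g 0)
    (h : F =ᶠ[𝓝 0] fun t => t ^ n * g t) :
    ∃ r : ℝ → ℝ, AnalyticAt ℝ r 0 ∧ eulerOp a b c F =ᶠ[𝓝 0] fun t =>
      t ^ n * ((a * n ^ 2 + b * n + c) * g t + t * r t) := by
  have h1 := euler_deriv_pow_mul hg h
  have hg' := hg.deriv
  have h2 := euler_deriv_pow_mul (by fun_prop) h1
  have hd : AnalyticAt ℝ (fun t => n * g t + t * deriv g t) 0 := by fun_prop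
  have hd' := hd.deriv
  refine ⟨fun t => a * (n * deriv g t + deriv (fun t => n * g t + t * deriv g t) t)
    + b * deriv g t, by fun_prop, ?_⟩
  filter_upwards [h, h1, h2] with t ht ht1 ht2
  rw [eulerOp, ht2, ht1, ht]; ring

/-- The operator multiplies the leading coefficient by the indicial polynomial, so the order of a
nonzero solution is an indicial root. -/
theorem eulerOp_leading_exponent {F g : ℝ → ℝ} {n : ℕ} {a b c : ℝ} (hg : AnalyticAt ℝ g 0)
    (hg0 : g 0 ≠ 0) (h : F =ᶠ[𝓝 0] fun t => t ^ n * g t)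
    (hE : eulerOp a b c F =ᶠ[𝓝 0] 0) : a * n ^ 2 + b * n + c = 0 := by
  obtain ⟨r, hr, h1⟩ := eulerOp_pow_mul (a := a) (b := b) (c := c) hg h
  have h2 : ∀ᶠ t in 𝓝[≠] (0 : ℝ), (a * n ^ 2 + b * n + c) * g t + t * r t = 0 := by
    filter_upwards [(h1.symm.trans hE).filter_mono nhdsWithin_le_nhds, self_mem_nhdsWithin] with t ht h0
    exact (mul_eq_zero.1 ht).resolve_left (pow_ne_zero _ h0)
  have h3 : ContinuousAt (fun t => (a * n ^ 2 + b * n + c) * g t + t * r t) 0 := by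
    have := hg.continuousAt; have := hr.continuousAt; fun_prop
  have h4 := tendsto_nhds_unique (h3.tendsto.mono_left nhdsWithin_le_nhds)
    ((tendsto_congr' h2).2 tendsto_const_nhds)
  simpa [hg0] using h4

/-- For an indicial root n the monomial t^n is itself a solution; subtract it by linearity. -/
theorem eulerOp_sub_monomial {F : ℝ → ℝ} {n : ℕ} {a b c k : ℝ} (hF : AnalyticAt ℝ F 0)
    (hn : a * n ^ 2 + b * n + c = 0) (hE : eulerOp a b c F =ᶠ[𝓝 0] 0) :
    eulerOp a b c (fun t => F t - t ^ n * k) =ᶠ[𝓝 0] 0 := by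
  have hm : AnalyticAt ℝ (fun t : ℝ => t ^ n * k) 0 := by fun_prop
  have key : ∀ {A B : ℝ → ℝ}, AnalyticAt ℝ A 0 → AnalyticAt ℝ B 0 →
      (fun t => t * deriv (fun s => A s - B s) t) =ᶠ[𝓝 0]
        fun t => t * deriv A t - t * deriv B t := by
    intro A B hA hB
    filter_upwards [hA.eventually_analyticAt, hB.eventually_analyticAt] with t h1 h2
    rw [deriv_fun_sub h1.differentiableAt h2.differentiableAt]; ring
  have h1 := key hF hm
  have hF' := hF.deriv
  have hm' := hm.deriv
  have h2 := key (A := fun t => t * deriv F t) (B := fun t => t * deriv (fun s => s ^ n * k) t)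
    (by fun_prop) (by fun_prop)
  have h3 : eulerOp a b c (fun t => t ^ n * k) =ᶠ[𝓝 0] 0 := by
    have e1 := euler_deriv_pow_mul (F := fun t => t ^ n * k) (g := fun _ => k) (n := n)
      analyticAt_const (Eventually.of_forall fun t => rfl)
    have e2 := euler_deriv_pow_mul (by fun_prop) e1
    filter_upwards [e1, e2] with t h1 h2
    simp only [eulerOp, h1, h2]
    simp
    linear_combination (k * t ^ n) * hn
  filter_upwards [h1, h1.eventuallyEq_nhds, h2, hE, h3] with t h1 h1' h2 hE h3
  have h4 : deriv (fun s => s * deriv (fun t => F t - t ^ n * k) s) t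
      = deriv (fun s => s * deriv F s - s * deriv (fun t => t ^ n * k) s) t := h1'.deriv_eq
  simp only [eulerOp, Pi.zero_apply] at hE h3 ⊢
  rw [h4, h2, h1]
  linear_combination hE - h3

/-- Removing the leading monomial strictly raises the order at 0: otherwise dividing by t^n' and
letting t → 0 would give g'(0) = 0. -/
theorem leading_exponent_lt {F g g' : ℝ → ℝ} {n n' : ℕ} (hg : AnalyticAt ℝ g 0)
    (hg' : AnalyticAt ℝ g' 0) (hg0 : g' 0 ≠ 0) (h : F =ᶠ[𝓝 0] fun t => t ^ n * g t)
    (h' : (fun t => F t - t ^ n * g 0) =ᶠ[𝓝 0] fun t => t ^ n' * g' t) : n < n' := by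
  by_contra! hle
  obtain ⟨k, rfl⟩ := Nat.exists_eq_add_of_le hle
  have h2 : ∀ᶠ t in 𝓝[≠] (0 : ℝ), t ^ k * (g t - g 0) - g' t = 0 := by
    filter_upwards [h.filter_mono nhdsWithin_le_nhds, h'.filter_mono nhdsWithin_le_nhds,
      self_mem_nhdsWithin] with t ht ht' h0
    rw [ht] at ht'
    have : t ^ n' * (t ^ k * (g t - g 0) - g' t) = 0 := by
      simp only [pow_add] at ht'; linear_combination ht'
    exact (mul_eq_zero.1 this).resolve_left (pow_ne_zero _ h0)
  have h3 : ContinuousAt (fun t => t ^ k * (g t - g 0) - g' t) 0 := by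
    have := hg.continuousAt; have := hg'.continuousAt; fun_prop
  have h4 := tendsto_nhds_unique (h3.tendsto.mono_left nhdsWithin_le_nhds)
    ((tendsto_congr' h2).2 tendsto_const_nhds)
  simp at h4
  exact hg0 h4

/-- An analytic solution of a second order Euler equation is a polynomial. -/
theorem exists_polynomial_of_eulerOp {V : ℝ → ℝ} {a b c : ℝ} (ha : a ≠ 0) (hV : AnalyticAt ℝ V 0)
    (hE : eulerOp a b c V =ᶠ[𝓝 0] 0) :
    ∃ P : Polynomial ℝ, V =ᶠ[𝓝 0] fun t => P.eval t := by
  by_contra! hP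
  -- Peel off leading monomials. If V is not a polynomial this can be done three times, and the
  -- quadratic indicial polynomial, with a ≠ 0, would have three distinct roots.
  have step : ∀ {F : ℝ → ℝ}, AnalyticAt ℝ F 0 → eulerOp a b c F =ᶠ[𝓝 0] 0 → ¬ F =ᶠ[𝓝 0] 0 →
      ∃ (n : ℕ) (g : ℝ → ℝ), AnalyticAt ℝ g 0 ∧ g 0 ≠ 0 ∧ (F =ᶠ[𝓝 0] fun t => t ^ n * g t) ∧
        a * n ^ 2 + b * n + c = 0 ∧ eulerOp a b c (fun t => F t - t ^ n * g 0) =ᶠ[𝓝 0] 0 ∧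
        AnalyticAt ℝ (fun t => F t - t ^ n * g 0) 0 := by
    intro F hF hE hz
    obtain ⟨n, g, hg, hg1, hXg⟩ := hF.exists_eventuallyEq_pow_smul_nonzero_iff.2 hz
    have h1 : F =ᶠ[𝓝 0] fun t => t ^ n * g t := by
      filter_upwards [hXg] with t ht; simpa using ht
    have h2 := eulerOp_leading_exponent hg hg1 h1 hE
    exact ⟨n, g, hg, hg1, h1, h2, eulerOp_sub_monomial hF h2 hE, by fun_prop⟩
  obtain ⟨n₁, g₁, hg1, hg1', h1, r1, E1, A1⟩ := step hV hE fun h =>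
    hP 0 (h.trans (Eventually.of_forall fun t => by simp))
  obtain ⟨n₂, g₂, hg2, hg2', h2, r2, E2, A2⟩ := step A1 E1 fun h =>
    hP (Polynomial.X ^ n₁ * Polynomial.C (g₁ 0)) (by
      filter_upwards [h] with t ht
      simp at ht ⊢; linarith)
  obtain ⟨n₃, g₃, hg3, hg3', h3, r3, -, -⟩ := step A2 E2 fun h =>
    hP (Polynomial.X ^ n₁ * Polynomial.C (g₁ 0) + Polynomial.X ^ n₂ * Polynomial.C (g₂ 0)) (by
      filter_upwards [h] with t ht
      simp at ht ⊢; linarith)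
  have l1 := leading_exponent_lt hg1 hg2 hg2' h1 h2
  have l2 := leading_exponent_lt hg2 hg3 hg3' h2 h3
  have l1' : (n₁ : ℝ) < n₂ := by exact_mod_cast l1
  have l2' : (n₂ : ℝ) < n₃ := by exact_mod_cast l2
  have e1 : ((n₂ : ℝ) - n₁) * (a * (n₂ + n₁) + b) = 0 := by linear_combination r2 - r1
  have e2 : ((n₃ : ℝ) - n₂) * (a * (n₃ + n₂) + b) = 0 := by linear_combination r3 - r2
  have e1' := (mul_eq_zero.1 e1).resolve_left (by linarith)
  have e2' := (mul_eq_zero.1 e2).resolve_left (by linarith)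
  have e3 : a * ((n₃ : ℝ) - n₁) = 0 := by linear_combination e2' - e1'
  rcases mul_eq_zero.1 e3 with h | h
  · exact ha h
  · linarith

/-! ### Exclusion of the polynomial solutions. -/

open Polynomial in
-- The left side has degree at least 8. On the right T has degree at most 3 and the other factor at
-- most 4, so the degree is at most 7.
theorem no_polynomial_of_quadratic {q₀ q₁ q₂ κ m : ℝ} {V : ℝ[X]} (hV : V ≠ 0) (hq₂ : q₂ ≠ 0)
    (Q T : ℝ[X]) (hQ : Q = C q₂ * X ^ 2 + C q₁ * X + C q₀)
    (hT : T = C m * Q * (1 - X) + X * derivative Q * (1 - X) + 3 * X * Q)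
    (h : Q ^ 4 * V = C κ * (T * (derivative T * Q * (1 - X) - T * derivative Q * (1 - X) + T * Q))) :
    False := by
  have hT' : T = C ((1 - m) * q₂) * X ^ 3 + C (m * (q₂ - q₁) + 2 * q₂ + 2 * q₁) * X ^ 2
      + C (m * (q₁ - q₀) + q₁ + 3 * q₀) * X + C (m * q₀) := by
    rw [hT, hQ]; simp [map_ofNat]; ring
  generalize (1 - m) * q₂ = a₃ at hT'
  generalize m * (q₂ - q₁) + 2 * q₂ + 2 * q₁ = a₂ at hT'
  generalize m * (q₁ - q₀) + q₁ + 3 * q₀ = a₁ at hT'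
  generalize m * q₀ = a₀ at hT'
  -- The coefficient of X^5 is -3a₃q₂ + 2a₃q₂ + a₃q₂ = 0; without this cancellation the degree count
  -- would not decide.
  have hB : ∃ b₀ b₁ b₂ b₃ b₄ : ℝ, derivative T * Q * (1 - X) - T * derivative Q * (1 - X) + T * Q
      = C b₄ * X ^ 4 + C b₃ * X ^ 3 + C b₂ * X ^ 2 + C b₁ * X + C b₀ := by
    refine ⟨a₁ * q₀ - a₀ * q₁ + a₀ * q₀,
      2 * a₂ * q₀ - a₁ * q₀ - 2 * a₀ * q₂ + a₀ * q₁ + a₁ * q₀ + a₀ * q₁ ,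
      (3 * a₃ * q₀ + a₂ * q₁ - a₁ * q₂) - (2 * a₂ * q₀ - 2 * a₀ * q₂) + a₂ * q₀ + a₁ * q₁ + a₀ * q₂,
      (2 * a₃ * q₁) - (3 * a₃ * q₀ + a₂ * q₁ - a₁ * q₂) + a₃ * q₀ + a₂ * q₁ + a₁ * q₂,
      a₃ * q₂ - 2 * a₃ * q₁ + a₃ * q₁ + a₂ * q₂, ?_⟩
    rw [hT', hQ]; simp [map_ofNat]; ring
  obtain ⟨b₀, b₁, b₂, b₃, b₄, hB⟩ := hB
  rw [hB] at h
  have hd1 : T.natDegree ≤ 3 := by rw [hT']; compute_degree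
  have hd2 : (C b₄ * X ^ 4 + C b₃ * X ^ 3 + C b₂ * X ^ 2 + C b₁ * X + C b₀ : ℝ[X]).natDegree ≤ 4 := by
    compute_degree
  have hQd : Q.natDegree = 2 := by rw [hQ]; compute_degree!
  have hQ0 : Q ≠ 0 := by rintro rfl; simp at hQd
  have e1 : (Q ^ 4 * V).natDegree = 8 + V.natDegree := by
    rw [natDegree_mul (pow_ne_zero _ hQ0) hV, natDegree_pow, hQd]
  have e2 : (Q ^ 4 * V).natDegree ≤ 7 := by
    rw [h]
    refine (natDegree_C_mul_le _ _).trans ((natDegree_mul_le).trans ?_)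
    omega
  omega

open Polynomial in
-- The moment relation makes p and V polynomials; the identity `hpV` then leaves only constant p,
-- for which the moments j = 0 and j = 1 force κ = 4/9 and 4m = 3.
theorem no_balanced_power_series {b : ℕ → ℝ} {p V T : ℝ → ℝ} {m : ℕ} {κ : ℝ}
    (hp : AnalyticOnNhd ℝ p (Icc 0 1)) (hV : AnalyticOnNhd ℝ V (Icc 0 1))
    (hp0 : p 0 ≠ 0) (hp1 : p 1 ≠ 0)
    (hsum : ∀ t ∈ Ioo (0 : ℝ) 1, HasSum (fun j => b j * t ^ j) (p t / (1 - t) ^ 3))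
    (hmom : ∀ j : ℕ, b j * ∫ t in (0 : ℝ)..1, t ^ j * V t = 2 * (m + j : ℕ) + 1)
    (hT : ∀ t ∈ Ioo (0 : ℝ) 1, T t = m * p t * (1 - t) + t * deriv p t * (1 - t) + 3 * t * p t)
    (hpV : ∀ t ∈ Ioo (0 : ℝ) 1, p t ^ 4 * V t
      = κ * (T t * (deriv T t * p t * (1 - t) - T t * deriv p t * (1 - t) + T t * p t))) :
    False := by
  obtain ⟨k₁, k₂, hpq, hbq, hW⟩ := quadratic_of_moments (l := 2 * m + 1) (by positivity) hp hV hsum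
    (fun j => by rw [hmom]; push_cast; ring)
  have h0 : (0 : ℝ) ∈ Icc (0 : ℝ) 1 := by simp
  have hE : eulerOp (p 1 / 2) (- (p 1 / 2) - k₁) k₂ V =ᶠ[𝓝 0] 0 := by
    have hY : AnalyticOnNhd ℝ (fun t => t * deriv V t) (Icc 0 1) := analyticOnNhd_id.mul hV.deriv
    have hZ : AnalyticOnNhd ℝ (fun t => t * deriv (fun s => s * deriv V s) t) (Icc 0 1) :=
      analyticOnNhd_id.mul hY.deriv
    have hA : AnalyticAt ℝ (eulerOp (p 1 / 2) (- (p 1 / 2) - k₁) k₂ V) 0 := by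
      have := hZ 0 h0; have := hY 0 h0; have := hV 0 h0
      unfold eulerOp; fun_prop
    -- The Euler equation is known only to the right of 0; isolation of zeros extends it to a full
    -- neighbourhood.
    rcases hA.eventually_eq_zero_or_eventually_ne_zero with h | h
    · exact h
    · exfalso
      have h1 : ∀ᶠ t in 𝓝[>] (0 : ℝ), t ∈ Ioo (0 : ℝ) 1 := Ioo_mem_nhdsGT one_pos
      have h2 := h.filter_mono (nhdsWithin_mono (0 : ℝ) (s := Ioi 0) (fun x hx => ne_of_gt hx))
      obtain ⟨t, ht, ht'⟩ := (h1.and h2).exists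
      refine ht' ?_
      have := hW t ⟨ht.1.le, ht.2.le⟩
      unfold eulerOp; linear_combination this
  obtain ⟨P, hP⟩ := exists_polynomial_of_eulerOp (by simpa using hp1) (hV 0 h0) hE
  have hVP : EqOn V (fun t => P.eval t) (Icc 0 1) :=
    hV.eqOn_of_preconnected_of_eventuallyEq
      (fun t _ => AnalyticOnNhd.eval_polynomial P t (mem_univ t)) isPreconnected_Icc h0 hP
  have hmV : ∀ j : ℕ, ∫ t in (0 : ℝ)..1, t ^ j * V t = ∫ t in (0 : ℝ)..1, t ^ j * P.eval t := fun j =>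
    intervalIntegral.integral_congr fun t ht => by
      rw [uIcc_of_le zero_le_one] at ht; simp only [hVP ht]
  have hP0 : P ≠ 0 := by
    rintro rfl
    have := hmom 0
    rw [hmV] at this
    simp at this
    have h3 : (0 : ℝ) ≤ m := Nat.cast_nonneg m
    linarith
  obtain ⟨q₀, q₁, q₂, Q, hQ, hpQ⟩ : ∃ (q₀ q₁ q₂ : ℝ) (Q : ℝ[X]),
      Q = C q₂ * X ^ 2 + C q₁ * X + C q₀ ∧ ∀ t ∈ Ioo (0 : ℝ) 1, p t = Q.eval t :=
    ⟨p 1 + k₁ + k₂, - k₁ - 2 * k₂, k₂, _, rfl, fun t ht => by rw [hpq t ht]; simp; ring⟩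
  have hpQ' : EqOn p (fun t => Q.eval t) (Icc 0 1) := by
    refine hp.eqOn_of_preconnected_of_eventuallyEq (z₀ := 1 / 2)
      (fun t _ => AnalyticOnNhd.eval_polynomial Q t (mem_univ t)) isPreconnected_Icc
      ⟨by norm_num, by norm_num⟩ ?_
    filter_upwards [isOpen_Ioo.mem_nhds (show (1 / 2 : ℝ) ∈ Ioo (0 : ℝ) 1 by norm_num)] using hpQ
  have hderiv : ∀ {F : ℝ → ℝ} {R : ℝ[X]}, (∀ t ∈ Ioo (0 : ℝ) 1, F t = R.eval t) →
      ∀ t ∈ Ioo (0 : ℝ) 1, deriv F t = (derivative R).eval t := by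
    intro F R h t ht
    have : F =ᶠ[𝓝 t] fun t => R.eval t := by
      filter_upwards [isOpen_Ioo.mem_nhds ht] using h
    rw [this.deriv_eq, Polynomial.deriv]
  let S : ℝ[X] := C (m : ℝ) * Q * (1 - X) + X * derivative Q * (1 - X) + 3 * X * Q
  have hTS : ∀ t ∈ Ioo (0 : ℝ) 1, T t = S.eval t := by
    intro t ht
    rw [hT t ht, hderiv hpQ t ht, hpQ t ht]
    simp [S]
  have hpoly : Q ^ 4 * P
      = C κ * (S * (derivative S * Q * (1 - X) - S * derivative Q * (1 - X) + S * Q)) := by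
    refine eq_of_infinite_eval_eq _ _ ((Ioo_infinite (zero_lt_one (α := ℝ))).mono fun t ht => ?_)
    have h1 := hpV t ht
    rw [hderiv hTS t ht, hTS t ht, hderiv hpQ t ht, hpQ t ht, hVP ⟨ht.1.le, ht.2.le⟩] at h1
    simpa using h1
  by_cases hq2 : q₂ = 0
  swap
  · exact no_polynomial_of_quadratic hP0 hq2 Q S hQ rfl hpoly
  have hQ0 : p 0 = q₀ := by rw [hpQ' (by simp)]; simp [hQ]
  have hQ1 : p 1 = q₁ + q₀ := by rw [hpQ' (by simp)]; simp [hQ, hq2]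
  have hq0 : q₀ ≠ 0 := hQ0 ▸ hp0
  have hκ : κ ≠ 0 := by
    rintro rfl
    have hQne : Q ≠ 0 := by
      rintro rfl
      have := hpQ' (x := 0) (by simp)
      simp at this; exact hp0 this
    rw [C_0, zero_mul] at hpoly
    exact (mul_ne_zero (pow_ne_zero 4 hQne) hP0) hpoly
  by_cases hq1 : q₁ = 0
  swap
  -- At the root x of Q the left side vanishes, while T(x) = x q₁(1-x) and the right side is -κ
  -- T(x)² q₁(1-x). Here x ≠ 0 as p(0) ≠ 0, and 1 - x = p(1)/q₁ ≠ 0.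
  · have h1 := congrArg (Polynomial.eval (- q₀ / q₁)) hpoly
    have h2 : Q.eval (- q₀ / q₁) = 0 := by rw [hQ, hq2]; simp; field_simp; ring
    have h3 : (derivative Q).eval (- q₀ / q₁) = q₁ := by rw [hQ, hq2]; simp
    simp [S, h2, h3] at h1
    have h4 : 1 - - q₀ / q₁ = p 1 / q₁ := by rw [hQ1]; field_simp; ring
    rw [h4] at h1
    simp [hκ, hq1, hq0, hp1] at h1
  · have hQc : Q = C q₀ := by rw [hQ, hq2, hq1]; simp
    -- With Q = q₀, T is q₀(m + (3-m)t) and the bracket in `hpoly` collapses to 3q₀².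
    have hPe : ∀ t : ℝ, q₀ * P.eval t = 3 * κ * (m + (3 - m) * t) := by
      intro t
      have h1 := congrArg (Polynomial.eval t) hpoly
      simp [S, hQc] at h1
      have h2 : q₀ ^ 3 * (q₀ * P.eval t) = q₀ ^ 3 * (3 * κ * (m + (3 - m) * t)) := by
        linear_combination h1
      exact mul_left_cancel₀ (pow_ne_zero 3 hq0) h2
    have hb : ∀ j : ℕ, b j = q₀ * ((j + 1) * (j + 2) / 2) := by
      intro j
      have h1 := hpq (1 / 2) (by norm_num)
      have h2 := hpq (1 / 3) (by norm_num)
      rw [hpQ _ (by norm_num), hQc, eval_C, hQ1, hq1, zero_add] at h1 h2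
      have hk2 : k₂ = 0 := by linarith
      have hk1 : k₁ = 0 := by rw [hk2] at h1; linarith
      rw [hbq, hk1, hk2, hQ1, hq1]; ring
    have hint : ∀ j : ℕ, q₀ * ∫ t in (0 : ℝ)..1, t ^ j * V t
        = 3 * κ * (m / (j + 1) + (3 - m) / (j + 2)) := by
      intro j
      rw [hmV, ← intervalIntegral.integral_const_mul]
      have : ∀ t : ℝ, q₀ * (t ^ j * P.eval t)
          = 3 * κ * m * t ^ j + 3 * κ * (3 - m) * t ^ (j + 1) := by
        intro t; linear_combination t ^ j * hPe t
      simp_rw [this]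
      rw [intervalIntegral.integral_add (Continuous.intervalIntegrable (by fun_prop) _ _)
        (Continuous.intervalIntegrable (by fun_prop) _ _), intervalIntegral.integral_const_mul,
        intervalIntegral.integral_const_mul, integral_pow, integral_pow]
      push_cast
      simp
      field_simp
      ring
    have e0 := hmom 0
    have e1 := hmom 1
    have i0 := hint 0
    have i1 := hint 1
    rw [hb] at e0 e1
    push_cast at e0 e1 i0 i1
    have f0 : 3 * κ * (m + (3 - m) / 2) = 2 * m + 1 := by linear_combination e0 - i0
    have f1 : 9 * κ * (m / 2 + (3 - m) / 3) = 2 * m + 3 := by linear_combination e1 - 3 * i1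
    have hk : κ = 4 / 9 := by linarith
    rw [hk] at f0
    have f2 : (4 : ℝ) * m = 3 := by linarith
    have f3 : 4 * m = 3 := by exact_mod_cast f2
    omega

/-! ### Radial profiles: density, moments and the radial form of the balanced equation. -/

/-- The logarithmic slope `t g'(t)` of `g = log (1 / f)`. -/
noncomputable def logSlope (f : ℝ → ℝ) (t : ℝ) : ℝ := t * deriv (fun s => Real.log (1 / f s)) t

/-- The radial density `f³ (L²)'`, where `L` is the logarithmic slope of `f`. -/
noncomputable def radialDensity (f : ℝ → ℝ) (t : ℝ) : ℝ :=
  f t ^ 3 * (2 * logSlope f t * deriv (logSlope f) t)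

/-- The moments of the radial density. -/
noncomputable def radialMoment (f : ℝ → ℝ) (m : ℤ) : ENNReal :=
  ∫⁻ t in Ioo (0 : ℝ) 1, ENNReal.ofReal (t ^ m * radialDensity f t)

/-- `f` is a positive radial profile on `(0,1)` with `log (1 / f)` strictly plurisubharmonic. -/
structure IsRadialProfile (f : ℝ → ℝ) : Prop where
  contDiffOn : ContDiffOn ℝ ∞ f (Ioo 0 1)
  pos : ∀ t ∈ Ioo (0 : ℝ) 1, 0 < f t
  slope_pos : ∀ t ∈ Ioo (0 : ℝ) 1, 0 < logSlope f t
  deriv_slope_pos : ∀ t ∈ Ioo (0 : ℝ) 1, 0 < deriv (logSlope f) t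

namespace IsRadialProfile

variable {f : ℝ → ℝ}

theorem contDiffOn_log (hf : IsRadialProfile f) :
    ContDiffOn ℝ ∞ (fun s => Real.log (1 / f s)) (Ioo 0 1) :=
  (contDiffOn_const.div hf.contDiffOn fun t ht => (hf.pos t ht).ne').log
    fun t ht => (one_div_pos.2 (hf.pos t ht)).ne'

theorem contDiffOn_logSlope (hf : IsRadialProfile f) : ContDiffOn ℝ ∞ (logSlope f) (Ioo 0 1) :=
  contDiffOn_id.mul (hf.contDiffOn_log.deriv_of_isOpen isOpen_Ioo (by simp))

theorem contDiffOn_radialDensity (hf : IsRadialProfile f) :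
    ContDiffOn ℝ ∞ (radialDensity f) (Ioo 0 1) :=
  (hf.contDiffOn.pow 3).mul ((contDiffOn_const.mul hf.contDiffOn_logSlope).mul
    (hf.contDiffOn_logSlope.deriv_of_isOpen isOpen_Ioo (by simp)))

theorem differentiableAt {t : ℝ} (hf : IsRadialProfile f) (ht : t ∈ Ioo (0 : ℝ) 1) :
    DifferentiableAt ℝ f t :=
  (hf.contDiffOn.differentiableOn (by simp)).differentiableAt (isOpen_Ioo.mem_nhds ht)

theorem hasDerivAt_logSlope {t : ℝ} (hf : IsRadialProfile f) (ht : t ∈ Ioo (0 : ℝ) 1) :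
    HasDerivAt (logSlope f) (deriv (logSlope f) t) t :=
  ((hf.contDiffOn_logSlope.differentiableOn (by simp)).differentiableAt
    (isOpen_Ioo.mem_nhds ht)).hasDerivAt

theorem radialDensity_pos {t : ℝ} (hf : IsRadialProfile f) (ht : t ∈ Ioo (0 : ℝ) 1) :
    0 < radialDensity f t := by
  have h1 := hf.pos t ht
  have h2 := hf.slope_pos t ht
  have h3 := hf.deriv_slope_pos t ht
  unfold radialDensity; positivity

theorem logSlope_eq {t : ℝ} (hf : IsRadialProfile f) (ht : t ∈ Ioo (0 : ℝ) 1) :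
    logSlope f t = - (t * deriv f t / f t) := by
  have h := (hf.differentiableAt ht).hasDerivAt.log (hf.pos t ht).ne'
  have h1 : (fun s => Real.log (1 / f s)) = fun s => - Real.log (f s) := by
    ext s; rw [one_div, Real.log_inv]
  rw [logSlope, h1, h.fun_neg.deriv]; ring

/-- The factor f³ cancels all denominators, so the density continues analytically across a zero of f
at t = 1. -/
theorem radialDensity_eq {t : ℝ} (hf : IsRadialProfile f) (ht : t ∈ Ioo (0 : ℝ) 1) :
    radialDensity f t = 2 * (t * deriv f t) * (f t * deriv f t + t * f t * deriv (deriv f) t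
      - t * deriv f t ^ 2) := by
  have h1 : logSlope f =ᶠ[𝓝 t] fun t => - (t * deriv f t / f t) := by
    filter_upwards [isOpen_Ioo.mem_nhds ht] with s hs using hf.logSlope_eq hs
  have hd : HasDerivAt f (deriv f t) t := (hf.differentiableAt ht).hasDerivAt
  have hdd : HasDerivAt (deriv f) (deriv (deriv f) t) t :=
    (((hf.contDiffOn.deriv_of_isOpen isOpen_Ioo (m := ∞) (by simp)).differentiableOn
      (by simp)).differentiableAt (isOpen_Ioo.mem_nhds ht)).hasDerivAt
  have h0 := (hf.pos t ht).ne'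
  have h2 := ((((hasDerivAt_id t).mul hdd).div hd h0).fun_neg)
  rw [radialDensity, h1.deriv_eq, hf.logSlope_eq ht]
  have h3 := h2.deriv
  simp only [id, one_mul, Pi.mul_apply] at h3
  change deriv (fun t => - (t * deriv f t / f t)) t = _ at h3
  rw [h3]
  field_simp

/-- The logarithmic derivative of t^m f³ is (m - 3L)/t ≥ 0 on (0, 1/2], so t^m f³ is bounded there
by its value at 1/2. The other factor (L²)' is integrable because L² is monotone. -/
theorem integrableOn_left (hf : IsRadialProfile f) {m : ℕ} (hm : 3 * logSlope f (1 / 2) ≤ m) :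
    IntegrableOn (fun t => t ^ m * radialDensity f t) (Ioc 0 (1 / 2)) := by
  have hsub : ∀ t ∈ Ioc (0 : ℝ) (1 / 2), t ∈ Ioo (0 : ℝ) 1 := fun t ht =>
    ⟨ht.1, ht.2.trans_lt (by norm_num)⟩
  have hmono : StrictMonoOn (logSlope f) (Ioo 0 1) := by
    refine strictMonoOn_of_deriv_pos (convex_Ioo 0 1) hf.contDiffOn_logSlope.continuousOn ?_
    simpa using hf.deriv_slope_pos
  -- Monotone also at the endpoint 0, where the factor t makes `logSlope` vanish whatever the
  -- derivative there.
  have hL : MonotoneOn (fun t => logSlope f t ^ 2) (uIcc (0 : ℝ) (1 / 2)) := by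
    rw [uIcc_of_le (by norm_num)]
    intro s hs t ht hst
    rcases hs.1.eq_or_lt with h | h
    · rw [← h]; simp only [logSlope, zero_mul, zero_pow two_ne_zero]; positivity
    · have hs' := hsub s ⟨h, hs.2⟩
      exact pow_le_pow_left₀ (hf.slope_pos s hs').le
        (hmono.monotoneOn hs' (hsub t ⟨h.trans_le hst, ht.2⟩) hst) 2
  have hint := hL.intervalIntegrable_deriv.1
  have hψ : MonotoneOn (fun t => t ^ m * f t ^ 3) (Ioc (0 : ℝ) (1 / 2)) := by
    refine monotoneOn_of_deriv_nonneg (convex_Ioc _ _) ?_ ?_ ?_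
    · exact (continuousOn_pow m).mul
        ((hf.contDiffOn.continuousOn.mono hsub).pow 3)
    · rw [interior_Ioc]
      intro t ht
      have := hf.differentiableAt (hsub t ⟨ht.1, ht.2.le⟩)
      exact DifferentiableAt.differentiableWithinAt (by fun_prop)
    · rw [interior_Ioc]
      intro t ht
      have ht' := hsub t ⟨ht.1, ht.2.le⟩
      have hd := (hasDerivAt_pow m t).mul ((hf.differentiableAt ht').hasDerivAt.fun_pow 3)
      have h0 := hf.pos t ht'
      have hl := hf.logSlope_eq ht'
      have hle : logSlope f t ≤ logSlope f (1 / 2) :=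
        hmono.monotoneOn ht' (by norm_num) ht.2.le
      have e : deriv f t * t = - (logSlope f t * f t) := by rw [hl]; field_simp
      rw [show (fun t => t ^ m * f t ^ 3) = (fun t : ℝ => t ^ m) * (fun t => f t ^ 3) from rfl,
        hd.deriv]
      have h3 : (m * t ^ (m - 1)) * f t ^ 3 + t ^ m * ((3 : ℕ) * f t ^ (3 - 1) * deriv f t)
          = (t ^ m * f t ^ 3 * (m - 3 * logSlope f t)) / t := by
        rw [eq_div_iff ht.1.ne']
        have h4 : (m : ℝ) * t ^ (m - 1) * t = m * t ^ m := by
          rcases m with _ | m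
          · simp
          · simp [pow_succ]; ring
        push_cast
        linear_combination f t ^ 3 * h4 + 3 * t ^ m * f t ^ 2 * e
      rw [h3]
      have : 0 ≤ (m : ℝ) - 3 * logSlope f t := by linarith
      have := ht.1
      positivity
  refine (hint.const_mul ((1 / 2) ^ m * f (1 / 2) ^ 3)).mono' ?_ ?_
  · refine ContinuousOn.aestronglyMeasurable ?_ measurableSet_Ioc
    exact (continuousOn_pow m).mul (hf.contDiffOn_radialDensity.continuousOn.mono hsub)
  · refine (ae_restrict_mem measurableSet_Ioc).mono fun t ht => ?_
    have ht' := hsub t ht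
    have h0 := hf.radialDensity_pos ht'
    have hd : deriv (fun t => logSlope f t ^ 2) t = 2 * logSlope f t * deriv (logSlope f) t := by
      rw [((hf.hasDerivAt_logSlope ht').fun_pow 2).deriv]; simp
    have h1 : 0 < 2 * logSlope f t * deriv (logSlope f) t := by
      have h2 := hf.slope_pos t ht'
      have h3 := hf.deriv_slope_pos t ht'
      positivity
    have h4 : (0 : ℝ) < t ^ m := pow_pos ht.1 m
    rw [Real.norm_eq_abs, abs_of_pos (by positivity), hd, radialDensity, ← mul_assoc]
    exact mul_le_mul_of_nonneg_right (hψ ht (by norm_num) ht.2) h1.le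

theorem exists_analytic_density (hf : IsRadialProfile f) {F : ℝ → ℝ} (hF : AnalyticAt ℝ F 1)
    (hfF : f =ᶠ[𝓝[<] 1] F) :
    ∃ H : ℝ → ℝ, AnalyticAt ℝ H 1 ∧ radialDensity f =ᶠ[𝓝[<] 1] H := by
  have h1 := hF.deriv
  have h2 := h1.deriv
  refine ⟨fun t => 2 * (t * deriv F t) * (F t * deriv F t + t * F t * deriv (deriv F) t
      - t * deriv F t ^ 2), by fun_prop, ?_⟩
  obtain ⟨a, ha, ha'⟩ := mem_nhdsLT_iff_exists_Ioo_subset.1 hfF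
  have hev : ∀ t ∈ Ioo a 1, f =ᶠ[𝓝 t] F := fun t ht => by
    filter_upwards [isOpen_Ioo.mem_nhds ht] using ha'
  filter_upwards [Ioo_mem_nhdsLT ha, Ioo_mem_nhdsLT (zero_lt_one (α := ℝ))] with t ht ht'
  rw [hf.radialDensity_eq ht', (hev t ht).deriv.deriv_eq, (hev t ht).deriv_eq,
    (hev t ht).self_of_nhds]

/-- Only t = 0 can cause divergence, and a high power of t cures it: near 1 the density has an
analytic continuation, in between it is continuous. -/
theorem exists_radialMoment_lt_top (hf : IsRadialProfile f) {F : ℝ → ℝ} (hF : AnalyticAt ℝ F 1)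
    (hfF : f =ᶠ[𝓝[<] 1] F) : ∃ m : ℕ, radialMoment f m < ⊤ := by
  obtain ⟨m, hm⟩ := exists_nat_ge (3 * logSlope f (1 / 2))
  obtain ⟨H, hH, hfH⟩ := hf.exists_analytic_density hF hfF
  refine ⟨m, ?_⟩
  obtain ⟨a, ha, ha'⟩ := mem_nhdsLT_iff_exists_Ioo_subset.1
    (hfH.and (hH.eventually_analyticAt.filter_mono nhdsWithin_le_nhds))
  obtain ⟨b, hb1, hb2⟩ := exists_between (max_lt ha (by norm_num : (1 / 2 : ℝ) < 1))
  have hb : a < b := (le_max_left _ _).trans_lt hb1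
  have hb' : 1 / 2 < b := (le_max_right _ _).trans_lt hb1
  have hi2 : IntegrableOn (fun t => t ^ m * radialDensity f t) (Icc (1 / 2) b) := by
    refine ContinuousOn.integrableOn_Icc ((continuousOn_pow m).mul
      (hf.contDiffOn_radialDensity.continuousOn.mono fun t ht => ⟨?_, ?_⟩))
    · linarith [ht.1]
    · linarith [ht.2]
  have hi3 : IntegrableOn (fun t => t ^ m * radialDensity f t) (Ioo b 1) := by
    have hc : ContinuousOn (fun t => t ^ m * H t) (Icc b 1) := by
      refine (continuousOn_pow m).mul fun t ht => ?_
      rcases ht.2.eq_or_lt with h | h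
      · subst h; exact hH.continuousAt.continuousWithinAt
      · exact (ha' ⟨hb.trans_le ht.1, h⟩).2.continuousAt.continuousWithinAt
    refine (hc.integrableOn_Icc.mono_set Ioo_subset_Icc_self).congr_fun (fun t ht => ?_)
      measurableSet_Ioo
    simp only
    rw [(ha' ⟨hb.trans ht.1, ht.2⟩ : _ ∧ _).1]
  have hi : IntegrableOn (fun t => t ^ m * radialDensity f t) (Ioo 0 1) := by
    refine (((hf.integrableOn_left hm).union hi2).union hi3).mono_set fun t ht => ?_
    rcases le_or_gt t (1 / 2) with h | h
    · exact Or.inl (Or.inl ⟨ht.1, h⟩)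
    · rcases le_or_gt t b with h' | h'
      · exact Or.inl (Or.inr ⟨h.le, h'⟩)
      · exact Or.inr ⟨h', ht.2⟩
  simpa [radialMoment] using hi.lintegral_lt_top

theorem radialMoment_mono {m n : ℕ} (hf : IsRadialProfile f) (hmn : m ≤ n) :
    radialMoment f n ≤ radialMoment f m := by
  refine setLIntegral_mono_ae' measurableSet_Ioo (Eventually.of_forall fun t ht => ?_)
  simp only [zpow_natCast]
  refine ENNReal.ofReal_le_ofReal (mul_le_mul_of_nonneg_right ?_ (hf.radialDensity_pos ht).le)
  exact pow_le_pow_of_le_one ht.1.le ht.2.le hmn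

theorem aemeasurable_moment (hf : IsRadialProfile f) (m : ℤ) :
    AEMeasurable (fun t => t ^ m * radialDensity f t) (volume.restrict (Ioo 0 1)) := by
  refine ContinuousOn.aemeasurable ?_ measurableSet_Ioo
  exact (continuousOn_zpow₀ m |>.mono fun t ht => ht.1.ne').mul
    hf.contDiffOn_radialDensity.continuousOn

theorem radialMoment_pos (hf : IsRadialProfile f) (m : ℤ) : 0 < radialMoment f m := by
  refine lt_of_le_of_ne bot_le fun h => ?_
  have h1 := (lintegral_eq_zero_iff' (hf.aemeasurable_moment m).ennreal_ofReal).1 h.symm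
  rw [EventuallyEq, ae_restrict_iff' measurableSet_Ioo] at h1
  have h2 : volume (Ioo (0 : ℝ) 1) = 0 := by
    refine measure_mono_null (fun t ht => ?_) (ae_iff.1 h1)
    have h1 := hf.radialDensity_pos ht
    have h2 : 0 < t ^ m := zpow_pos ht.1 m
    simp only [mem_ofPred_eq, Classical.not_imp, Pi.zero_apply, ENNReal.ofReal_eq_zero, not_le]
    exact ⟨ht, by positivity⟩
  simp at h2

end IsRadialProfile

theorem analyticAt_powerSeries {e : ℕ → ℝ} (he : ∀ t ∈ Ioo (0 : ℝ) 1, Summable fun j => e j * t ^ j)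
    {t : ℝ} (ht : |t| < 1) : AnalyticAt ℝ (fun t => ∑' j, e j * t ^ j) t := by
  let P := FormalMultilinearSeries.ofScalars ℝ e
  have hr : 1 ≤ P.radius := by
    refine ENNReal.le_of_forall_nnreal_lt fun r hr => ?_
    have hr' : (r : ℝ) < 1 := by exact_mod_cast hr
    refine P.le_radius_of_summable ?_
    rcases eq_or_lt_of_le r.coe_nonneg with h | h
    · refine summable_of_ne_finset_zero (s := {0}) fun j hj => ?_
      have : (r : ℝ) = 0 := h.symm
      simp at hj; simp [this, hj]
    · have h1 := (he r ⟨h, hr'⟩).norm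
      refine Summable.of_nonneg_of_le (fun j => by positivity) (fun j => ?_) h1
      rw [norm_mul, norm_pow, Real.norm_of_nonneg r.coe_nonneg]
      refine mul_le_mul_of_nonneg_right ?_ (by positivity)
      simp [P]
  have h1 : HasFPowerSeriesOnBall P.sum P 0 P.radius := P.hasFPowerSeriesOnBall
    (lt_of_lt_of_le (by simp) hr)
  have h2 : P.sum = fun t => ∑' j, e j * t ^ j := by
    ext t
    simp [P, FormalMultilinearSeries.sum, FormalMultilinearSeries.ofScalars, smul_eq_mul]
  rw [← h2]
  refine h1.analyticAt_of_mem (lt_of_lt_of_le ?_ hr)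
  rw [edist_zero_right, ← ofReal_norm, ← ENNReal.ofReal_one, Real.norm_eq_abs]
  exact (ENNReal.ofReal_lt_ofReal_iff one_pos).2 ht

namespace IsRadialProfile

variable {f : ℝ → ℝ}

/-- Expression of the radial density through the power series of `1 / f³`. -/
theorem radialDensity_eq_of_pow {p : ℝ → ℝ} {C : ℝ} {m : ℕ} {t : ℝ} (hf : IsRadialProfile f)
    (hC : 0 < C) (hp : ∀ t ∈ Ioo (0 : ℝ) 1, 0 < p t) (hpa : ∀ t ∈ Ioo (0 : ℝ) 1, AnalyticAt ℝ p t)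
    (hfp : ∀ t ∈ Ioo (0 : ℝ) 1, t ^ m * p t * f t ^ 3 = C * (1 - t) ^ 3) {T : ℝ → ℝ}
    (hT : T = fun t => m * p t * (1 - t) + t * deriv p t * (1 - t) + 3 * t * p t)
    (ht : t ∈ Ioo (0 : ℝ) 1) :
    t ^ m * radialDensity f t = 2 * C / 9 *
      (T t * (deriv T t * p t * (1 - t) - T t * deriv p t * (1 - t) + T t * p t)) / p t ^ 4 := by
  -- Taking logarithms in `hfp` makes the logarithmic slope equal to T/(3p(1-t)); this is the origin
  -- of T.
  have hlog : ∀ t ∈ Ioo (0 : ℝ) 1, Real.log (1 / f t)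
      = 1 / 3 * (m * Real.log t + Real.log (p t) - 3 * Real.log (1 - t) - Real.log C) := by
    intro t ht
    have h1 := hf.pos t ht
    have h2 := hp t ht
    have h3 : 0 < 1 - t := by linarith [ht.2]
    have h4 := ht.1
    have h := congrArg Real.log (hfp t ht)
    rw [Real.log_mul (by positivity) (by positivity), Real.log_mul (by positivity) (by positivity),
      Real.log_mul (by positivity) (by positivity), Real.log_pow, Real.log_pow, Real.log_pow] at h
    rw [one_div, Real.log_inv]
    push_cast at h
    linarith
  have hL : ∀ t ∈ Ioo (0 : ℝ) 1, logSlope f t = T t / (3 * (p t * (1 - t))) := by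
    intro t ht
    have h2 := hp t ht
    have h3 : 0 < 1 - t := by linarith [ht.2]
    have h4 := ht.1
    have hev : (fun t => Real.log (1 / f t)) =ᶠ[𝓝 t] fun t =>
        1 / 3 * (m * Real.log t + Real.log (p t) - 3 * Real.log (1 - t) - Real.log C) := by
      filter_upwards [isOpen_Ioo.mem_nhds ht] using hlog
    have hd1 : HasDerivAt (fun t => Real.log (1 - t)) (-1 / (1 - t)) t :=
      ((hasDerivAt_id t).const_sub 1).log h3.ne'
    have hd : HasDerivAt (fun t => 1 / 3 * (m * Real.log t + Real.log (p t)
        - 3 * Real.log (1 - t) - Real.log C))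
        (1 / 3 * (m * t⁻¹ + deriv p t / p t - 3 * (-1 / (1 - t)))) t :=
      ((((((Real.hasDerivAt_log h4.ne').const_mul (m : ℝ)).add
        ((hpa t ht).differentiableAt.hasDerivAt.log h2.ne')).sub (hd1.const_mul 3))).sub_const
          _).const_mul _
    rw [logSlope, hev.deriv_eq, hd.deriv, hT]
    field_simp
    ring
  have h1 := hf.pos t ht
  have h2 := hp t ht
  have h3 : 0 < 1 - t := by linarith [ht.2]
  have h4 := ht.1
  have hpd := (hpa t ht).differentiableAt.hasDerivAt
  have hTd : HasDerivAt T (deriv T t) t := by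
    have h1 := hpa t ht
    have h2 := h1.deriv
    have : AnalyticAt ℝ T t := by rw [hT]; fun_prop
    exact this.differentiableAt.hasDerivAt
  have hev : logSlope f =ᶠ[𝓝 t] fun t => T t / (3 * (p t * (1 - t))) := by
    filter_upwards [isOpen_Ioo.mem_nhds ht] using hL
  have hd : HasDerivAt (fun t => T t / (3 * (p t * (1 - t))))
      ((deriv T t * (3 * (p t * (1 - t))) - T t * (3 * (deriv p t * (1 - t) + p t * (-1))))
        / (3 * (p t * (1 - t))) ^ 2) t :=
    hTd.div ((hpd.mul ((hasDerivAt_id t).const_sub 1)).const_mul 3) (by positivity)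
  rw [radialDensity, hev.deriv_eq, hd.deriv, hL t ht]
  have hf3 : f t ^ 3 = C * (1 - t) ^ 3 / (t ^ m * p t) := by
    rw [eq_div_iff (by positivity)]; linarith [hfp t ht]
  rw [hf3]
  field_simp
  ring

/-- The balanced condition in radial form has no solution that is analytic at the boundary. -/
theorem not_balanced {F : ℝ → ℝ} (hf : IsRadialProfile f) (hF : AnalyticAt ℝ F 1) (hF1 : F 1 = 0)
    (hF' : deriv F 1 ≠ 0) (hfF : f =ᶠ[𝓝[<] 1] F) (C : ℝ)
    (hK : ∀ t ∈ Ioo (0 : ℝ) 1, HasSum (fun m : ℕ =>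
      (2 * (m : ℝ) + 1) / (radialMoment f m).toReal * t ^ m) (C / f t ^ 3)) : False := by
  classical
  have hex := hf.exists_radialMoment_lt_top hF hfF
  -- Least index with finite moment. Lower moments are infinite, so their `toReal` is 0 and, with
  -- x/0 = 0, the kernel series starts at t^m.
  set m := Nat.find hex with hm
  have hfin : ∀ j : ℕ, radialMoment f (m + j : ℕ) < ⊤ := fun j =>
    (hf.radialMoment_mono (Nat.le_add_right m j)).trans_lt (Nat.find_spec hex)
  have hpos : ∀ j : ℕ, 0 < (radialMoment f (m + j : ℕ)).toReal := fun j =>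
    ENNReal.toReal_pos (hf.radialMoment_pos _).ne' (hfin j).ne
  have hzero : ∀ n < m, (radialMoment f (n : ℕ)).toReal = 0 := fun n hn => by
    have := Nat.find_min hex hn
    simp only [not_lt, top_le_iff] at this
    simp [this]
  set b : ℕ → ℝ := fun j => (2 * (m + j : ℕ) + 1) / (radialMoment f (m + j : ℕ)).toReal with hb
  have hbpos : ∀ j, 0 < b j := fun j => div_pos (by positivity) (hpos j)
  have hPsum : ∀ t ∈ Ioo (0 : ℝ) 1, HasSum (fun j => b j * t ^ j) (C / f t ^ 3 / t ^ m) := by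
    intro t ht
    have h1 := (hasSum_nat_add_iff' m).2 (hK t ht)
    rw [Finset.sum_eq_zero, sub_zero] at h1
    · refine (h1.div_const (t ^ m)).congr_fun fun j => ?_
      have := ht.1.ne'
      simp only [hb]
      rw [add_comm j m, pow_add]
      field_simp
    · intro n hn
      rw [hzero n (Finset.mem_range.1 hn)]; simp
  set P : ℝ → ℝ := fun t => ∑' j, b j * t ^ j with hP
  have hPeq : ∀ t ∈ Ioo (0 : ℝ) 1, P t = C / f t ^ 3 / t ^ m := fun t ht => (hPsum t ht).tsum_eq
  have hPpos : ∀ t ∈ Ico (0 : ℝ) 1, 0 < P t := by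
    intro t ht
    have hs : Summable fun j => b j * t ^ j := by
      rcases ht.1.eq_or_lt with h | h
      · refine summable_of_ne_finset_zero (s := {0}) fun j hj => ?_
        simp at hj; simp [← h, hj]
      · exact (hPsum t ⟨h, ht.2⟩).summable
    refine hs.tsum_pos (fun j => mul_nonneg (hbpos j).le (pow_nonneg ht.1 j)) 0 ?_
    simpa using hbpos 0
  have hC : 0 < C := by
    have h0 : (1 / 2 : ℝ) ∈ Ioo (0 : ℝ) 1 := by norm_num
    have h1 := hPpos (1 / 2) ⟨h0.1.le, h0.2⟩
    rw [hPeq _ h0, div_div] at h1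
    have h2 := hf.pos _ h0
    by_contra! hle
    exact absurd h1 (not_lt.2 (div_nonpos_of_nonpos_of_nonneg hle (by positivity)))
  -- the analytic continuation of `(1 - t)³ P` across `t = 1`
  have hda : AnalyticAt ℝ (dslope F 1) 1 := by
    obtain ⟨q, hq⟩ := hF
    exact hq.has_fpower_series_dslope_fslope.analyticAt
  have hd1 : dslope F 1 1 ≠ 0 := by rwa [dslope_same]
  have hFd : ∀ t, F t = (t - 1) * dslope F 1 t := fun t => by
    have := sub_smul_dslope F 1 t
    rw [hF1, sub_zero] at this
    exact this.symm
  -- Since F(t) = (t-1) `dslope F 1 t`, this is (1-t)³ C/(t^m F³), which has no singularity at 1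
  -- because F'(1) ≠ 0.
  let p₁ : ℝ → ℝ := fun t => - C / (t ^ m * dslope F 1 t ^ 3)
  have hp1a : AnalyticAt ℝ p₁ 1 := by
    have : (1 : ℝ) ^ m * dslope F 1 1 ^ 3 ≠ 0 := by simpa using hd1
    exact analyticAt_const.div ((analyticAt_id.pow m).mul (hda.pow 3)) this
  let p : ℝ → ℝ := fun t => if t < 1 then (1 - t) ^ 3 * P t else p₁ t
  have hplt : ∀ t < 1, p t = (1 - t) ^ 3 * P t := fun t ht => if_pos ht
  have hp1 : p =ᶠ[𝓝 1] p₁ := by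
    have h1 : ∀ᶠ t in 𝓝[<] (1 : ℝ), p t = p₁ t := by
      filter_upwards [hfF, Ioo_mem_nhdsLT (zero_lt_one (α := ℝ))] with t ht ht'
      have h1 := (hf.pos t ht').ne'
      have h2 := ht'.1.ne'
      have h3 : t - 1 ≠ 0 := by linarith [ht'.2]
      rw [hplt t ht'.2, hPeq t ht']
      rw [ht, hFd] at h1
      rw [ht, hFd]
      have h4 := right_ne_zero_of_mul h1
      simp only [p₁]
      rw [show (1 - t) ^ 3 = - (t - 1) ^ 3 by ring]
      field_simp
    rw [EventuallyEq, ← nhdsLT_sup_nhdsGE, eventually_sup]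
    refine ⟨h1, ?_⟩
    filter_upwards [self_mem_nhdsWithin] with t ht
    exact if_neg (not_lt.2 ht)
  have hPa : ∀ t, |t| < 1 → AnalyticAt ℝ p t := fun t ht => by
    have h1 := analyticAt_powerSeries (fun t ht => (hPsum t ht).summable) ht
    have h2 : AnalyticAt ℝ (fun t => (1 - t) ^ 3 * P t) t := by fun_prop
    refine h2.congr ?_
    filter_upwards [isOpen_Iio.mem_nhds (abs_lt.1 ht).2] with s hs using (hplt s hs).symm
  have hpa : AnalyticOnNhd ℝ p (Icc 0 1) := by
    intro t ht
    rcases ht.2.eq_or_lt with h | h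
    · rw [h]; exact hp1a.congr hp1.symm
    · exact hPa t (by rw [abs_of_nonneg ht.1]; exact h)
  have hppos : ∀ t ∈ Ico (0 : ℝ) 1, 0 < p t := fun t ht => by
    rw [hplt t ht.2]
    have := hPpos t ht
    have h3 : 0 < 1 - t := by linarith [ht.2]
    positivity
  have hp1ne : p 1 ≠ 0 := by
    rw [hp1.self_of_nhds]; simp [p₁, hC.ne', hF']
  have hpne : ∀ t ∈ Icc (0 : ℝ) 1, p t ≠ 0 := by
    intro t ht
    rcases ht.2.eq_or_lt with h | h
    · rw [h]; exact hp1ne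
    · exact (hppos t ⟨ht.1, h⟩).ne'
  have hIoo : Ioo (0 : ℝ) 1 ⊆ Icc 0 1 := Ioo_subset_Icc_self
  -- The expressions of `radialDensity_eq_of_pow`; V is analytic on the closed interval because p
  -- has no zero there.
  let T : ℝ → ℝ := fun t => m * p t * (1 - t) + t * deriv p t * (1 - t) + 3 * t * p t
  let V : ℝ → ℝ := fun t => 2 * C / 9 *
      (T t * (deriv T t * p t * (1 - t) - T t * deriv p t * (1 - t) + T t * p t)) / p t ^ 4
  have hTa : AnalyticOnNhd ℝ T (Icc 0 1) := fun t ht => by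
    have h1 := hpa t ht
    have h2 := h1.deriv
    simp only [T]; fun_prop
  have hVa : AnalyticOnNhd ℝ V (Icc 0 1) := fun t ht => by
    have h1 := hpa t ht
    have h2 := h1.deriv
    have h3 := hTa t ht
    have h4 := h3.deriv
    exact AnalyticAt.div (by fun_prop) (by fun_prop) (pow_ne_zero 4 (hpne t ht))
  have hdens : ∀ t ∈ Ioo (0 : ℝ) 1, t ^ m * radialDensity f t = V t := by
    intro t ht
    refine hf.radialDensity_eq_of_pow hC (fun t ht => hppos t ⟨ht.1.le, ht.2⟩)
      (fun t ht => hpa t (hIoo ht)) (fun t ht => ?_) rfl ht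
    have h1 := (hf.pos t ht).ne'
    have h2 := ht.1.ne'
    rw [hplt t ht.2, hPeq t ht]
    field_simp
  have hmom : ∀ j : ℕ, b j * ∫ t in (0 : ℝ)..1, t ^ j * V t = 2 * (m + j : ℕ) + 1 := by
    intro j
    have h1 : ∫ t in (0 : ℝ)..1, t ^ j * V t = (radialMoment f (m + j : ℕ)).toReal := by
      rw [intervalIntegral.integral_of_le zero_le_one, integral_Ioc_eq_integral_Ioo]
      have h2 : ∫ t in Ioo (0 : ℝ) 1, t ^ j * V t
          = ∫ t in Ioo (0 : ℝ) 1, t ^ ((m + j : ℕ) : ℤ) * radialDensity f t := by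
        refine setIntegral_congr_fun measurableSet_Ioo fun t ht => ?_
        simp only [← hdens t ht, zpow_natCast, pow_add]; ring
      rw [h2, integral_eq_lintegral_of_nonneg_ae ?_ (hf.aemeasurable_moment _).aestronglyMeasurable]
      · rfl
      · refine (ae_restrict_mem measurableSet_Ioo).mono fun t ht => ?_
        exact mul_nonneg (zpow_nonneg ht.1.le _) (hf.radialDensity_pos ht).le
    rw [h1, hb]
    exact div_mul_cancel₀ _ (hpos j).ne'
  refine no_balanced_power_series (p := p) (T := T) (κ := 2 * C / 9) hpa hVa
    (hpne 0 (by simp)) hp1ne (fun t ht => ?_) hmom (fun t _ => rfl) (fun t ht => ?_)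
  · have h3 : (1 - t) ≠ 0 := by linarith [ht.2]
    rw [hplt t ht.2, hPeq t ht, mul_div_cancel_left₀ _ (pow_ne_zero 3 h3)]
    exact hPsum t ht
  · simp only [V]
    rw [mul_div_cancel₀ _ (pow_ne_zero 4 (hpne t (hIoo ht)))]

end IsRadialProfile

/-! ### Cauchy estimates and derivatives of holomorphic maps. -/

/-- Cauchy estimate for a holomorphic map between normed spaces. -/
theorem norm_fderiv_le_of_forall_mem_ball {V F : Type*} [NormedAddCommGroup V] [NormedSpace ℂ V]
    [NormedAddCommGroup F] [NormedSpace ℂ F] {ψ : V → F} {x : V} {r M : ℝ} (hr : 0 < r)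
    (hd : DifferentiableOn ℂ ψ (Metric.ball x (2 * r)))
    (hM : ∀ y ∈ Metric.ball x (2 * r), ‖ψ y‖ ≤ M) : ‖fderiv ℂ ψ x‖ ≤ M / r := by
  have hx : x ∈ Metric.ball x (2 * r) := Metric.mem_ball_self (by positivity)
  have hM0 : 0 ≤ M := (norm_nonneg _).trans (hM x hx)
  refine ContinuousLinearMap.opNorm_le_bound _ (by positivity) fun v => ?_
  rcases eq_or_ne v 0 with rfl | hv
  · simp
  have hv' : 0 < ‖v‖ := norm_pos_iff.2 hv
  have hmaps : ∀ ζ ∈ Metric.closedBall (0 : ℂ) (r / ‖v‖), x + ζ • v ∈ Metric.ball x (2 * r) := by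
    intro ζ hζ
    rw [mem_closedBall_zero_iff, le_div_iff₀ hv'] at hζ
    rw [Metric.mem_ball, dist_eq_norm, add_sub_cancel_left, norm_smul]
    linarith
  have hline : ∀ ζ : ℂ, HasDerivAt (fun ζ : ℂ => x + ζ • v) v ζ := fun ζ => by
    simpa using ((hasDerivAt_id ζ).smul_const v).const_add x
  have h1 : HasDerivAt (fun ζ : ℂ => ψ (x + ζ • v)) (fderiv ℂ ψ x v) 0 := by
    have h2 : HasFDerivAt ψ (fderiv ℂ ψ x) (x + (0 : ℂ) • v) := by
      simpa using (hd.differentiableAt (Metric.isOpen_ball.mem_nhds hx)).hasFDerivAt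
    exact h2.comp_hasDerivAt 0 (hline 0)
  have h2 := Complex.norm_deriv_le_of_forall_mem_sphere_norm_le (c := 0) (R := r / ‖v‖) (C := M)
    (f := fun ζ : ℂ => ψ (x + ζ • v)) (by positivity) ?_ ?_
  · rw [h1.deriv] at h2
    calc _ ≤ M / (r / ‖v‖) := h2
      _ = _ := by field_simp
  · refine (DifferentiableOn.diffContOnCl_ball (U := Metric.closedBall 0 (r / ‖v‖)) ?_ subset_rfl)
    exact hd.comp (fun ζ _ => (hline ζ).differentiableAt.differentiableWithinAt) hmaps
  · exact fun ζ hζ => hM _ (hmaps ζ (Metric.sphere_subset_closedBall hζ))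

/-- Directional derivatives of holomorphic maps in several variables are holomorphic. -/
theorem differentiableOn_fderiv_apply {V F : Type*} [NormedAddCommGroup V]
    [NormedSpace ℂ V] [FiniteDimensional ℂ V] [NormedAddCommGroup F] [NormedSpace ℂ F]
    [FiniteDimensional ℂ F] {ψ : V → F} {U : Set V} (hψ : DifferentiableOn ℂ ψ U) (hU : IsOpen U)
    (v : V) : DifferentiableOn ℂ (fun y => fderiv ℂ ψ y v) U := by
  have : CompleteSpace F := FiniteDimensional.complete ℂ F
  have : ProperSpace V := FiniteDimensional.proper ℂ V
  have : ProperSpace (V →L[ℂ] F) := FiniteDimensional.proper ℂ _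
  borelize V
  borelize F
  borelize (V →L[ℂ] F)
  intro x hx
  refine DifferentiableAt.differentiableWithinAt ?_
  -- Room for two steps: circles around points of the ε-ball stay within 2ε, and the Cauchy estimate
  -- at their points needs another 2ε.
  obtain ⟨ε, hε, hball, M, hM⟩ : ∃ ε > 0, Metric.ball x (4 * ε) ⊆ U ∧
      ∃ M, ∀ y ∈ Metric.ball x (4 * ε), ‖ψ y‖ ≤ M := by
    have h1 := (hψ.continuousOn.continuousAt (hU.mem_nhds hx)).norm.eventually_lt_const
      (lt_add_one ‖ψ x‖)
    obtain ⟨ε, hε, h⟩ := Metric.mem_nhds_iff.1 (h1.and (hU.mem_nhds hx))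
    refine ⟨ε / 4, by positivity, ?_, ‖ψ x‖ + 1, ?_⟩
    · rw [mul_div_cancel₀ _ (by norm_num)]; exact fun y hy => (h hy).2
    · rw [mul_div_cancel₀ _ (by norm_num)]; exact fun y hy => (h hy).1.le
  set r : ℝ := ε / (‖v‖ + 1) with hr
  have hr0 : 0 < r := by positivity
  have hrv : r * ‖v‖ ≤ ε := by
    rw [hr, div_mul_eq_mul_div, div_le_iff₀ (by positivity)]
    nlinarith [norm_nonneg v]
  have hmaps : ∀ y ∈ Metric.ball x ε, ∀ ζ ∈ Metric.closedBall (0 : ℂ) r,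
      y + ζ • v ∈ Metric.ball x (2 * ε) := by
    intro y hy ζ hζ
    rw [mem_closedBall_zero_iff] at hζ
    rw [Metric.mem_ball, dist_eq_norm] at hy ⊢
    calc ‖y + ζ • v - x‖ = ‖(y - x) + ζ • v‖ := by congr 1; abel
      _ ≤ ‖y - x‖ + ‖ζ • v‖ := norm_add_le _ _
      _ < ε + ε := by
        rw [norm_smul]
        have : ‖ζ‖ * ‖v‖ ≤ r * ‖v‖ := by gcongr
        linarith
      _ = 2 * ε := by ring
  have hbig : Metric.ball x (2 * ε) ⊆ Metric.ball x (4 * ε) := Metric.ball_subset_ball (by linarith)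
  have hline : ∀ (y : V) (ζ : ℂ), HasDerivAt (fun ζ : ℂ => y + ζ • v) v ζ := fun y ζ => by
    simpa using ((hasDerivAt_id ζ).smul_const v).const_add y
  have hψd : DifferentiableOn ℂ ψ (Metric.ball x (4 * ε)) := hψ.mono hball
  have hψd2 : ∀ y ∈ Metric.ball x (2 * ε), HasFDerivAt ψ (fderiv ℂ ψ y) y := fun y hy =>
    (hψd.differentiableAt (Metric.isOpen_ball.mem_nhds (hbig hy))).hasFDerivAt
  have hcauchy : ∀ y ∈ Metric.ball x (2 * ε), ‖fderiv ℂ ψ y‖ ≤ M / ε := by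
    intro y hy
    have hsub : Metric.ball y (2 * ε) ⊆ Metric.ball x (4 * ε) := by
      refine Metric.ball_subset_ball' ?_
      rw [Metric.mem_ball] at hy; linarith
    exact norm_fderiv_le_of_forall_mem_ball hε (hψd.mono hsub) fun z hz => hM z (hsub hz)
  have hcirc : ∀ θ : ℝ, circleMap 0 r θ ∈ Metric.closedBall (0 : ℂ) r := fun θ =>
    circleMap_mem_closedBall _ hr0.le _
  -- Cauchy's formula on the complex line through y in direction v. It is then differentiated in y
  -- under the integral sign, dominated by the Cauchy estimate.
  have hform : ∀ y ∈ Metric.ball x ε, fderiv ℂ ψ y v = (2 * Real.pi * Complex.I : ℂ)⁻¹ •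
      ∫ θ in (0 : ℝ)..2 * Real.pi, deriv (circleMap 0 r) θ •
        ((circleMap 0 r θ - 0) ^ 2)⁻¹ • ψ (y + circleMap 0 r θ • v) := by
    intro y hy
    have hy2 : y ∈ Metric.ball x (2 * ε) := by
      simpa using hmaps y hy 0 (Metric.mem_closedBall_self hr0.le)
    have h1 : HasDerivAt (fun ζ : ℂ => ψ (y + ζ • v)) (fderiv ℂ ψ y v) 0 := by
      have h2 : HasFDerivAt ψ (fderiv ℂ ψ y) (y + (0 : ℂ) • v) := by simpa using hψd2 y hy2
      exact h2.comp_hasDerivAt 0 (hline y 0)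
    have hopen : IsOpen ((fun ζ : ℂ => y + ζ • v) ⁻¹' Metric.ball x (2 * ε)) :=
      Metric.isOpen_ball.preimage (by fun_prop)
    have h2 := Complex.cderiv_eq_deriv (f := fun ζ : ℂ => ψ (y + ζ • v)) hopen
      (fun ζ hζ => ((hψd2 _ hζ).comp_hasDerivAt ζ (hline y ζ)).differentiableAt.differentiableWithinAt)
      hr0 (hmaps y hy)
    rw [← h1.deriv, ← h2]
    rfl
  have hcont : ∀ y ∈ Metric.ball x ε, Continuous fun θ : ℝ => ψ (y + circleMap 0 r θ • v) := by
    intro y hy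
    refine continuous_iff_continuousAt.2 fun θ => ?_
    refine ContinuousAt.comp (f := fun θ : ℝ => y + circleMap 0 r θ • v)
      (hψd2 _ (hmaps y hy _ (hcirc θ))).continuousAt ?_
    fun_prop
  have hcoef : Continuous fun θ : ℝ => deriv (circleMap 0 r) θ * ((circleMap 0 r θ - 0) ^ 2)⁻¹ := by
    simp only [deriv_circleMap]
    refine Continuous.mul (by fun_prop) (Continuous.inv₀ (by fun_prop) fun θ => ?_)
    simp [hr0.ne']
  obtain ⟨B, hB⟩ := (isCompact_Icc (a := (0 : ℝ)) (b := 2 * Real.pi)).exists_bound_of_continuousOn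
    hcoef.continuousOn
  have hxε : x ∈ Metric.ball x ε := Metric.mem_ball_self hε
  have key := intervalIntegral.hasFDerivAt_integral_of_dominated_of_fderiv_le (𝕜 := ℂ)
    (μ := volume) (a := (0 : ℝ)) (b := 2 * Real.pi) (x₀ := x) (s := Metric.ball x ε)
    (F := fun y θ => (deriv (circleMap 0 r) θ * ((circleMap 0 r θ - 0) ^ 2)⁻¹) •
      ψ (y + circleMap 0 r θ • v))
    (F' := fun y θ => (deriv (circleMap 0 r) θ * ((circleMap 0 r θ - 0) ^ 2)⁻¹) •
      fderiv ℂ ψ (y + circleMap 0 r θ • v)) (bound := fun _ => B * (M / ε))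
    (Metric.ball_mem_nhds x hε) ?_ ?_ ?_ ?_ intervalIntegrable_const ?_
  · refine ((key.const_smul (2 * Real.pi * Complex.I : ℂ)⁻¹).congr_of_eventuallyEq
      ?_).differentiableAt
    filter_upwards [Metric.ball_mem_nhds x hε] with y hy
    rw [hform y hy]
    simp only [Pi.smul_apply, mul_smul]
  · filter_upwards [Metric.ball_mem_nhds x hε] with y hy
    exact (hcoef.smul (hcont y hy)).aestronglyMeasurable
  · exact (hcoef.smul (hcont x hxε)).intervalIntegrable _ _
  -- Derivatives are always measurable, so continuity of the derivative is not presupposed.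
  · have hm : Measurable fun θ : ℝ => fderiv ℂ ψ (x + circleMap 0 r θ • v) :=
      (measurable_fderiv ℂ ψ).comp (by fun_prop : Continuous fun θ : ℝ =>
        x + circleMap 0 r θ • v).measurable
    exact hcoef.aestronglyMeasurable.smul hm.aestronglyMeasurable
  · refine Eventually.of_forall fun θ hθ y hy => ?_
    rw [uIoc_of_le (by positivity)] at hθ
    rw [norm_smul]
    have h1 := hB θ ⟨hθ.1.le, hθ.2⟩
    exact mul_le_mul h1 (hcauchy _ (hmaps y hy _ (hcirc θ))) (norm_nonneg _)
      ((norm_nonneg _).trans h1)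
  · refine Eventually.of_forall fun θ _ y hy => ?_
    have h := (hψd2 _ (hmaps y hy _ (hcirc θ))).comp y
      ((hasFDerivAt_id y).add_const (circleMap 0 r θ • v))
    rw [ContinuousLinearMap.comp_id] at h
    exact h.const_smul _

/-! ### The complex Hessian of a radial function. -/

section
variable {n N : ℕ}

theorem single_I_eq_smul (j : Fin n) :
    (Pi.single j Complex.I : Fin n → ℂ) = Complex.I • Pi.single j (1 : ℂ) := by
  ext i
  by_cases h : i = j
  · subst h; simp
  · simp [h]

/-- The partial derivative `∂ψ/∂x_j` of a holomorphic map. -/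
noncomputable def partialDeriv (ψ : (Fin n → ℂ) → EuclideanSpace ℂ (Fin N)) (j : Fin n)
    (x : Fin n → ℂ) : EuclideanSpace ℂ (Fin N) :=
  fderiv ℂ ψ x (Pi.single j 1)

theorem hasFDerivAt_radial {V : Type*} [NormedAddCommGroup V] [NormedSpace ℂ V]
    {ψ : V → EuclideanSpace ℂ (Fin N)} {y : V} {g : ℝ → ℝ}
    (hψ : DifferentiableAt ℂ ψ y) (hg : DifferentiableAt ℝ g (‖ψ y‖ ^ 2)) :
    ∃ L : V →L[ℝ] ℂ, HasFDerivAt (fun z => (g (‖ψ z‖ ^ 2) : ℂ)) L y ∧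
      ∀ v, L v = ((deriv g (‖ψ y‖ ^ 2) * (2 * (inner ℂ (ψ y) (fderiv ℂ ψ y v)).re) : ℝ) : ℂ) := by
  have h1 : HasFDerivAt ψ ((fderiv ℂ ψ y).restrictScalars ℝ) y :=
    hψ.hasFDerivAt.restrictScalars ℝ
  have h2 := hg.hasDerivAt.comp_hasFDerivAt y h1.norm_sq
  refine ⟨_, Complex.ofRealCLM.hasFDerivAt.comp y h2, fun v => ?_⟩
  have h3 : inner ℝ (ψ y) (fderiv ℂ ψ y v) = (inner ℂ (ψ y) (fderiv ℂ ψ y v)).re := by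
    simp [PiLp.inner_apply, Complex.re_sum]
  simp [h3]

theorem wirtingerBar_radial {ψ : (Fin n → ℂ) → EuclideanSpace ℂ (Fin N)} {y : Fin n → ℂ}
    {g : ℝ → ℝ} (hψ : DifferentiableAt ℂ ψ y) (hg : DifferentiableAt ℝ g (‖ψ y‖ ^ 2)) (k : Fin n) :
    wirtingerBar k (fun z => (g (‖ψ z‖ ^ 2) : ℂ)) y
      = ((deriv g (‖ψ y‖ ^ 2) : ℝ) : ℂ) * inner ℂ (partialDeriv ψ k y) (ψ y) := by
  obtain ⟨L, hL, hLv⟩ := hasFDerivAt_radial hψ hg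
  rw [wirtingerBar, hL.fderiv, hLv, hLv, single_I_eq_smul, map_smul, inner_smul_right,
    ← inner_conj_symm (partialDeriv ψ k y)]
  change _ = _ * starRingEnd ℂ (inner ℂ (ψ y) ((fderiv ℂ ψ y) (Pi.single k 1)))
  generalize inner ℂ (ψ y) ((fderiv ℂ ψ y) (Pi.single k 1)) = c
  apply Complex.ext <;> simp <;> ring

/-- The complex Hessian of `g (|ψ|²)` for a holomorphic map `ψ`. -/
theorem complexHessian_radial {ψ : (Fin n → ℂ) → EuclideanSpace ℂ (Fin N)} {U : Set (Fin n → ℂ)}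
    (hU : IsOpen U) (hψ : DifferentiableOn ℂ ψ U) {g : ℝ → ℝ} {J : Set ℝ} (hJ : IsOpen J)
    (hg : ContDiffOn ℝ ∞ g J) (hψJ : ∀ y ∈ U, ‖ψ y‖ ^ 2 ∈ J) {φ : (Fin n → ℂ) → ℝ}
    (hφ : ∀ y ∈ U, φ y = g (‖ψ y‖ ^ 2)) {x : Fin n → ℂ} (hx : x ∈ U) (j k : Fin n) :
    complexHessian φ x j k
      = ((deriv g (‖ψ x‖ ^ 2) : ℝ) : ℂ) * inner ℂ (partialDeriv ψ k x) (partialDeriv ψ j x)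
        + ((deriv (deriv g) (‖ψ x‖ ^ 2) : ℝ) : ℂ) *
          (inner ℂ (ψ x) (partialDeriv ψ j x) * inner ℂ (partialDeriv ψ k x) (ψ x)) := by
  have hgd : ∀ t ∈ J, DifferentiableAt ℝ g t := fun t ht =>
    (hg.differentiableOn (by simp)).differentiableAt (hJ.mem_nhds ht)
  have hgd' : ∀ t ∈ J, DifferentiableAt ℝ (deriv g) t := fun t ht =>
    ((hg.deriv_of_isOpen hJ (m := ∞) (by simp)).differentiableOn (by simp)).differentiableAt
      (hJ.mem_nhds ht)
  have hψd : ∀ y ∈ U, DifferentiableAt ℂ ψ y := fun y hy => hψ.differentiableAt (hU.mem_nhds hy)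
  have hev : (wirtingerBar k fun y => (φ y : ℂ)) =ᶠ[𝓝 x] fun y =>
      ((deriv g (‖ψ y‖ ^ 2) : ℝ) : ℂ) * inner ℂ (partialDeriv ψ k y) (ψ y) := by
    filter_upwards [hU.mem_nhds hx] with y hy
    rw [← wirtingerBar_radial (hψd y hy) (hgd _ (hψJ y hy))]
    have : (fun y => (φ y : ℂ)) =ᶠ[𝓝 y] fun z => (g (‖ψ z‖ ^ 2) : ℂ) := by
      filter_upwards [hU.mem_nhds hy] with z hz
      rw [hφ z hz]
    simp only [wirtingerBar, this.fderiv_eq]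
  obtain ⟨L, hL, hLv⟩ := hasFDerivAt_radial (hψd x hx) (hgd' _ (hψJ x hx))
  have ha : HasFDerivAt (partialDeriv ψ k)
      ((fderiv ℂ (partialDeriv ψ k) x).restrictScalars ℝ) x :=
    ((differentiableOn_fderiv_apply hψ hU (Pi.single k 1)).differentiableAt
      (hU.mem_nhds hx)).hasFDerivAt.restrictScalars ℝ
  have hψx : HasFDerivAt ψ ((fderiv ℂ ψ x).restrictScalars ℝ) x :=
    (hψd x hx).hasFDerivAt.restrictScalars ℝ
  have h1 := hL.fun_mul (ha.inner ℂ hψx)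
  simp only [complexHessian, Matrix.of_apply, wirtinger]
  rw [hev.fderiv_eq, h1.fderiv]
  simp only [add_apply, smul_apply, smul_eq_mul,
    ContinuousLinearMap.comp_apply, ContinuousLinearMap.prod_apply, fderivInnerCLM_apply, hLv,
    ContinuousLinearMap.coe_restrictScalars', single_I_eq_smul, map_smul, inner_smul_right,
    inner_smul_left, Complex.conj_I]
  change _ = _ * inner ℂ (partialDeriv ψ k x) (fderiv ℂ ψ x (Pi.single j 1))
    + _ * (inner ℂ (ψ x) (fderiv ℂ ψ x (Pi.single j 1)) * _)
  generalize hc : inner ℂ (ψ x) (fderiv ℂ ψ x (Pi.single j 1)) = c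
  generalize inner ℂ (partialDeriv ψ k x) (fderiv ℂ ψ x (Pi.single j 1)) = d
  -- This term is antiholomorphic in the direction of differentiation, so it cancels in ∂/∂z_j.
  generalize inner ℂ (fderiv ℂ (partialDeriv ψ k) x (Pi.single j 1)) (ψ x) = e
  generalize inner ℂ (partialDeriv ψ k x) (ψ x) = b
  have hc2 : ((c.re : ℂ) - Complex.I * ((Complex.I * c).re : ℂ)) = c := by
    apply Complex.ext <;> simp
  push_cast
  linear_combination ((deriv (deriv g) (‖ψ x‖ ^ 2) : ℝ) : ℂ) * b * hc2
    - ((deriv g (‖ψ x‖ ^ 2) : ℝ) : ℂ) / 2 * (d - e) * Complex.I_sq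

end

/-! ### The chart of the two-dimensional Kepler manifold. -/

/-- The chart `(ξ, ζ) ↦ ξ (1 - ζ², i (1 + ζ²), 2ζ)` of the two-dimensional Kepler manifold. -/
noncomputable def keplerChart (x : Fin 2 → ℂ) : EuclideanSpace ℂ (Fin 3) :=
  !₂[x 0 * (1 - x 1 ^ 2), Complex.I * x 0 * (1 + x 1 ^ 2), 2 * x 0 * x 1]

/-- The preimage of the unit ball of the Kepler manifold under the chart. -/
def keplerDomain : Set (Fin 2 → ℂ) := {x | x 0 ≠ 0 ∧ 2 * ‖x 0‖ ^ 2 * (1 + ‖x 1‖ ^ 2) ^ 2 < 1}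

/-- The linear form whose zero set is the complement of the image of the chart. -/
noncomputable def nullForm (z : EuclideanSpace ℂ (Fin 3)) : ℂ := z 0 - Complex.I * z 1

/-- The inverse of the chart. -/
noncomputable def keplerCoord (z : EuclideanSpace ℂ (Fin 3)) : Fin 2 → ℂ :=
  ![nullForm z / 2, z 2 / nullForm z]

@[simp] theorem keplerChart_zero (x : Fin 2 → ℂ) : keplerChart x 0 = x 0 * (1 - x 1 ^ 2) := rfl
@[simp] theorem keplerChart_one (x : Fin 2 → ℂ) :
    keplerChart x 1 = Complex.I * x 0 * (1 + x 1 ^ 2) := rfl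
@[simp] theorem keplerChart_two (x : Fin 2 → ℂ) : keplerChart x 2 = 2 * x 0 * x 1 := rfl

theorem norm_sq_keplerChart (x : Fin 2 → ℂ) :
    ‖keplerChart x‖ ^ 2 = 2 * ‖x 0‖ ^ 2 * (1 + ‖x 1‖ ^ 2) ^ 2 := by
  rw [EuclideanSpace.norm_sq_eq, Fin.sum_univ_three, keplerChart_zero, keplerChart_one,
    keplerChart_two]
  simp only [← Complex.normSq_eq_norm_sq, Complex.normSq_apply]
  simp [pow_two]
  ring

theorem sum_sq_keplerChart (x : Fin 2 → ℂ) : ∑ j, keplerChart x j ^ 2 = 0 := by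
  rw [Fin.sum_univ_three, keplerChart_zero, keplerChart_one, keplerChart_two]
  linear_combination x 0 ^ 2 * (1 + x 1 ^ 2) ^ 2 * Complex.I_sq

theorem nullForm_keplerChart (x : Fin 2 → ℂ) : nullForm (keplerChart x) = 2 * x 0 := by
  rw [nullForm, keplerChart_zero, keplerChart_one]
  linear_combination - x 0 * (1 + x 1 ^ 2) * Complex.I_sq

theorem keplerCoord_keplerChart {x : Fin 2 → ℂ} (hx : x 0 ≠ 0) : keplerCoord (keplerChart x) = x := by
  ext i
  fin_cases i
  · simp [keplerCoord, nullForm_keplerChart]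
  · simp [keplerCoord, nullForm_keplerChart]; field_simp

/-- On the cone z₂² = -(z₀ - iz₁)(z₀ + iz₁), so z₂ and a nonzero z₀ - iz₁ determine the point. -/
theorem keplerChart_keplerCoord {z : EuclideanSpace ℂ (Fin 3)} (hz : ∑ j, z j ^ 2 = 0)
    (hn : nullForm z ≠ 0) : keplerChart (keplerCoord z) = z := by
  rw [Fin.sum_univ_three] at hz
  have h1 : z 2 ^ 2 = - nullForm z * (z 0 + Complex.I * z 1) := by
    rw [nullForm]; linear_combination hz - z 1 ^ 2 * Complex.I_sq
  have h2 : (z 2 / nullForm z) ^ 2 = - (z 0 + Complex.I * z 1) / nullForm z := by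
    rw [div_pow, h1]; field_simp
  ext i
  fin_cases i
  · change nullForm z / 2 * (1 - (z 2 / nullForm z) ^ 2) = z 0
    rw [h2]; field_simp; rw [nullForm]; ring
  · change Complex.I * (nullForm z / 2) * (1 + (z 2 / nullForm z) ^ 2) = z 1
    rw [h2]; field_simp; rw [nullForm]
    linear_combination -2 * z 1 * Complex.I_sq
  · change 2 * (nullForm z / 2) * (z 2 / nullForm z) = z 2
    field_simp

theorem differentiable_apply_kepler (i : Fin 3) :
    Differentiable ℂ fun z : EuclideanSpace ℂ (Fin 3) => z i :=
  (EuclideanSpace.proj (𝕜 := ℂ) i).differentiable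

theorem differentiable_nullForm : Differentiable ℂ nullForm :=
  (differentiable_apply_kepler 0).sub ((differentiable_apply_kepler 1).const_mul _)

theorem hasFDerivAt_keplerChart (x : Fin 2 → ℂ) :
    ∃ L : (Fin 2 → ℂ) →L[ℂ] EuclideanSpace ℂ (Fin 3), HasFDerivAt keplerChart L x ∧
      ∀ v, L v = !₂[v 0 * (1 - x 1 ^ 2) - x 0 * (2 * x 1 * v 1),
        Complex.I * v 0 * (1 + x 1 ^ 2) + Complex.I * x 0 * (2 * x 1 * v 1),
        2 * v 0 * x 1 + 2 * x 0 * v 1] := by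
  have p : ∀ i, HasFDerivAt (fun x : Fin 2 → ℂ => x i)
      (ContinuousLinearMap.proj (R := ℂ) (φ := fun _ => ℂ) i) x := fun i => hasFDerivAt_apply i x
  have hsq := (p 1).fun_mul (p 1)
  simp only [← pow_two] at hsq
  obtain ⟨L₀, h0, e0⟩ : ∃ L : (Fin 2 → ℂ) →L[ℂ] ℂ,
      HasFDerivAt (fun x : Fin 2 → ℂ => x 0 * (1 - x 1 ^ 2)) L x ∧
      ∀ v, L v = v 0 * (1 - x 1 ^ 2) - x 0 * (2 * x 1 * v 1) :=
    ⟨_, (p 0).fun_mul (hsq.const_sub 1), fun v => by simp; ring⟩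
  obtain ⟨L₁, h1, e1⟩ : ∃ L : (Fin 2 → ℂ) →L[ℂ] ℂ,
      HasFDerivAt (fun x : Fin 2 → ℂ => Complex.I * x 0 * (1 + x 1 ^ 2)) L x ∧
      ∀ v, L v = Complex.I * v 0 * (1 + x 1 ^ 2) + Complex.I * x 0 * (2 * x 1 * v 1) :=
    ⟨_, ((p 0).const_mul Complex.I).fun_mul (hsq.const_add 1), fun v => by simp; ring⟩
  obtain ⟨L₂, h2, e2⟩ : ∃ L : (Fin 2 → ℂ) →L[ℂ] ℂ,
      HasFDerivAt (fun x : Fin 2 → ℂ => 2 * x 0 * x 1) L x ∧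
      ∀ v, L v = 2 * v 0 * x 1 + 2 * x 0 * v 1 :=
    ⟨_, ((p 0).const_mul 2).fun_mul (p 1), fun v => by simp; ring⟩
  let L : Fin 3 → ((Fin 2 → ℂ) →L[ℂ] ℂ) := ![L₀, L₁, L₂]
  have hpi : HasFDerivAt (fun x : Fin 2 → ℂ => ![x 0 * (1 - x 1 ^ 2),
      Complex.I * x 0 * (1 + x 1 ^ 2), 2 * x 0 * x 1]) (ContinuousLinearMap.pi L) x := by
    rw [hasFDerivAt_pi']
    intro i
    fin_cases i
    · exact h0
    · exact h1
    · exact h2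
  have hE := ((PiLp.continuousLinearEquiv 2 ℂ (fun _ : Fin 3 => ℂ)).symm.hasFDerivAt).comp x hpi
  refine ⟨_, hE, fun v => ?_⟩
  ext i
  fin_cases i
  · exact e0 v
  · exact e1 v
  · exact e2 v

theorem differentiable_keplerChart : Differentiable ℂ keplerChart := fun x =>
  (hasFDerivAt_keplerChart x).choose_spec.1.differentiableAt

theorem fderiv_keplerChart (x v : Fin 2 → ℂ) : fderiv ℂ keplerChart x v =
    !₂[v 0 * (1 - x 1 ^ 2) - x 0 * (2 * x 1 * v 1),
        Complex.I * v 0 * (1 + x 1 ^ 2) + Complex.I * x 0 * (2 * x 1 * v 1),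
        2 * v 0 * x 1 + 2 * x 0 * v 1] := by
  obtain ⟨L, hL, h⟩ := hasFDerivAt_keplerChart x
  rw [hL.fderiv, h]

theorem isOpen_keplerDomain : IsOpen keplerDomain := by
  refine IsOpen.inter ?_ ?_
  · exact isOpen_ne.preimage (continuous_apply 0)
  · exact isOpen_Iio.preimage (f := fun x : Fin 2 → ℂ => 2 * ‖x 0‖ ^ 2 * (1 + ‖x 1‖ ^ 2) ^ 2)
      (by fun_prop)

theorem mem_keplerDomain_iff {x : Fin 2 → ℂ} :
    x ∈ keplerDomain ↔ x 0 ≠ 0 ∧ ‖keplerChart x‖ ^ 2 < 1 := by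
  rw [norm_sq_keplerChart]; rfl

theorem norm_sq_mem_Ioo_of_mem_keplerBall {z : EuclideanSpace ℂ (Fin 3)} (hz : z ∈ keplerBall 2) :
    ‖z‖ ^ 2 ∈ Ioo (0 : ℝ) 1 := by
  obtain ⟨-, h0, h1⟩ := hz
  have : 0 < ‖z‖ := norm_pos_iff.2 h0
  exact ⟨by positivity, by nlinarith⟩

theorem keplerChart_mem_keplerBall {x : Fin 2 → ℂ} (hx : x ∈ keplerDomain) :
    keplerChart x ∈ keplerBall 2 := by
  refine ⟨sum_sq_keplerChart x, fun h => ?_, ?_⟩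
  · have h1 := nullForm_keplerChart x
    rw [h, nullForm] at h1
    simp at h1
    exact hx.1 h1
  · have h := (mem_keplerDomain_iff.1 hx).2
    have h1 := norm_nonneg (keplerChart x)
    nlinarith

theorem isHolParam_keplerChart : IsHolParam (keplerBall 2) keplerDomain keplerChart where
  isOpen := isOpen_keplerDomain
  holomorphic := differentiable_keplerChart.differentiableOn
  injOn := fun x hx y hy h => by
    rw [← keplerCoord_keplerChart hx.1, h, keplerCoord_keplerChart hy.1]
  immersion := fun x hx => by
    rw [injective_iff_map_eq_zero]
    intro v hv
    rw [fderiv_keplerChart] at hv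
    have h0 := congrArg (fun z : EuclideanSpace ℂ (Fin 3) => z 0) hv
    have h1 := congrArg (fun z : EuclideanSpace ℂ (Fin 3) => z 1) hv
    have h2 := congrArg (fun z : EuclideanSpace ℂ (Fin 3) => z 2) hv
    simp at h0 h1 h2
    have hv0 : v 0 = 0 := by
      linear_combination h0 / 2 - Complex.I * h1 / 2
        + (v 0 * (1 + x 1 ^ 2) + x 0 * (2 * x 1 * v 1)) / 2 * Complex.I_sq
    rw [hv0] at h2
    have hv1 : v 1 = 0 := by simpa [hx.1] using h2
    ext i
    fin_cases i
    · exact hv0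
    · exact hv1
  mapsTo := fun x hx => keplerChart_mem_keplerBall hx

theorem partialDeriv_keplerChart_zero (x : Fin 2 → ℂ) : partialDeriv keplerChart 0 x
    = !₂[1 - x 1 ^ 2, Complex.I * (1 + x 1 ^ 2), 2 * x 1] := by
  rw [partialDeriv, fderiv_keplerChart]; simp

theorem partialDeriv_keplerChart_one (x : Fin 2 → ℂ) : partialDeriv keplerChart 1 x
    = !₂[- (2 * x 0 * x 1), 2 * Complex.I * x 0 * x 1, 2 * x 0] := by
  rw [partialDeriv, fderiv_keplerChart]; simp
  constructor <;> ring

section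
variable {g : ℝ → ℝ} {φ : (Fin 2 → ℂ) → ℝ} {x : Fin 2 → ℂ}

theorem complexHessian_keplerChart (hg : ContDiffOn ℝ ∞ g (Ioo 0 1))
    (hφ : ∀ y ∈ keplerDomain, φ y = g (‖keplerChart y‖ ^ 2)) (hx : x ∈ keplerDomain) (j k : Fin 2) :
    complexHessian φ x j k
      = ((deriv g (‖keplerChart x‖ ^ 2) : ℝ) : ℂ) *
          inner ℂ (partialDeriv keplerChart k x) (partialDeriv keplerChart j x)
        + ((deriv (deriv g) (‖keplerChart x‖ ^ 2) : ℝ) : ℂ) *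
          (inner ℂ (keplerChart x) (partialDeriv keplerChart j x) *
            inner ℂ (partialDeriv keplerChart k x) (keplerChart x)) :=
  complexHessian_radial isOpen_keplerDomain differentiable_keplerChart.differentiableOn isOpen_Ioo hg
    (fun _ hy => norm_sq_mem_Ioo_of_mem_keplerBall (keplerChart_mem_keplerBall hy)) hφ hx j k

theorem complexHessian_keplerChart_zero_zero (hg : ContDiffOn ℝ ∞ g (Ioo 0 1))
    (hφ : ∀ y ∈ keplerDomain, φ y = g (‖keplerChart y‖ ^ 2)) (hx : x ∈ keplerDomain) :
    complexHessian φ x 0 0 = ((2 * (1 + ‖x 1‖ ^ 2) ^ 2 * (deriv g (‖keplerChart x‖ ^ 2)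
      + ‖keplerChart x‖ ^ 2 * deriv (deriv g) (‖keplerChart x‖ ^ 2)) : ℝ) : ℂ) := by
  rw [complexHessian_keplerChart hg hφ hx, partialDeriv_keplerChart_zero]
  simp only [PiLp.inner_apply, RCLike.inner_apply, Fin.sum_univ_three, keplerChart_zero,
    keplerChart_one, keplerChart_two]
  generalize deriv g (‖keplerChart x‖ ^ 2) = a
  generalize deriv (deriv g) (‖keplerChart x‖ ^ 2) = b
  rw [norm_sq_keplerChart]
  push_cast
  rw [← Complex.mul_conj', ← Complex.mul_conj']
  simp [map_ofNat (starRingEnd ℂ) 2]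
  generalize starRingEnd ℂ (x 0) = X'
  generalize starRingEnd ℂ (x 1) = W'
  ring_nf
  simp only [Complex.I_sq, Complex.I_pow_four]
  ring

theorem det_complexHessian_keplerChart (hg : ContDiffOn ℝ ∞ g (Ioo 0 1))
    (hφ : ∀ y ∈ keplerDomain, φ y = g (‖keplerChart y‖ ^ 2)) (hx : x ∈ keplerDomain) :
    (complexHessian φ x).det = ((8 * ‖x 0‖ ^ 2 * (1 + ‖x 1‖ ^ 2) ^ 2 *
      (deriv g (‖keplerChart x‖ ^ 2) * (deriv g (‖keplerChart x‖ ^ 2)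
      + ‖keplerChart x‖ ^ 2 * deriv (deriv g) (‖keplerChart x‖ ^ 2))) : ℝ) : ℂ) := by
  rw [Matrix.det_fin_two]
  simp only [complexHessian_keplerChart hg hφ hx, partialDeriv_keplerChart_zero,
    partialDeriv_keplerChart_one]
  simp only [PiLp.inner_apply, RCLike.inner_apply, Fin.sum_univ_three, keplerChart_zero,
    keplerChart_one, keplerChart_two]
  generalize deriv g (‖keplerChart x‖ ^ 2) = a
  generalize deriv (deriv g) (‖keplerChart x‖ ^ 2) = b
  rw [norm_sq_keplerChart]
  push_cast
  rw [← Complex.mul_conj', ← Complex.mul_conj']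
  simp [map_ofNat (starRingEnd ℂ) 2]
  generalize starRingEnd ℂ (x 0) = X'
  generalize starRingEnd ℂ (x 1) = W'
  ring_nf
  simp only [Complex.I_sq, Complex.I_pow_four]
  ring

/-- Change of the complex Hessian of a radial function under a change of coordinates. -/
theorem det_complexHessian_comp (hg : ContDiffOn ℝ ∞ g (Ioo 0 1))
    (hφ : ∀ y ∈ keplerDomain, φ y = g (‖keplerChart y‖ ^ 2))
    {U : Set (Fin 2 → ℂ)} (hU : IsOpen U) {ψ : (Fin 2 → ℂ) → EuclideanSpace ℂ (Fin 3)}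
    (hψ : DifferentiableOn ℂ ψ U) {τ : (Fin 2 → ℂ) → Fin 2 → ℂ} (hτ : DifferentiableOn ℂ τ U)
    (hτU : MapsTo τ U keplerDomain) (hψτ : ∀ y ∈ U, ψ y = keplerChart (τ y))
    {φ' : (Fin 2 → ℂ) → ℝ} (hφ' : ∀ y ∈ U, φ' y = g (‖ψ y‖ ^ 2)) (hx : x ∈ U) :
    (complexHessian φ' x).det
      = (Complex.normSq (LinearMap.det (fderiv ℂ τ x : (Fin 2 → ℂ) →ₗ[ℂ] Fin 2 → ℂ)) : ℂ)
        * (complexHessian φ (τ x)).det := by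
  have hτx : HasFDerivAt τ (fderiv ℂ τ x) x := (hτ.differentiableAt (hU.mem_nhds hx)).hasFDerivAt
  have hψx : fderiv ℂ ψ x = (fderiv ℂ keplerChart (τ x)).comp (fderiv ℂ τ x) := by
    have h1 : ψ =ᶠ[𝓝 x] fun y => keplerChart (τ y) := by
      filter_upwards [hU.mem_nhds hx] using hψτ
    rw [h1.fderiv_eq]
    exact ((differentiable_keplerChart _).hasFDerivAt.comp x hτx).fderiv
  have hpart : ∀ j, partialDeriv ψ j x
      = (fderiv ℂ τ x (Pi.single j 1)) 0 • partialDeriv keplerChart 0 (τ x)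
        + (fderiv ℂ τ x (Pi.single j 1)) 1 • partialDeriv keplerChart 1 (τ x) := by
    intro j
    rw [partialDeriv, hψx, ContinuousLinearMap.comp_apply]
    generalize fderiv ℂ τ x (Pi.single j 1) = v
    have : v = v 0 • Pi.single (M := fun _ => ℂ) 0 1 + v 1 • Pi.single 1 1 := by
      ext i; fin_cases i <;> simp
    conv_lhs => rw [this]
    rw [map_add, map_smul, map_smul]
    rfl
  have hdet : LinearMap.det (fderiv ℂ τ x : (Fin 2 → ℂ) →ₗ[ℂ] Fin 2 → ℂ)
      = (fderiv ℂ τ x (Pi.single 0 1)) 0 * (fderiv ℂ τ x (Pi.single 1 1)) 1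
        - (fderiv ℂ τ x (Pi.single 1 1)) 0 * (fderiv ℂ τ x (Pi.single 0 1)) 1 := by
    rw [← LinearMap.det_toMatrix', Matrix.det_fin_two]
    simp [LinearMap.toMatrix'_apply]
  rw [hdet, Matrix.det_fin_two, Matrix.det_fin_two]
  simp only [complexHessian_keplerChart hg hφ (hτU hx)]
  simp only [complexHessian_radial hU hψ isOpen_Ioo hg (fun y hy => by
    rw [hψτ y hy]
    exact norm_sq_mem_Ioo_of_mem_keplerBall (keplerChart_mem_keplerBall (hτU hy))) hφ' hx]
  rw [← Complex.mul_conj, hψτ x hx]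
  simp only [hpart, inner_add_left, inner_add_right, inner_smul_left, inner_smul_right, map_sub,
    map_mul]
  ring

end

/-! ### From functions on the manifold to radial profiles. -/

theorem exists_keplerDomain_norm_sq {t : ℝ} (ht : t ∈ Ioo (0 : ℝ) 1) :
    (![((√(t / 2) : ℝ) : ℂ), 0] : Fin 2 → ℂ) ∈ keplerDomain ∧
      ‖keplerChart ![((√(t / 2) : ℝ) : ℂ), 0]‖ ^ 2 = t := by
  have h0 : 0 < t / 2 := by linarith [ht.1]
  have h1 : 0 < √(t / 2) := Real.sqrt_pos.2 h0
  have h2 : ‖keplerChart ![((√(t / 2) : ℝ) : ℂ), 0]‖ ^ 2 = t := by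
    rw [norm_sq_keplerChart]
    simp only [Matrix.cons_val_zero, Matrix.cons_val_one, Complex.norm_real, norm_zero]
    rw [Real.norm_of_nonneg h1.le, Real.sq_sqrt h0.le]
    ring
  refine ⟨mem_keplerDomain_iff.2 ⟨?_, by rw [h2]; exact ht.2⟩, h2⟩
  simpa using h1.ne'

/-- Evaluate along the points (√(t/2), 0), where |z|² = t. With g = log(1/f), the first diagonal
entry of the Hessian is a positive multiple of L' = g' + tg'', and the determinant is a positive
multiple of g'L'. -/
theorem isRadialProfile_of_strictlyPsh {u : EuclideanSpace ℂ (Fin 3) → ℝ} {f : ℝ → ℝ}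
    (hu : ∀ z ∈ keplerBall 2, u z = f (‖z‖ ^ 2)) (hpos : ∀ z ∈ keplerBall 2, 0 < u z)
    (hsm : IsSmoothOn 2 (keplerBall 2) u)
    (hpsh : IsStrictlyPsh 2 (keplerBall 2) fun z => Real.log (1 / u z)) : IsRadialProfile f := by
  have hu' : ∀ x ∈ keplerDomain, u (keplerChart x) = f (‖keplerChart x‖ ^ 2) := fun x hx =>
    hu _ (keplerChart_mem_keplerBall hx)
  have hfpos : ∀ t ∈ Ioo (0 : ℝ) 1, 0 < f t := by
    intro t ht
    obtain ⟨h1, h2⟩ := exists_keplerDomain_norm_sq ht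
    have := hpos _ (keplerChart_mem_keplerBall h1)
    rwa [hu' _ h1, h2] at this
  have hf : ContDiffOn ℝ ∞ f (Ioo 0 1) := by
    have h1 := hsm _ _ isHolParam_keplerChart
    have h2 : ContDiffOn ℝ ∞ (fun t : ℝ => (![((√(t / 2) : ℝ) : ℂ), 0] : Fin 2 → ℂ)) (Ioo 0 1) := by
      rw [contDiffOn_pi]
      intro i
      fin_cases i
      · refine Complex.ofRealCLM.contDiff.comp_contDiffOn ?_
        refine ContDiffOn.sqrt (contDiffOn_id.div_const 2) fun t ht => ?_
        have := ht.1
        change t / 2 ≠ 0; positivity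
      · exact contDiffOn_const
    refine (h1.comp h2 fun t ht => (exists_keplerDomain_norm_sq ht).1).congr fun t ht => ?_
    obtain ⟨h3, h4⟩ := exists_keplerDomain_norm_sq ht
    simp only [Function.comp]
    rw [hu' _ h3, h4]
  set g : ℝ → ℝ := fun s => Real.log (1 / f s) with hgdef
  have hg : ContDiffOn ℝ ∞ g (Ioo 0 1) :=
    (contDiffOn_const.div hf fun t ht => (hfpos t ht).ne').log
      fun t ht => (one_div_pos.2 (hfpos t ht)).ne'
  have hφ : ∀ y ∈ keplerDomain, Real.log (1 / u (keplerChart y)) = g (‖keplerChart y‖ ^ 2) :=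
    fun y hy => by rw [hu' y hy]
  have hgd : ∀ t ∈ Ioo (0 : ℝ) 1, HasDerivAt (logSlope f) (deriv g t + t * deriv (deriv g) t) t := by
    intro t ht
    have h1 : HasDerivAt (deriv g) (deriv (deriv g) t) t :=
      (((hg.deriv_of_isOpen isOpen_Ioo (m := ∞) (by simp)).differentiableOn
        (by simp)).differentiableAt (isOpen_Ioo.mem_nhds ht)).hasDerivAt
    have h2 := (hasDerivAt_id t).mul h1
    simp only [id, one_mul] at h2
    exact h2
  have key : ∀ t ∈ Ioo (0 : ℝ) 1, 0 < deriv g t ∧ 0 < deriv g t + t * deriv (deriv g) t := by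
    intro t ht
    obtain ⟨h1, h2⟩ := exists_keplerDomain_norm_sq ht
    have hp := hpsh _ _ isHolParam_keplerChart _ h1
    have h3 := hp.diag_pos (i := 0)
    have h4 := hp.det_pos
    rw [complexHessian_keplerChart_zero_zero hg hφ h1, h2, Complex.zero_lt_real] at h3
    rw [det_complexHessian_keplerChart hg hφ h1, h2, Complex.zero_lt_real] at h4
    have h5 := pos_of_mul_pos_right h3 (by positivity)
    have h6 := pos_of_mul_pos_right h4 (by positivity)
    exact ⟨pos_of_mul_pos_left h6 h5.le, h5⟩
  exact
    { contDiffOn := hf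
      pos := hfpos
      slope_pos := fun t ht => mul_pos ht.1 (key t ht).1
      deriv_slope_pos := fun t ht => by rw [(hgd t ht).deriv]; exact (key t ht).2 }

theorem IsRadialProfile.deriv_logSlope {f : ℝ → ℝ} (hf : IsRadialProfile f) {t : ℝ}
    (ht : t ∈ Ioo (0 : ℝ) 1) : deriv (logSlope f) t = deriv (fun s => Real.log (1 / f s)) t
      + t * deriv (deriv fun s => Real.log (1 / f s)) t := by
  have h1 : HasDerivAt (deriv fun s => Real.log (1 / f s))
      (deriv (deriv fun s => Real.log (1 / f s)) t) t :=
    (((hf.contDiffOn_log.deriv_of_isOpen isOpen_Ioo (m := ∞) (by simp)).differentiableOn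
      (by simp)).differentiableAt (isOpen_Ioo.mem_nhds ht)).hasDerivAt
  have h2 := (hasDerivAt_id t).mul h1
  simp only [id, one_mul] at h2
  exact h2.deriv

/-- The density of the weighted volume in the chart. -/
theorem IsRadialProfile.pow_mul_det_complexHessian {f : ℝ → ℝ} (hf : IsRadialProfile f)
    {φ : (Fin 2 → ℂ) → ℝ} (hφ : ∀ y ∈ keplerDomain, φ y = Real.log (1 / f (‖keplerChart y‖ ^ 2)))
    {x : Fin 2 → ℂ} (hx : x ∈ keplerDomain) :
    f (‖keplerChart x‖ ^ 2) ^ 3 * (complexHessian φ x).det.re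
      = 2 * radialDensity f (‖keplerChart x‖ ^ 2) := by
  have ht := norm_sq_mem_Ioo_of_mem_keplerBall (keplerChart_mem_keplerBall hx)
  rw [det_complexHessian_keplerChart hf.contDiffOn_log hφ hx, Complex.ofReal_re, radialDensity,
    hf.deriv_logSlope ht, logSlope]
  have h := norm_sq_keplerChart x
  generalize ‖keplerChart x‖ ^ 2 = N at h ⊢
  rw [show 8 * ‖x 0‖ ^ 2 * (1 + ‖x 1‖ ^ 2) ^ 2 = 4 * N by rw [h]; ring]
  ring

/-! ### The Kähler volume in a single chart. -/

theorem abs_det_restrictScalars (L : (Fin 2 → ℂ) →L[ℂ] Fin 2 → ℂ) :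
    |(L.restrictScalars ℝ).det|
      = Complex.normSq (LinearMap.det (L : (Fin 2 → ℂ) →ₗ[ℂ] Fin 2 → ℂ)) := by
  have h : (L.restrictScalars ℝ).det
      = Complex.normSq (LinearMap.det (L : (Fin 2 → ℂ) →ₗ[ℂ] Fin 2 → ℂ)) := by
    rw [← Algebra.norm_complex_apply, ← LinearMap.det_restrictScalars]
    rfl
  rw [h, abs_of_nonneg (Complex.normSq_nonneg _)]

theorem ContinuousOn.measurableSet_preimage_inter {α β : Type*} [TopologicalSpace α]
    [MeasurableSpace α] [OpensMeasurableSpace α] [TopologicalSpace β] [MeasurableSpace β]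
    [BorelSpace β] {ψ : α → β} {U : Set α} (hψ : ContinuousOn ψ U) (hU : MeasurableSet U)
    {s : Set β} (hs : MeasurableSet s) : MeasurableSet (ψ ⁻¹' s ∩ U) := by
  have h1 : MeasurableSet ((U.domRestrict ψ) ⁻¹' s) :=
    (continuousOn_iff_continuous_domRestrict.1 hψ).measurable hs
  have h2 := hU.subtype_image h1
  convert h2 using 1
  ext x
  simp [and_comm]

section
variable {n N : ℕ} {M : Set (EuclideanSpace ℂ (Fin N))} {U V : Set (Fin n → ℂ)}
  {ψ : (Fin n → ℂ) → EuclideanSpace ℂ (Fin N)}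

theorem IsHolParam.mono (h : IsHolParam M U ψ) (hV : IsOpen V) (hVU : V ⊆ U) :
    IsHolParam M V ψ where
  isOpen := hV
  holomorphic := h.holomorphic.mono hVU
  injOn := h.injOn.mono hVU
  immersion := fun x hx => h.immersion x (hVU hx)
  mapsTo := h.mapsTo.mono_left hVU

theorem IsHolParam.differentiableAt (h : IsHolParam M U ψ) {x : Fin n → ℂ} (hx : x ∈ U) :
    DifferentiableAt ℂ ψ x := h.holomorphic.differentiableAt (h.isOpen.mem_nhds hx)

end

section
variable {U : Set (Fin 2 → ℂ)} {ψ : (Fin 2 → ℂ) → EuclideanSpace ℂ (Fin 3)}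

theorem keplerChart_keplerCoord_of_mem {z : EuclideanSpace ℂ (Fin 3)} (hz : z ∈ keplerBall 2)
    (hn : nullForm z ≠ 0) : keplerCoord z ∈ keplerDomain ∧ keplerChart (keplerCoord z) = z := by
  have h := keplerChart_keplerCoord hz.1 hn
  refine ⟨mem_keplerDomain_iff.2 ⟨?_, ?_⟩, h⟩
  · simpa [keplerCoord] using hn
  · rw [h]; exact (norm_sq_mem_Ioo_of_mem_keplerBall hz).2

theorem differentiableAt_keplerCoord {z : EuclideanSpace ℂ (Fin 3)} (hn : nullForm z ≠ 0) :
    DifferentiableAt ℂ keplerCoord z := by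
  rw [differentiableAt_pi]
  intro i
  fin_cases i
  · change DifferentiableAt ℂ (fun z => nullForm z / 2) z
    simp only [div_eq_mul_inv]
    exact (differentiable_nullForm z).mul_const _
  · change DifferentiableAt ℂ (fun z => z 2 / nullForm z) z
    simp only [div_eq_mul_inv]
    exact (differentiable_apply_kepler 2 z).mul ((differentiable_nullForm z).inv hn)

/-- Off the zero set of `nullForm` any parametrization factors through the chart; by the chain rule
the immersion property makes the transition map nondegenerate. -/
theorem IsHolParam.transition (h : IsHolParam (keplerBall 2) U ψ)
    (hn : ∀ x ∈ U, nullForm (ψ x) ≠ 0) :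
    DifferentiableOn ℂ (fun x => keplerCoord (ψ x)) U ∧
    MapsTo (fun x => keplerCoord (ψ x)) U keplerDomain ∧
    (∀ x ∈ U, ψ x = keplerChart (keplerCoord (ψ x))) ∧
    InjOn (fun x => keplerCoord (ψ x)) U ∧
    ∀ x ∈ U, LinearMap.det
      (fderiv ℂ (fun x => keplerCoord (ψ x)) x : (Fin 2 → ℂ) →ₗ[ℂ] Fin 2 → ℂ) ≠ 0 := by
  have hd : DifferentiableOn ℂ (fun x => keplerCoord (ψ x)) U := fun x hx =>
    ((differentiableAt_keplerCoord (hn x hx)).comp x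
      (h.differentiableAt hx)).differentiableWithinAt
  have he : ∀ x ∈ U, ψ x = keplerChart (keplerCoord (ψ x)) := fun x hx =>
    (keplerChart_keplerCoord_of_mem (h.mapsTo hx) (hn x hx)).2.symm
  refine ⟨hd, fun x hx => (keplerChart_keplerCoord_of_mem (h.mapsTo hx) (hn x hx)).1, he,
    fun x hx y hy hxy => h.injOn hx hy ?_, fun x hx => ?_⟩
  · rw [he x hx, he y hy]; exact congrArg keplerChart hxy
  · have h1 : ψ =ᶠ[𝓝 x] fun y => keplerChart (keplerCoord (ψ y)) := by
      filter_upwards [h.isOpen.mem_nhds hx] using he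
    have h2 : fderiv ℂ ψ x = (fderiv ℂ keplerChart (keplerCoord (ψ x))).comp
        (fderiv ℂ (fun x => keplerCoord (ψ x)) x) := by
      rw [h1.fderiv_eq]
      exact ((differentiable_keplerChart _).hasFDerivAt.comp x
        (hd.differentiableAt (h.isOpen.mem_nhds hx)).hasFDerivAt).fderiv
    have h3 := h.immersion x hx
    rw [h2, ContinuousLinearMap.coe_comp] at h3
    have h4 := h3.of_comp
    intro h0
    exact (LinearMap.bot_lt_ker_of_det_eq_zero h0).ne' (LinearMap.ker_eq_bot.2 h4)

/-- The reflection `z₀ ↦ -z₀` of `ℂ³`. -/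
noncomputable def reflection₀ : EuclideanSpace ℂ (Fin 3) ≃ₗᵢ[ℂ] EuclideanSpace ℂ (Fin 3) :=
  LinearIsometryEquiv.piLpCongrRight 2 fun i =>
    if i = 0 then LinearIsometryEquiv.neg ℂ else LinearIsometryEquiv.refl ℂ ℂ

theorem reflection₀_zero (z : EuclideanSpace ℂ (Fin 3)) : reflection₀ z 0 = - z 0 := by
  simp [reflection₀]
theorem reflection₀_one (z : EuclideanSpace ℂ (Fin 3)) : reflection₀ z 1 = z 1 := by
  simp [reflection₀]
theorem reflection₀_two (z : EuclideanSpace ℂ (Fin 3)) : reflection₀ z 2 = z 2 := by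
  simp [reflection₀]

theorem IsHolParam.reflection₀_comp (h : IsHolParam (keplerBall 2) U ψ) :
    IsHolParam (keplerBall 2) U fun x => reflection₀ (ψ x) where
  isOpen := h.isOpen
  holomorphic := reflection₀.differentiable.comp_differentiableOn h.holomorphic
  injOn := fun x hx y hy hxy => h.injOn hx hy (reflection₀.injective hxy)
  immersion := fun x hx => by
    have h1 : fderiv ℂ (fun x => reflection₀ (ψ x)) x
        = (reflection₀ : EuclideanSpace ℂ (Fin 3) →L[ℂ] EuclideanSpace ℂ (Fin 3)).comp
          (fderiv ℂ ψ x) :=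
      ((reflection₀ : EuclideanSpace ℂ (Fin 3) →L[ℂ] EuclideanSpace ℂ (Fin 3)).hasFDerivAt.comp x
        (h.differentiableAt hx).hasFDerivAt).fderiv
    rw [h1, ContinuousLinearMap.coe_comp]
    exact reflection₀.injective.comp (h.immersion x hx)
  mapsTo := fun x hx => by
    obtain ⟨h1, h2, h3⟩ := h.mapsTo hx
    refine ⟨?_, ?_, ?_⟩
    · rw [Fin.sum_univ_three] at h1 ⊢
      rw [reflection₀_zero, reflection₀_one, reflection₀_two]
      linear_combination h1
    · simpa using h2
    · simpa using h3

/-- On the exceptional set z₂ = 0. The reflected chart covers it, for `nullForm` and its reflection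
have no common zero on the manifold, and there it lies in the null hyperplane ζ = 0. -/
theorem volume_nullForm_eq_zero (h : IsHolParam (keplerBall 2) U ψ) :
    volume (((fun x => nullForm (ψ x)) ⁻¹' {0}) ∩ U) = 0 := by
  set A := ((fun x => nullForm (ψ x)) ⁻¹' {0}) ∩ U with hA
  have hc : ContinuousOn ψ U := h.holomorphic.continuousOn
  have hAm : MeasurableSet A := ContinuousOn.measurableSet_preimage_inter
    (differentiable_nullForm.continuous.comp_continuousOn hc) h.isOpen.measurableSet
    (measurableSet_singleton 0)
  set W := U ∩ (fun x => nullForm (reflection₀ (ψ x))) ⁻¹' {0}ᶜ with hW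
  have hWo : IsOpen W := ContinuousOn.isOpen_inter_preimage
    ((differentiable_nullForm.continuous.comp reflection₀.continuous).comp_continuousOn hc) h.isOpen
    isOpen_compl_singleton
  have hsq : ∀ x ∈ A, ψ x 2 = 0 := by
    rintro x ⟨hx0, hx⟩
    have h1 := (h.mapsTo hx).1
    rw [Fin.sum_univ_three] at h1
    have h2 : nullForm (ψ x) = 0 := hx0
    rw [nullForm] at h2
    have h3 : ψ x 2 ^ 2 = 0 := by
      linear_combination h1 - (ψ x 0 + Complex.I * ψ x 1) * h2 - ψ x 1 ^ 2 * Complex.I_sq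
    exact pow_eq_zero_iff two_ne_zero |>.1 h3
  have hAW : A ⊆ W := by
    rintro x ⟨hx0, hx⟩
    refine ⟨hx, fun h0 => (h.mapsTo hx).2.1 ?_⟩
    have h1 : ψ x 0 - Complex.I * ψ x 1 = 0 := hx0
    have h2 : - ψ x 0 - Complex.I * ψ x 1 = 0 := by
      have : nullForm (reflection₀ (ψ x)) = 0 := h0
      rwa [nullForm, reflection₀_zero, reflection₀_one] at this
    have h3 : ψ x 0 = 0 := by linear_combination h1 / 2 - h2 / 2
    have h4 : ψ x 1 = 0 := by
      linear_combination Complex.I * h1 / 2 + Complex.I * h2 / 2 + ψ x 1 * Complex.I_sq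
    ext i
    fin_cases i
    · exact h3
    · exact h4
    · exact hsq x ⟨hx0, hx⟩
  obtain ⟨t1, -, -, t4, t5⟩ := (h.reflection₀_comp.mono hWo inter_subset_left).transition
    fun x hx => hx.2
  set τ : (Fin 2 → ℂ) → Fin 2 → ℂ := fun x => keplerCoord (reflection₀ (ψ x)) with hτ
  have hτd : ∀ x ∈ A, HasFDerivWithinAt τ ((fderiv ℂ τ x).restrictScalars ℝ) A x := fun x hx =>
    ((t1.differentiableAt (hWo.mem_nhds (hAW hx))).hasFDerivAt.restrictScalars ℝ).hasFDerivWithinAt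
  have himg : volume (τ '' A) = 0 := by
    refine measure_mono_null (t := {y | y 1 = 0}) ?_ ?_
    · rintro _ ⟨x, hx, rfl⟩
      change reflection₀ (ψ x) 2 / nullForm (reflection₀ (ψ x)) = 0
      rw [reflection₀_two, hsq x hx, zero_div]
    · rw [volume_pi]
      exact Measure.pi_hyperplane _ 1 0
  -- The integral of the Jacobian over A is the volume of the image, which is 0; the Jacobian is
  -- positive on A, so A is null.
  rw [← lintegral_abs_det_fderiv_eq_addHaar_image volume hAm hτd (t4.mono hAW),
    lintegral_eq_zero_iff' (aemeasurable_ofReal_abs_det_fderivWithin volume hAm hτd),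
    EventuallyEq, ae_restrict_iff' hAm] at himg
  refine measure_mono_null (fun x hx => ?_) (ae_iff.1 himg)
  simp only [mem_ofPred_eq, Classical.not_imp, Pi.zero_apply, ENNReal.ofReal_eq_zero, not_le]
  refine ⟨hx, ?_⟩
  rw [abs_det_restrictScalars, Complex.normSq_pos]
  exact t5 x (hAW hx)

/-- The Kähler volume of a radial potential is the image of its expression in a single chart. -/
theorem kahlerVolume_eq_map {g : ℝ → ℝ} (hg : ContDiffOn ℝ ∞ g (Ioo 0 1))
    {Φ : EuclideanSpace ℂ (Fin 3) → ℝ} (hΦ : ∀ z ∈ keplerBall 2, Φ z = g (‖z‖ ^ 2)) :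
    kahlerVolume 2 (keplerBall 2) Φ = ((volume.restrict keplerDomain).withDensity fun x =>
      ENNReal.ofReal (complexHessian (fun y => Φ (keplerChart y)) x).det.re).map keplerChart := by
  -- The chart is one member of the supremum. Any other is dominated by it: discard the null
  -- exceptional set, then change variables by the transition map, whose real Jacobian |det|² is
  -- exactly the factor in the Hessian determinant.
  refine le_antisymm (iSup_le fun U => iSup_le fun ψ => iSup_le fun h => ?_)
    (le_iSup_of_le keplerDomain (le_iSup_of_le keplerChart
      (le_iSup_of_le isHolParam_keplerChart le_rfl)))
  rw [Measure.le_iff]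
  intro s hs
  have hUm := h.isOpen.measurableSet
  have hc : ContinuousOn ψ U := h.holomorphic.continuousOn
  have hcm : Measurable keplerChart := differentiable_keplerChart.continuous.measurable
  rw [Measure.map_apply_of_aemeasurable
    ((hc.aemeasurable hUm).mono_ac (withDensity_absolutelyContinuous _ _)) hs,
    Measure.map_apply hcm hs, withDensity_apply' _ _, withDensity_apply' _ _,
    Measure.restrict_restrict' hUm, Measure.restrict_restrict' isOpen_keplerDomain.measurableSet]
  set W := U ∩ (fun x => nullForm (ψ x)) ⁻¹' {0}ᶜ with hW
  have hWo : IsOpen W := ContinuousOn.isOpen_inter_preimage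
    (differentiable_nullForm.continuous.comp_continuousOn hc) h.isOpen isOpen_compl_singleton
  have hWU : W ⊆ U := inter_subset_left
  obtain ⟨t1, t2, t3, t4, -⟩ := (h.mono hWo hWU).transition fun x hx => hx.2
  set τ : (Fin 2 → ℂ) → Fin 2 → ℂ := fun x => keplerCoord (ψ x) with hτ
  have hAm : MeasurableSet (ψ ⁻¹' s ∩ W) :=
    (hc.mono hWU).measurableSet_preimage_inter hWo.measurableSet hs
  have hτd : ∀ x ∈ ψ ⁻¹' s ∩ W,
      HasFDerivWithinAt τ ((fderiv ℂ τ x).restrictScalars ℝ) (ψ ⁻¹' s ∩ W) x := fun x hx =>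
    ((t1.differentiableAt (hWo.mem_nhds hx.2)).hasFDerivAt.restrictScalars ℝ).hasFDerivWithinAt
  have hae : (ψ ⁻¹' s ∩ U : Set (Fin 2 → ℂ)) =ᵐ[volume] (ψ ⁻¹' s ∩ W : Set (Fin 2 → ℂ)) := by
    refine (ae_le_set.2 ?_).antisymm (inter_subset_inter_right _ hWU).eventuallyLE
    refine measure_mono_null (fun x hx => ?_) (volume_nullForm_eq_zero h)
    by_contra h0
    exact hx.2 ⟨hx.1.1, hx.1.2, fun h1 => h0 ⟨h1, hx.1.2⟩⟩
  calc _ = ∫⁻ x in ψ ⁻¹' s ∩ W, ENNReal.ofReal (complexHessian (fun y => Φ (ψ y)) x).det.re :=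
        setLIntegral_congr hae
    _ = ∫⁻ x in ψ ⁻¹' s ∩ W, ENNReal.ofReal |((fderiv ℂ τ x).restrictScalars ℝ).det| *
          ENNReal.ofReal (complexHessian (fun y => Φ (keplerChart y)) (τ x)).det.re := by
        refine setLIntegral_congr_fun hAm fun x hx => ?_
        rw [det_complexHessian_comp hg (fun y hy => hΦ _ (keplerChart_mem_keplerBall hy)) hWo
          (h.holomorphic.mono hWU) t1 t2 t3 (fun y hy => hΦ _ (h.mapsTo (hWU hy))) hx.2,
          abs_det_restrictScalars, ← ENNReal.ofReal_mul (Complex.normSq_nonneg _),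
          Complex.re_ofReal_mul]
    _ = ∫⁻ x in τ '' (ψ ⁻¹' s ∩ W),
          ENNReal.ofReal (complexHessian (fun y => Φ (keplerChart y)) x).det.re :=
        (lintegral_image_eq_lintegral_abs_det_fderiv_mul volume hAm hτd
          (t4.mono inter_subset_right)
          fun x => ENNReal.ofReal (complexHessian (fun y => Φ (keplerChart y)) x).det.re).symm
    _ ≤ _ := by
        refine lintegral_mono_set ?_
        rintro _ ⟨x, hx, rfl⟩
        refine ⟨?_, t2 hx.2⟩
        have := t3 x hx.2
        simp only [mem_preimage, hτ] at this ⊢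
        rw [← this]; exact hx.1

end

theorem measurableSet_keplerBall : MeasurableSet (keplerBall 2) := by
  have h1 : IsClosed {z : EuclideanSpace ℂ (Fin 3) | ∑ j, z j ^ 2 = 0} :=
    isClosed_eq (continuous_finsetSum _ fun j _ =>
      ((EuclideanSpace.proj (𝕜 := ℂ) j).continuous.pow 2)) continuous_const
  exact h1.measurableSet.inter ((isOpen_ne.measurableSet).inter
    (isOpen_lt continuous_norm continuous_const).measurableSet)

/-! ### The weighted volume in the chart. -/

/-- The chart of the Kepler manifold, with its two coordinates in a product. -/
noncomputable def keplerChartProd (p : ℂ × ℂ) : EuclideanSpace ℂ (Fin 3) := keplerChart ![p.1, p.2]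

theorem continuous_keplerChartProd : Continuous keplerChartProd :=
  differentiable_keplerChart.continuous.comp (by
    refine continuous_pi fun i => ?_
    fin_cases i
    · exact continuous_fst
    · exact continuous_snd)

/-- The squared norm of a point of the Kepler manifold in the chart. -/
noncomputable def chartNormSq (p : ℂ × ℂ) : ℝ := 2 * ‖p.1‖ ^ 2 * (1 + ‖p.2‖ ^ 2) ^ 2

theorem continuous_chartNormSq : Continuous chartNormSq := by
  unfold chartNormSq; fun_prop

theorem norm_sq_keplerChartProd (p : ℂ × ℂ) : ‖keplerChartProd p‖ ^ 2 = chartNormSq p := by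
  rw [keplerChartProd, norm_sq_keplerChart]; rfl

theorem mem_keplerDomain_iff_chartNormSq {p : ℂ × ℂ} :
    ![p.1, p.2] ∈ keplerDomain ↔ chartNormSq p ∈ Ioo (0 : ℝ) 1 := by
  refine and_congr_left fun _ => ?_
  simp only [Matrix.cons_val_zero, chartNormSq]
  constructor
  · intro h
    have : 0 < ‖p.1‖ := norm_pos_iff.2 h
    positivity
  · intro h h0
    simp [h0] at h

/-- The weighted volume of a radial balanced function, in the chart. -/
noncomputable def chartMeasure (f : ℝ → ℝ) : Measure (ℂ × ℂ) :=
  volume.withDensity fun p =>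
    ENNReal.ofReal (2 * (Ioo 0 1).indicator (radialDensity f) (chartNormSq p))

namespace IsRadialProfile

variable {f : ℝ → ℝ}

theorem measurable_indicator (hf : IsRadialProfile f) :
    Measurable ((Ioo 0 1).indicator (radialDensity f)) := by
  classical
  rw [← piecewise_eq_indicator]
  exact ContinuousOn.measurable_piecewise hf.contDiffOn_radialDensity.continuousOn
    (continuousOn_const (c := (0 : ℝ))) measurableSet_Ioo

theorem measurable_chartDensity (hf : IsRadialProfile f) : Measurable fun p : ℂ × ℂ =>
    ENNReal.ofReal (2 * (Ioo 0 1).indicator (radialDensity f) (chartNormSq p)) :=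
  ((hf.measurable_indicator.comp continuous_chartNormSq.measurable).const_mul 2).ennreal_ofReal

theorem balancedWeight_eq_map (hf : IsRadialProfile f) {u : EuclideanSpace ℂ (Fin 3) → ℝ}
    (hu : ∀ z ∈ keplerBall 2, u z = f (‖z‖ ^ 2)) :
    balancedWeight 2 (keplerBall 2) u = (chartMeasure f).map keplerChartProd := by
  classical
  set g : ℝ → ℝ := fun s => Real.log (1 / f s)
  have hfi : Measurable ((Ioo 0 1).indicator f) := by
    rw [← piecewise_eq_indicator]
    exact ContinuousOn.measurable_piecewise hf.contDiffOn.continuousOn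
      (continuousOn_const (c := (0 : ℝ))) measurableSet_Ioo
  have hcm : Measurable keplerChart := differentiable_keplerChart.continuous.measurable
  rw [balancedWeight, kahlerVolume_eq_map (g := g) hf.contDiffOn_log (fun z hz => by rw [hu z hz])]
  set ν₀ := (volume.restrict keplerDomain).withDensity fun x =>
    ENNReal.ofReal (complexHessian (fun y => Real.log (1 / u (keplerChart y))) x).det.re with hν₀
  have hdom : MeasurableSet keplerDomain := isOpen_keplerDomain.measurableSet
  -- Nothing is known of u off the ball, so u and the Hessian are replaced almost everywhere by
  -- indicator expressions that are measurable globally; the two factors f³ then cancel.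
  have hν₀' : ν₀ = (volume.restrict keplerDomain).withDensity fun x => ENNReal.ofReal
      (2 * (Ioo 0 1).indicator (radialDensity f) (‖keplerChart x‖ ^ 2)
        / (Ioo 0 1).indicator f (‖keplerChart x‖ ^ 2) ^ 3) := by
    refine withDensity_congr_ae ((ae_restrict_mem hdom).mono fun x hx => ?_)
    have ht := norm_sq_mem_Ioo_of_mem_keplerBall (keplerChart_mem_keplerBall hx)
    have h1 := hf.pow_mul_det_complexHessian
      (φ := fun y => Real.log (1 / u (keplerChart y)))
      (fun y hy => by rw [hu _ (keplerChart_mem_keplerBall hy)]) hx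
    have h2 := (hf.pos _ ht).ne'
    simp only [indicator_of_mem ht]
    rw [← h1]
    congr 1
    field_simp
  have hae : (fun z => ENNReal.ofReal (u z ^ (2 + 1))) =ᵐ[ν₀.map keplerChart]
      fun z => ENNReal.ofReal ((Ioo 0 1).indicator f (‖z‖ ^ 2) ^ 3) := by
    have h1 : ∀ᵐ z ∂(ν₀.map keplerChart), z ∈ keplerBall 2 := by
      refine (ae_map_iff (p := fun z => z ∈ keplerBall 2) hcm.aemeasurable
        measurableSet_keplerBall).2 ?_
      refine (withDensity_absolutelyContinuous _ _).ae_le ?_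
      exact (ae_restrict_mem hdom).mono fun x hx => keplerChart_mem_keplerBall hx
    filter_upwards [h1] with z hz
    rw [indicator_of_mem (norm_sq_mem_Ioo_of_mem_keplerBall hz), hu z hz]
  rw [withDensity_congr_ae hae]
  have hvm : Measurable fun z : EuclideanSpace ℂ (Fin 3) =>
      ENNReal.ofReal ((Ioo 0 1).indicator f (‖z‖ ^ 2) ^ 3) :=
    ((hfi.comp (by fun_prop : Measurable fun z : EuclideanSpace ℂ (Fin 3) => ‖z‖ ^ 2)).pow_const
      3).ennreal_ofReal
  have hsq : Measurable fun x : Fin 2 → ℂ => ‖keplerChart x‖ ^ 2 := (hcm.norm).pow_const 2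
  have hρm : Measurable fun x : Fin 2 → ℂ => ENNReal.ofReal
      (2 * (Ioo 0 1).indicator (radialDensity f) (‖keplerChart x‖ ^ 2)
        / (Ioo 0 1).indicator f (‖keplerChart x‖ ^ 2) ^ 3) :=
    (((hf.measurable_indicator.comp hsq).const_mul 2).div
      ((hfi.comp hsq).pow_const 3)).ennreal_ofReal
  have hvm' : Measurable fun x : Fin 2 → ℂ =>
      ENNReal.ofReal ((Ioo 0 1).indicator f (‖keplerChart x‖ ^ 2) ^ 3) := hvm.comp hcm
  have hmp := (volume_preserving_finTwoArrow ℂ).symm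
  have hpe : Measurable keplerChartProd := continuous_keplerChartProd.measurable
  ext s hs
  rw [withDensity_apply _ hs, setLIntegral_map hs hvm hcm, hν₀',
    setLIntegral_withDensity_eq_setLIntegral_mul _ hρm hvm' (hcm hs),
    Measure.restrict_restrict (hcm hs), Measure.map_apply hpe hs, chartMeasure,
    withDensity_apply _ (hpe hs), ← lintegral_indicator ((hcm hs).inter hdom),
    ← lintegral_indicator (hpe hs), ← hmp.lintegral_comp_emb (MeasurableEquiv.measurableEmbedding _)]
  refine lintegral_congr fun p => ?_
  have hp : (MeasurableEquiv.finTwoArrow.symm p : Fin 2 → ℂ) = ![p.1, p.2] := by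
    ext i; fin_cases i <;> rfl
  rw [hp]
  by_cases h1 : ![p.1, p.2] ∈ keplerDomain
  · have ht := mem_keplerDomain_iff_chartNormSq.1 h1
    have hpos := hf.pos _ ht
    by_cases h2 : keplerChartProd p ∈ s
    · rw [indicator_of_mem (show ![p.1, p.2] ∈ keplerChart ⁻¹' s ∩ keplerDomain from ⟨h2, h1⟩),
        indicator_of_mem (show p ∈ keplerChartProd ⁻¹' s from h2)]
      simp only [Pi.mul_apply]
      change ENNReal.ofReal (_ * (Ioo 0 1).indicator _ (‖keplerChartProd p‖ ^ 2)
        / (Ioo 0 1).indicator f (‖keplerChartProd p‖ ^ 2) ^ 3)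
        * ENNReal.ofReal ((Ioo 0 1).indicator f (‖keplerChartProd p‖ ^ 2) ^ 3) = _
      rw [norm_sq_keplerChartProd, indicator_of_mem ht f, ← ENNReal.ofReal_mul' (by positivity)]
      congr 1
      field_simp
    · rw [indicator_of_notMem (show ![p.1, p.2] ∉ keplerChart ⁻¹' s ∩ keplerDomain from
          fun h => h2 h.1), indicator_of_notMem (show p ∉ keplerChartProd ⁻¹' s from h2)]
  · rw [indicator_of_notMem (fun h => h1 h.2)]
    have h2 : chartNormSq p ∉ Ioo (0 : ℝ) 1 := fun h => h1 (mem_keplerDomain_iff_chartNormSq.2 h)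
    rw [indicator_apply, indicator_of_notMem h2]
    simp

end IsRadialProfile

instance fact_two_pi_pos : Fact (0 < 2 * Real.pi) := ⟨Real.two_pi_pos⟩

/-! ### Laurent coefficients and averages over the circle. -/

section Circle

open AddCircle Real Complex Metric

theorem fourier_two_pi_eq_zpow (m : ℤ) (x : AddCircle (2 * π)) :
    fourier m x = (toCircle x : ℂ) ^ m := by
  rw [fourier_apply, toCircle_zsmul, Circle.coe_zpow]

theorem toCircle_two_pi_coe (x : ℝ) :
    ((toCircle (x : AddCircle (2 * π)) : Circle) : ℂ) = Complex.exp (x * I) := by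
  rw [toCircle_apply_mk, div_self Real.two_pi_pos.ne', one_mul, Circle.coe_exp]

theorem fourierCoeff_comp_toCircle_mul (h : ℂ → ℂ) (m : ℤ) {z : ℂ} (hz : z ≠ 0) :
    fourierCoeff (fun x : AddCircle (2 * π) => h (toCircle x * z)) m
      = z ^ m * circleAverage (fun w => w ^ (-m) * h w) 0 ‖z‖ := by
  rw [fourierCoeff_eq_intervalIntegral _ m 0, zero_add, circleAverage_eq_integral_add z.arg,
    one_div, mul_smul_comm, ← intervalIntegral.integral_const_mul]
  congr 1
  refine intervalIntegral.integral_congr fun x _ => ?_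
  have h1 : circleMap 0 ‖z‖ (x + z.arg) = Complex.exp (x * I) * z := by
    conv_rhs => rw [← Complex.norm_mul_exp_arg_mul_I z]
    rw [circleMap, zero_add]
    push_cast
    rw [add_mul, Complex.exp_add]
    ring
  simp only [fourier_two_pi_eq_zpow, toCircle_two_pi_coe, h1, smul_eq_mul, mul_zpow]
  rw [zpow_neg z]
  field_simp

/-- Cauchy's theorem on the annulus: Laurent coefficients do not depend on the radius. -/
theorem circleAverage_zpow_mul_eq {h : ℂ → ℂ} {R : ℝ}
    (hh : DifferentiableOn ℂ h {w | 0 < ‖w‖ ∧ ‖w‖ < R}) (m : ℤ) {r s : ℝ} (hr : 0 < r)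
    (hs : s < R) (hrs : r ≤ s) :
    circleAverage (fun w => w ^ (-m) * h w) 0 s = circleAverage (fun w => w ^ (-m) * h w) 0 r := by
  have hopen : IsOpen {w : ℂ | 0 < ‖w‖ ∧ ‖w‖ < R} :=
    (isOpen_lt continuous_const continuous_norm).inter (isOpen_lt continuous_norm continuous_const)
  have hd : ∀ w : ℂ, 0 < ‖w‖ → ‖w‖ < R → DifferentiableAt ℂ (fun w => w ^ (-m) * h w) w :=
    fun w h0 h1 => (differentiableAt_zpow.2 (Or.inl (norm_pos_iff.1 h0))).mul
      ((hh w ⟨h0, h1⟩).differentiableAt (hopen.mem_nhds ⟨h0, h1⟩))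
  rw [circleAverage_eq_circleIntegral (hr.trans_le hrs).ne', circleAverage_eq_circleIntegral hr.ne',
    circleIntegral_sub_center_inv_smul_eq_of_differentiable_on_annulus_off_countable hr hrs
      countable_empty]
  · intro w hw
    simp only [Set.mem_sdiff, mem_closedBall_zero_iff, mem_ball_zero_iff, not_lt] at hw
    exact (hd w (hr.trans_le hw.2) (hw.1.trans_lt hs)).continuousAt.continuousWithinAt
  · intro w hw
    simp only [Set.mem_sdiff, mem_closedBall_zero_iff, mem_ball_zero_iff, not_le] at hw
    exact hd w (hr.trans hw.1.2) (hw.1.1.trans hs)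

theorem exists_fourierCoeff_eq_mul_zpow {h : ℂ → ℂ} {R : ℝ}
    (hh : DifferentiableOn ℂ h {w | 0 < ‖w‖ ∧ ‖w‖ < R}) :
    ∃ γ : ℤ → ℂ, ∀ m z, 0 < ‖z‖ → ‖z‖ < R →
      fourierCoeff (fun x : AddCircle (2 * π) => h (toCircle x * z)) m = γ m * z ^ m := by
  refine ⟨fun m => circleAverage (fun w => w ^ (-m) * h w) 0 (R / 2), fun m z h0 h1 => ?_⟩
  rw [fourierCoeff_comp_toCircle_mul h m (norm_pos_iff.1 h0), mul_comm]
  congr 1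
  rcases le_total ‖z‖ (R / 2) with h2 | h2
  · exact (circleAverage_zpow_mul_eq hh m h0 (by linarith) h2).symm
  · exact circleAverage_zpow_mul_eq hh m (by linarith) h1 h2

theorem fourierCoeff_zero_comp_toCircle_mul {h : ℂ → ℂ} {R : ℝ} {z : ℂ}
    (hh : DifferentiableOn ℂ h (ball 0 R)) (hz : ‖z‖ < R) :
    fourierCoeff (fun x : AddCircle (2 * π) => h (toCircle x * z)) 0 = h 0 := by
  rcases eq_or_ne z 0 with rfl | h0
  · simp [fourierCoeff]
  rw [fourierCoeff_comp_toCircle_mul h 0 h0]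
  simp only [neg_zero, zpow_zero, one_mul]
  refine DiffContOnCl.circleAverage (DifferentiableOn.diffContOnCl (hh.mono ?_))
  rw [abs_of_nonneg (norm_nonneg z)]
  exact closure_ball_subset_closedBall.trans (closedBall_subset_ball hz)

/-- Bessel's inequality, in extended form so that it can be integrated over a measure space without
integrability conditions. -/
theorem sum_enorm_sq_fourierCoeff_le (φ : C(AddCircle (2 * π), ℂ)) (S : Finset ℤ) :
    ∑ m ∈ S, ‖fourierCoeff φ m‖ₑ ^ 2 ≤ ∫⁻ x, ‖φ x‖ₑ ^ 2 ∂haarAddCircle := by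
  have h1 := hasSum_sq_fourierCoeff (ContinuousMap.toLp (E := ℂ) 2 haarAddCircle ℂ φ)
  simp only [fourierCoeff_toLp] at h1
  have h2 : ∫ t : AddCircle (2 * π),
      ‖ContinuousMap.toLp (E := ℂ) 2 haarAddCircle ℂ φ t‖ ^ 2 ∂haarAddCircle
      = ∫ t : AddCircle (2 * π), ‖φ t‖ ^ 2 ∂haarAddCircle :=
    integral_congr_ae ((ContinuousMap.coeFn_toAEEqFun haarAddCircle φ).mono fun t ht => by
      simp only; rw [← ht]; rfl)
  rw [h2] at h1
  have h3 := sum_le_hasSum S (fun _ _ => sq_nonneg _) h1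
  have hint : Integrable (fun t : AddCircle (2 * π) => ‖φ t‖ ^ 2) haarAddCircle := by
    refine Continuous.integrable_of_hasCompactSupport (by fun_prop) ?_
    exact HasCompactSupport.of_compactSpace _
  calc ∑ m ∈ S, ‖fourierCoeff φ m‖ₑ ^ 2 = ENNReal.ofReal (∑ m ∈ S, ‖fourierCoeff φ m‖ ^ 2) := by
        rw [ENNReal.ofReal_sum_of_nonneg fun _ _ => sq_nonneg _]
        refine Finset.sum_congr rfl fun m _ => ?_
        rw [ENNReal.ofReal_pow (norm_nonneg _), ofReal_norm]
    _ ≤ ENNReal.ofReal (∫ t : AddCircle (2 * π), ‖φ t‖ ^ 2 ∂haarAddCircle) :=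
        ENNReal.ofReal_le_ofReal h3
    _ = _ := by
        rw [ofReal_integral_eq_lintegral_ofReal hint (ae_of_all _ fun _ => sq_nonneg _)]
        refine lintegral_congr fun x => ?_
        rw [ENNReal.ofReal_pow (norm_nonneg _), ofReal_norm]

variable {X : Type*} [MeasurableSpace X] {ν : Measure X} [SFinite ν]
  {T : AddCircle (2 * π) → X → X}

theorem measurePreserving_uncurry (hT : Measurable (Function.uncurry T))
    (hν : ∀ x, MeasurePreserving (T x) ν ν) :
    MeasurePreserving (Function.uncurry T) (haarAddCircle.prod ν) ν :=
  measurePreserving_snd.comp ((MeasurePreserving.id haarAddCircle).skew_product hT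
    (ae_of_all _ fun x => (hν x).map_eq))

/-- Tonelli: averaging over a measure-preserving circle action leaves the integral unchanged. -/
theorem lintegral_circle_action (hT : Measurable (Function.uncurry T))
    (hν : ∀ x, MeasurePreserving (T x) ν ν) {F : X → ENNReal} (hF : Measurable F) :
    ∫⁻ p, ∫⁻ x, F (T x p) ∂haarAddCircle ∂ν = ∫⁻ p, F p ∂ν := by
  rw [← (measurePreserving_uncurry hT hν).lintegral_comp hF]
  exact (lintegral_prod_symm' _ (hF.comp hT)).symm

theorem integral_circle_action (hT : Measurable (Function.uncurry T))
    (hν : ∀ x, MeasurePreserving (T x) ν ν) {F : X → ℂ} (hF : Integrable F ν) :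
    ∫ p, ∫ x, F (T x p) ∂haarAddCircle ∂ν = ∫ p, F p ∂ν := by
  have h := measurePreserving_uncurry hT hν
  have h1 : Integrable (F ∘ Function.uncurry T) (haarAddCircle.prod ν) :=
    (h.integrable_comp hF.aestronglyMeasurable).2 hF
  conv_rhs => rw [← h.map_eq]
  rw [integral_map hT.aemeasurable (by rw [h.map_eq]; exact hF.aestronglyMeasurable)]
  exact (integral_prod_symm _ h1).symm

end Circle

/-! ### Rotation invariance of the weighted volume. -/

section Rotation

open AddCircle Real

/-- Rotation of the first coordinate. -/
noncomputable def rotateFst (x : AddCircle (2 * π)) (p : ℂ × ℂ) : ℂ × ℂ := (toCircle x * p.1, p.2)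

/-- Rotation of the second coordinate. -/
noncomputable def rotateSnd (x : AddCircle (2 * π)) (p : ℂ × ℂ) : ℂ × ℂ := (p.1, toCircle x * p.2)

theorem continuous_toCircle_coe : Continuous fun x : AddCircle (2 * π) => (toCircle x : ℂ) :=
  continuous_subtype_val.comp continuous_toCircle

theorem norm_toCircle_coe (x : AddCircle (2 * π)) : ‖(toCircle x : ℂ)‖ = 1 := Circle.norm_coe _

theorem continuous_uncurry_rotateFst : Continuous (Function.uncurry rotateFst) :=
  ((continuous_toCircle_coe.comp continuous_fst).mul (continuous_fst.comp continuous_snd)).prodMk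
    (continuous_snd.comp continuous_snd)

theorem continuous_uncurry_rotateSnd : Continuous (Function.uncurry rotateSnd) :=
  (continuous_fst.comp continuous_snd).prodMk
    ((continuous_toCircle_coe.comp continuous_fst).mul (continuous_snd.comp continuous_snd))

theorem chartNormSq_rotateFst (x : AddCircle (2 * π)) (p : ℂ × ℂ) :
    chartNormSq (rotateFst x p) = chartNormSq p := by
  simp only [chartNormSq, rotateFst, norm_mul, norm_toCircle_coe, one_mul]

theorem chartNormSq_rotateSnd (x : AddCircle (2 * π)) (p : ℂ × ℂ) :
    chartNormSq (rotateSnd x p) = chartNormSq p := by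
  simp only [chartNormSq, rotateSnd, norm_mul, norm_toCircle_coe, one_mul]

theorem measurePreserving_circle_mul (a : Circle) :
    MeasurePreserving (fun z : ℂ => (a : ℂ) * z) volume volume :=
  (rotation a).measurePreserving

theorem MeasureTheory.MeasurePreserving.withDensity_comp {X : Type*} [MeasurableSpace X]
    {μ : Measure X} {T : X → X} (hT : MeasurePreserving T μ μ) {ρ : X → ENNReal}
    (hρ : Measurable ρ) (h : ∀ x, ρ (T x) = ρ x) :
    MeasurePreserving T (μ.withDensity ρ) (μ.withDensity ρ) := by
  refine ⟨hT.measurable, Measure.ext fun s hs => ?_⟩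
  rw [Measure.map_apply hT.measurable hs, withDensity_apply _ (hT.measurable hs),
    withDensity_apply _ hs, ← hT.setLIntegral_comp_preimage hs hρ]
  exact lintegral_congr fun x => (h x).symm

namespace IsRadialProfile

variable {f : ℝ → ℝ}

theorem measurePreserving_rotateFst (hf : IsRadialProfile f) (x : AddCircle (2 * π)) :
    MeasurePreserving (rotateFst x) (chartMeasure f) (chartMeasure f) :=
  MeasurePreserving.withDensity_comp
    ((measurePreserving_circle_mul (toCircle x)).prod (MeasurePreserving.id volume))
    hf.measurable_chartDensity fun p => by
      change ENNReal.ofReal (2 * indicator _ _ (chartNormSq (rotateFst x p))) = _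
      rw [chartNormSq_rotateFst]

theorem measurePreserving_rotateSnd (hf : IsRadialProfile f) (x : AddCircle (2 * π)) :
    MeasurePreserving (rotateSnd x) (chartMeasure f) (chartMeasure f) :=
  MeasurePreserving.withDensity_comp
    ((MeasurePreserving.id volume).prod (measurePreserving_circle_mul (toCircle x)))
    hf.measurable_chartDensity fun p => by
      change ENNReal.ofReal (2 * indicator _ _ (chartNormSq (rotateSnd x p))) = _
      rw [chartNormSq_rotateSnd]

end IsRadialProfile

end Rotation

/-! ### Norms of the powers of the first coordinate. -/

section Moments

open Real

theorem lintegral_norm_sq (φ : ℝ → ENNReal) (hφ : Measurable φ) :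
    ∫⁻ z : ℂ, φ (‖z‖ ^ 2) = ENNReal.ofReal π * ∫⁻ t in Ioi (0 : ℝ), φ t := by
  rw [← Complex.lintegral_comp_polarCoord_symm]
  have h1 : ∀ p ∈ polarCoord.target, ENNReal.ofReal p.1 • φ (‖Complex.polarCoord.symm p‖ ^ 2)
      = ENNReal.ofReal p.1 * φ (p.1 ^ 2) := fun p hp => by
    rw [smul_eq_mul, Complex.norm_polarCoord_symm, sq_abs]
  rw [setLIntegral_congr_fun polarCoord.open_target.measurableSet h1, polarCoord_target,
    Measure.volume_eq_prod, ← Measure.prod_restrict,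
    lintegral_prod _ (by fun_prop)]
  simp only [lintegral_const, Measure.restrict_apply MeasurableSet.univ, univ_inter,
    Real.volume_Ioo]
  rw [lintegral_mul_const _ (by fun_prop)]
  have h2 : ∫⁻ t in Ioi (0 : ℝ), φ t
      = ∫⁻ r in Ioi (0 : ℝ), ENNReal.ofReal (2 * r) * φ (r ^ 2) := by
    have himg : (fun r : ℝ => r ^ 2) '' Ioi 0 = Ioi 0 := by
      ext t
      constructor
      · rintro ⟨r, hr, rfl⟩
        exact pow_pos (mem_Ioi.1 hr) 2
      · exact fun ht => ⟨√t, Real.sqrt_pos.2 ht, Real.sq_sqrt (le_of_lt ht)⟩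
    have h3 := lintegral_image_eq_lintegral_abs_deriv_mul (s := Ioi (0 : ℝ)) (f := fun r => r ^ 2)
      (f' := fun r => 2 * r) measurableSet_Ioi
      (fun r _ => by simpa using (hasDerivAt_pow 2 r).hasDerivWithinAt)
      (fun a ha b hb h => by
        simpa using (pow_left_inj₀ (le_of_lt ha) (le_of_lt hb) two_ne_zero).1 h) φ
    rw [himg] at h3
    rw [h3]
    refine setLIntegral_congr_fun measurableSet_Ioi fun r hr => ?_
    rw [abs_of_pos (mul_pos two_pos hr)]
  rw [h2]
  have h4 : ∀ r : ℝ, ENNReal.ofReal (2 * r) * φ (r ^ 2)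
      = 2 * (ENNReal.ofReal r * φ (r ^ 2)) := fun r => by
    rw [ENNReal.ofReal_mul zero_le_two, mul_assoc]; simp
  simp only [h4]
  rw [lintegral_const_mul _ (by fun_prop), ← mul_assoc, mul_comm]
  congr 1
  rw [mul_comm, show π - -π = 2 * π by ring, ENNReal.ofReal_mul zero_le_two]
  simp

theorem lintegral_Ioi_comp_const_mul {a : ℝ} (ha : 0 < a) (φ : ℝ → ENNReal) :
    ∫⁻ t in Ioi (0 : ℝ), φ (a * t) = ENNReal.ofReal a⁻¹ * ∫⁻ t in Ioi (0 : ℝ), φ t := by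
  have himg : (fun r : ℝ => a * r) '' Ioi 0 = Ioi 0 := by
    rw [image_mul_left_Ioi ha, mul_zero]
  have h3 := lintegral_image_eq_lintegral_abs_deriv_mul (s := Ioi (0 : ℝ)) (f := fun r => a * r)
    (f' := fun r => a) measurableSet_Ioi
    (fun r _ => by simpa using ((hasDerivAt_id r).const_mul a).hasDerivWithinAt)
    (fun x _ y _ h => mul_left_cancel₀ ha.ne' h) φ
  rw [himg, lintegral_const_mul' _ _ ENNReal.ofReal_ne_top, abs_of_pos ha] at h3
  rw [h3, ← mul_assoc, ← ENNReal.ofReal_mul (by positivity), inv_mul_cancel₀ ha.ne']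
  simp

end Moments

section Moments

open Real

variable {f : ℝ → ℝ}

theorem enorm_zpow_sq (z : ℂ) (m : ℤ) : ‖z ^ m‖ₑ ^ 2 = ENNReal.ofReal ((‖z‖ ^ 2) ^ m) := by
  rw [← ofReal_norm, ← ENNReal.ofReal_pow (norm_nonneg _), norm_zpow, ← zpow_natCast,
    ← zpow_natCast, zpow_comm]

theorem IsRadialProfile.lintegral_slice (hf : IsRadialProfile f) (m : ℤ) {a : ℝ} (ha : 0 < a) :
    ∫⁻ z : ℂ, ENNReal.ofReal (2 * (Ioo 0 1).indicator (radialDensity f) (a * ‖z‖ ^ 2))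
        * ‖z ^ m‖ₑ ^ 2
      = ENNReal.ofReal (2 * π * a ^ (-m - 1)) * radialMoment f m := by
  have hind := hf.measurable_indicator
  have h1 : ∀ z : ℂ, ENNReal.ofReal (2 * (Ioo 0 1).indicator (radialDensity f) (a * ‖z‖ ^ 2))
        * ‖z ^ m‖ₑ ^ 2 = (fun t => ENNReal.ofReal (a ^ (-m)) * ENNReal.ofReal
          (2 * ((a * t) ^ m * (Ioo 0 1).indicator (radialDensity f) (a * t)))) (‖z‖ ^ 2) := fun z => by
    simp only
    rw [enorm_zpow_sq, ← ENNReal.ofReal_mul' (by positivity), ← ENNReal.ofReal_mul (by positivity)]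
    congr 1
    rw [mul_zpow, zpow_neg]
    field_simp
  rw [lintegral_congr h1, lintegral_norm_sq (fun t => ENNReal.ofReal (a ^ (-m)) * ENNReal.ofReal
      (2 * ((a * t) ^ m * (Ioo 0 1).indicator (radialDensity f) (a * t)))) (by fun_prop),
    lintegral_Ioi_comp_const_mul ha
    (fun t => ENNReal.ofReal (a ^ (-m)) * ENNReal.ofReal
          (2 * (t ^ m * (Ioo 0 1).indicator (radialDensity f) t))),
    lintegral_const_mul _ (by fun_prop)]
  have h2 : ∀ t : ℝ, ENNReal.ofReal (2 * (t ^ m * (Ioo 0 1).indicator (radialDensity f) t))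
      = 2 * (Ioo 0 1).indicator (fun t => ENNReal.ofReal (t ^ m * radialDensity f t)) t := fun t => by
    rw [ENNReal.ofReal_mul zero_le_two]
    by_cases ht : t ∈ Ioo (0 : ℝ) 1
    · simp [indicator_of_mem ht]
    · simp [indicator_of_notMem ht]
  rw [lintegral_congr h2, lintegral_const_mul' _ _ (by simp), lintegral_indicator measurableSet_Ioo,
    Measure.restrict_restrict measurableSet_Ioo, inter_eq_left.2 Ioo_subset_Ioi_self]
  change _ * (_ * (_ * (_ * radialMoment f m))) = _
  rw [zpow_sub_one₀ ha.ne', show 2 * π * (a ^ (-m) * a⁻¹) = π * (a⁻¹ * (a ^ (-m) * 2)) by ring,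
    ENNReal.ofReal_mul pi_pos.le, ENNReal.ofReal_mul (by positivity),
    ENNReal.ofReal_mul (by positivity)]
  simp only [ENNReal.ofReal_ofNat, mul_assoc]

/-- For fixed ζ the slice has a = 2(1 + |ζ|²)² and contributes a^(-m-1), whence the power -2m-2. Its
integral over ζ converges for m ≥ 0 and diverges for m < 0. -/
theorem IsRadialProfile.lintegral_zpow_fst (hf : IsRadialProfile f) (m : ℤ) :
    ∫⁻ p, ‖p.1 ^ m‖ₑ ^ 2 ∂(chartMeasure f)
      = ENNReal.ofReal (π ^ 2 * 2 ^ (-m))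
        * (∫⁻ t in Ioi (0 : ℝ), ENNReal.ofReal ((1 + t) ^ (-2 * m - 2))) * radialMoment f m := by
  have hm : Measurable fun p : ℂ × ℂ => ‖p.1 ^ m‖ₑ ^ 2 :=
    ((measurable_fst.pow_const m).enorm).pow_const 2
  rw [chartMeasure, lintegral_withDensity_eq_lintegral_mul _ hf.measurable_chartDensity hm,
    Measure.volume_eq_prod, lintegral_prod_symm' _ (hf.measurable_chartDensity.mul hm)]
  have h1 : ∀ w : ℂ, ∫⁻ z : ℂ, ((fun p : ℂ × ℂ => ENNReal.ofReal
        (2 * (Ioo 0 1).indicator (radialDensity f) (chartNormSq p))) * fun p : ℂ × ℂ => ‖p.1 ^ m‖ₑ ^ 2) (z, w)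
      = (fun t : ℝ => ENNReal.ofReal (π * 2 ^ (-m)) * ENNReal.ofReal ((1 + t) ^ (-2 * m - 2))
        * radialMoment f m) (‖w‖ ^ 2) := fun w => by
    simp only [Pi.mul_apply, chartNormSq]
    have h2 := hf.lintegral_slice m (a := 2 * (1 + ‖w‖ ^ 2) ^ 2) (by positivity)
    simp only [mul_right_comm (2 : ℝ) _ ((1 + ‖w‖ ^ 2) ^ 2)]
    rw [h2, ← ENNReal.ofReal_mul (by positivity)]
    congr 2
    rw [mul_zpow, ← zpow_natCast, ← zpow_mul, zpow_sub_one₀ two_ne_zero,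
      show ((2 : ℕ) : ℤ) * (-m - 1) = -2 * m - 2 by push_cast; ring]
    ring
  rw [lintegral_congr h1, lintegral_norm_sq (fun t : ℝ => ENNReal.ofReal (π * 2 ^ (-m)) *
      ENNReal.ofReal ((1 + t) ^ (-2 * m - 2)) * radialMoment f m) (by fun_prop),
    lintegral_mul_const _ (by fun_prop),
    lintegral_const_mul _ (by fun_prop), pow_two, mul_assoc π π,
    ENNReal.ofReal_mul (q := π * 2 ^ (-m)) pi_pos.le]
  simp only [mul_assoc]

theorem lintegral_one_add_zpow_of_nonneg (m : ℕ) :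
    ∫⁻ t in Ioi (0 : ℝ), ENNReal.ofReal ((1 + t) ^ (-2 * (m : ℤ) - 2))
      = ENNReal.ofReal (1 / (2 * m + 1)) := by
  have hd : ∀ t ∈ Ici (0 : ℝ), HasDerivAt (fun t : ℝ => -((2 * (m : ℝ) + 1)⁻¹ * ((1 + t) ^ (2 * m + 1))⁻¹))
      ((1 + t) ^ (-2 * (m : ℤ) - 2)) t := fun t ht => by
    have h0 : (1 + t) ≠ 0 := by linarith [mem_Ici.1 ht]
    have h1 := ((((hasDerivAt_id t).const_add 1).pow (2 * m + 1)).inv (pow_ne_zero _ h0)).const_mul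
      ((2 * (m : ℝ) + 1)⁻¹)
    convert! h1.neg using 1
    have h2 : (2 * (m : ℝ) + 1) ≠ 0 := by positivity
    rw [show -2 * (m : ℤ) - 2 = -((2 * m + 2 : ℕ) : ℤ) by push_cast; ring, zpow_neg, zpow_natCast]
    simp only [id, add_tsub_cancel_right, Pi.pow_apply]
    push_cast
    field_simp
    ring
  have hpos : ∀ t ∈ Ioi (0 : ℝ), 0 ≤ (1 + t) ^ (-2 * (m : ℤ) - 2) := fun t ht =>
    zpow_nonneg (by linarith [mem_Ioi.1 ht]) _
  have hlim : Tendsto (fun t : ℝ => -((2 * (m : ℝ) + 1)⁻¹ * ((1 + t) ^ (2 * m + 1))⁻¹)) atTop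
      (𝓝 (-((2 * (m : ℝ) + 1)⁻¹ * 0))) :=
    ((((tendsto_pow_atTop (by omega)).comp
      (tendsto_atTop_add_const_left _ 1 tendsto_id)).inv_tendsto_atTop).const_mul _).neg
  rw [← ofReal_integral_eq_lintegral_ofReal (integrableOn_Ioi_deriv_of_nonneg' hd hpos hlim)
    ((ae_restrict_mem measurableSet_Ioi).mono hpos),
    integral_Ioi_of_hasDerivAt_of_nonneg' hd hpos hlim]
  simp

theorem lintegral_one_add_zpow_of_neg {m : ℤ} (hm : m < 0) :
    ∫⁻ t in Ioi (0 : ℝ), ENNReal.ofReal ((1 + t) ^ (-2 * m - 2)) = ⊤ := by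
  rw [← top_le_iff]
  calc ⊤ = ∫⁻ t in Ioi (0 : ℝ), 1 := by simp
    _ ≤ _ := setLIntegral_mono' measurableSet_Ioi fun t ht => by
      rw [ENNReal.one_le_ofReal]
      exact one_le_zpow₀ (by linarith [mem_Ioi.1 ht]) (by omega)

theorem IsRadialProfile.lintegral_zpow_fst_of_neg (hf : IsRadialProfile f) {m : ℤ} (hm : m < 0) :
    ∫⁻ p, ‖p.1 ^ m‖ₑ ^ 2 ∂(chartMeasure f) = ⊤ := by
  rw [hf.lintegral_zpow_fst, lintegral_one_add_zpow_of_neg hm, ENNReal.mul_top,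
    ENNReal.top_mul (hf.radialMoment_pos m).ne']
  rw [Ne, ENNReal.ofReal_eq_zero, not_le]
  positivity

theorem IsRadialProfile.lintegral_pow_fst (hf : IsRadialProfile f) (m : ℕ) :
    ∫⁻ p, ‖p.1 ^ (m : ℤ)‖ₑ ^ 2 ∂(chartMeasure f)
      = ENNReal.ofReal (π ^ 2 / (2 ^ m * (2 * m + 1))) * radialMoment f m := by
  rw [hf.lintegral_zpow_fst, lintegral_one_add_zpow_of_nonneg, ← ENNReal.ofReal_mul (by positivity)]
  congr 2
  rw [zpow_neg, zpow_natCast]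
  field_simp

end Moments

/-! ### The reproducing kernel at the points (w, 0). -/

section Kernel

open AddCircle Real Metric
open scoped ComplexConjugate

/-- The domain of the chart of the unit ball of the Kepler manifold. -/
def chartBall : Set (ℂ × ℂ) := {p | chartNormSq p ∈ Ioo (0 : ℝ) 1}

theorem isOpen_chartBall : IsOpen chartBall :=
  isOpen_Ioo.preimage continuous_chartNormSq

theorem mem_chartBall_iff {p : ℂ × ℂ} :
    p ∈ chartBall ↔ 0 < ‖p.1‖ ∧ 2 * ‖p.1‖ ^ 2 * (1 + ‖p.2‖ ^ 2) ^ 2 < 1 := by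
  refine and_congr_left fun _ => ⟨fun h => ?_, fun h => ?_⟩
  · refine (norm_nonneg _).lt_of_ne fun h0 => ?_
    simp [chartNormSq, ← h0] at h
  · unfold chartNormSq; positivity

/-- The domain is complete in the second variable and punctured in the first: Taylor expansion in ζ,
Laurent expansion in ξ. -/
theorem mem_chartBall_of_norm_le {p q : ℂ × ℂ} (hp : p ∈ chartBall) (h1 : 0 < ‖q.1‖)
    (h1' : ‖q.1‖ ≤ ‖p.1‖) (h2 : ‖q.2‖ ≤ ‖p.2‖) : q ∈ chartBall := by
  rw [mem_chartBall_iff] at hp ⊢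
  refine ⟨h1, lt_of_le_of_lt ?_ hp.2⟩
  gcongr

theorem rotateFst_mem_chartBall {p : ℂ × ℂ} (hp : p ∈ chartBall) (x : AddCircle (2 * π)) :
    rotateFst x p ∈ chartBall := by
  change chartNormSq _ ∈ Ioo (0 : ℝ) 1; rwa [chartNormSq_rotateFst]

theorem rotateSnd_mem_chartBall {p : ℂ × ℂ} (hp : p ∈ chartBall) (x : AddCircle (2 * π)) :
    rotateSnd x p ∈ chartBall := by
  change chartNormSq _ ∈ Ioo (0 : ℝ) 1; rwa [chartNormSq_rotateSnd]

theorem mk_zero_mem_chartBall {p : ℂ × ℂ} (hp : p ∈ chartBall) : (p.1, (0 : ℂ)) ∈ chartBall :=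
  mem_chartBall_of_norm_le hp (mem_chartBall_iff.1 hp).1 le_rfl (by simp)

theorem mk_zero_mem_chartBall_iff {w : ℂ} :
    (w, (0 : ℂ)) ∈ chartBall ↔ 0 < ‖w‖ ∧ ‖w‖ < √(1 / 2) := by
  rw [mem_chartBall_iff, Real.lt_sqrt (norm_nonneg _)]
  refine and_congr_right fun _ => ?_
  simp only [norm_zero]
  constructor <;> intro h <;> linarith

section Holomorphic

variable {G : ℂ × ℂ → ℂ} (hG : DifferentiableOn ℂ G chartBall)

include hG

/-- Mean value property in ζ, on a disc slightly larger than the circle through p. -/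
theorem fourierCoeff_zero_rotateSnd {p : ℂ × ℂ} (hp : p ∈ chartBall) :
    fourierCoeff (fun x : AddCircle (2 * π) => G (rotateSnd x p)) 0 = G (p.1, 0) := by
  have hp' := mem_chartBall_iff.1 hp
  obtain ⟨R, hR, hRp⟩ : ∃ R, 2 * ‖p.1‖ ^ 2 * (1 + R ^ 2) ^ 2 < 1 ∧ ‖p.2‖ < R := by
    have hc : ContinuousAt (fun R : ℝ => 2 * ‖p.1‖ ^ 2 * (1 + R ^ 2) ^ 2) ‖p.2‖ := by fun_prop
    have h1 : ∀ᶠ R in 𝓝[>] ‖p.2‖, 2 * ‖p.1‖ ^ 2 * (1 + R ^ 2) ^ 2 < 1 :=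
      (hc.eventually (gt_mem_nhds hp'.2)).filter_mono nhdsWithin_le_nhds
    exact (h1.and self_mem_nhdsWithin).exists
  refine fourierCoeff_zero_comp_toCircle_mul (h := fun v => G (p.1, v)) (R := R) ?_ hRp
  refine hG.comp (by fun_prop) fun v hv => mem_chartBall_iff.2 ⟨hp'.1, lt_of_le_of_lt ?_ hR⟩
  have := (mem_ball_zero_iff.1 hv).le
  simp only
  gcongr

theorem differentiableOn_mk_zero :
    DifferentiableOn ℂ (fun w => G (w, 0)) {w : ℂ | 0 < ‖w‖ ∧ ‖w‖ < √(1 / 2)} :=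
  hG.comp (by fun_prop) fun _ hw => mk_zero_mem_chartBall_iff.2 hw

theorem continuous_comp_rotateSnd {p : ℂ × ℂ} (hp : p ∈ chartBall) :
    Continuous fun x : AddCircle (2 * π) => G (rotateSnd x p) :=
  hG.continuousOn.comp_continuous
    (continuous_uncurry_rotateSnd.comp (Continuous.prodMk_left p)) (rotateSnd_mem_chartBall hp)

theorem continuous_comp_rotateFst {p : ℂ × ℂ} (hp : p ∈ chartBall) :
    Continuous fun x : AddCircle (2 * π) => G ((rotateFst x p).1, 0) :=
  hG.continuousOn.comp_continuous (((continuous_fst.comp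
    (continuous_uncurry_rotateFst.comp (Continuous.prodMk_left p)))).prodMk continuous_const)
    fun x => mk_zero_mem_chartBall (rotateFst_mem_chartBall hp x)

end Holomorphic

namespace IsRadialProfile

variable {f : ℝ → ℝ} {G : ℂ × ℂ → ℂ}

theorem ae_mem_chartBall (hf : IsRadialProfile f) : ∀ᵐ p ∂(chartMeasure f), p ∈ chartBall := by
  rw [chartMeasure, ae_withDensity_iff hf.measurable_chartDensity]
  refine ae_of_all _ fun p hp => ?_
  by_contra h
  exact hp (by rw [indicator_of_notMem (show chartNormSq p ∉ Ioo (0 : ℝ) 1 from h)]; simp)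

/-- Setting ζ = 0 is averaging over rotations of ζ, hence a contraction: Bessel with the single
frequency 0. -/
theorem lintegral_enorm_sq_mk_zero_le (hf : IsRadialProfile f) (hGm : Measurable G)
    (hG : DifferentiableOn ℂ G chartBall) :
    ∫⁻ p, ‖G (p.1, 0)‖ₑ ^ 2 ∂(chartMeasure f) ≤ ∫⁻ p, ‖G p‖ₑ ^ 2 ∂(chartMeasure f) := by
  have : SFinite (chartMeasure f) := by unfold chartMeasure; infer_instance
  rw [← lintegral_circle_action continuous_uncurry_rotateSnd.measurable
    hf.measurePreserving_rotateSnd (hGm.enorm.pow_const 2)]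
  refine lintegral_mono_ae (hf.ae_mem_chartBall.mono fun p hp => ?_)
  have h := sum_enorm_sq_fourierCoeff_le ⟨_, continuous_comp_rotateSnd hG hp⟩ {0}
  simp only [Finset.sum_singleton, ContinuousMap.coe_mk] at h
  rwa [fourierCoeff_zero_rotateSnd hG hp] at h

theorem sum_enorm_sq_mul_lintegral_le (hf : IsRadialProfile f) (hGm : Measurable G)
    (hG : DifferentiableOn ℂ G chartBall) {γ : ℤ → ℂ}
    (hγ : ∀ m z, 0 < ‖z‖ → ‖z‖ < √(1 / 2) →
      fourierCoeff (fun x : AddCircle (2 * π) => G (toCircle x * z, 0)) m = γ m * z ^ m)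
    (S : Finset ℤ) :
    ∑ m ∈ S, ‖γ m‖ₑ ^ 2 * ∫⁻ p, ‖p.1 ^ m‖ₑ ^ 2 ∂(chartMeasure f)
      ≤ ∫⁻ p, ‖G p‖ₑ ^ 2 ∂(chartMeasure f) := by
  have : SFinite (chartMeasure f) := by unfold chartMeasure; infer_instance
  refine le_trans ?_ (hf.lintegral_enorm_sq_mk_zero_le hGm hG)
  have hgm : Measurable fun p : ℂ × ℂ => ‖G (p.1, 0)‖ₑ ^ 2 :=
    ((hGm.comp (measurable_fst.prodMk measurable_const)).enorm).pow_const 2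
  have hm : ∀ m : ℤ, Measurable fun p : ℂ × ℂ => ‖p.1 ^ m‖ₑ ^ 2 := fun m =>
    ((measurable_fst.pow_const m).enorm).pow_const 2
  rw [← lintegral_circle_action continuous_uncurry_rotateFst.measurable
    hf.measurePreserving_rotateFst hgm]
  calc _ = ∫⁻ p, ∑ m ∈ S, ‖γ m‖ₑ ^ 2 * ‖p.1 ^ m‖ₑ ^ 2 ∂(chartMeasure f) := by
        rw [lintegral_finsetSum _ fun m _ => (hm m).const_mul _]
        exact Finset.sum_congr rfl fun m _ => (lintegral_const_mul _ (hm m)).symm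
    _ ≤ _ := by
        refine lintegral_mono_ae (hf.ae_mem_chartBall.mono fun p hp => ?_)
        have h := sum_enorm_sq_fourierCoeff_le ⟨_, continuous_comp_rotateFst hG hp⟩ S
        simp only [ContinuousMap.coe_mk] at h
        refine le_of_eq_of_le (Finset.sum_congr rfl fun m _ => ?_) h
        have hp0 := mk_zero_mem_chartBall_iff.1 (mk_zero_mem_chartBall hp)
        rw [← mul_pow, ← enorm_mul]
        congr 2
        exact (hγ m p.1 hp0.1 hp0.2).symm

/-- Orthogonality: averaging over rotations of ζ and then of ξ leaves only the term γ_m ξ^m of G. -/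
theorem integral_pow_mul_conj (hf : IsRadialProfile f) (hGm : Measurable G)
    (hG : DifferentiableOn ℂ G chartBall)
    (hG2 : ∫⁻ p, ‖G p‖ₑ ^ 2 ∂(chartMeasure f) ≠ ⊤) {γ : ℤ → ℂ}
    (hγ : ∀ m z, 0 < ‖z‖ → ‖z‖ < √(1 / 2) →
      fourierCoeff (fun x : AddCircle (2 * π) => G (toCircle x * z, 0)) m = γ m * z ^ m)
    {m : ℕ} (hm : ∫⁻ p, ‖p.1 ^ (m : ℤ)‖ₑ ^ 2 ∂(chartMeasure f) ≠ ⊤) :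
    ∫ p, p.1 ^ m * conj (G p) ∂(chartMeasure f)
      = conj (γ m) * ((∫⁻ p, ‖p.1 ^ (m : ℤ)‖ₑ ^ 2 ∂(chartMeasure f)).toReal : ℂ) := by
  have : SFinite (chartMeasure f) := by unfold chartMeasure; infer_instance
  have hL : ∀ F : ℂ × ℂ → ℂ, Measurable F → ∫⁻ p, ‖F p‖ₑ ^ 2 ∂(chartMeasure f) ≠ ⊤ →
      MemLp F 2 (chartMeasure f) := fun F hF h => by
    refine ⟨hF.aestronglyMeasurable, ?_⟩
    rw [eLpNorm_lt_top_iff_lintegral_rpow_enorm_lt_top two_ne_zero ENNReal.ofNat_ne_top]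
    simpa using h.lt_top
  have hpm : Measurable fun p : ℂ × ℂ => p.1 ^ m := measurable_fst.pow_const m
  have hpL : MemLp (fun p : ℂ × ℂ => p.1 ^ m) 2 (chartMeasure f) :=
    hL _ hpm (by simpa using hm)
  have hgm : Measurable fun p : ℂ × ℂ => G (p.1, 0) :=
    hGm.comp (measurable_fst.prodMk measurable_const)
  have hI1 : Integrable (fun p => p.1 ^ m * conj (G p)) (chartMeasure f) :=
    MemLp.integrable_mul hpL (hL _ hGm hG2).star
  have hI2 : Integrable (fun p => p.1 ^ m * conj (G (p.1, 0))) (chartMeasure f) :=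
    MemLp.integrable_mul hpL (hL _ hgm
      (ne_top_of_le_ne_top hG2 (hf.lintegral_enorm_sq_mk_zero_le hGm hG))).star
  rw [← integral_circle_action continuous_uncurry_rotateSnd.measurable
    hf.measurePreserving_rotateSnd hI1]
  have h1 : ∀ p ∈ chartBall, ∫ x, (rotateSnd x p).1 ^ m * conj (G (rotateSnd x p)) ∂haarAddCircle
      = p.1 ^ m * conj (G (p.1, 0)) := fun p hp => by
    rw [← fourierCoeff_zero_rotateSnd hG hp]
    simp only [fourierCoeff, neg_zero, fourier_zero, one_smul]
    rw [← integral_conj, ← integral_const_mul]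
    rfl
  rw [integral_congr_ae (hf.ae_mem_chartBall.mono h1),
    ← integral_circle_action continuous_uncurry_rotateFst.measurable
      hf.measurePreserving_rotateFst hI2]
  have h2 : ∀ p ∈ chartBall,
      ∫ x, (rotateFst x p).1 ^ m * conj (G ((rotateFst x p).1, 0)) ∂haarAddCircle
      = conj (γ m) * ((‖p.1 ^ m‖ ^ 2 : ℝ) : ℂ) := fun p hp => by
    have hp0 := mk_zero_mem_chartBall_iff.1 (mk_zero_mem_chartBall hp)
    have h3 := congrArg (fun c => p.1 ^ m * conj c) (hγ m p.1 hp0.1 hp0.2)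
    simp only [fourierCoeff] at h3
    rw [← integral_conj, ← integral_const_mul] at h3
    rw [Complex.ofReal_pow, ← Complex.mul_conj' (p.1 ^ m)]
    refine Eq.trans (integral_congr_ae (ae_of_all _ fun x => ?_))
      (h3.trans (by rw [zpow_natCast, map_mul]; ring))
    simp only [rotateFst, smul_eq_mul, map_mul, fourier_neg, Complex.conj_conj,
      fourier_two_pi_eq_zpow, zpow_natCast, mul_pow]
    ring
  rw [integral_congr_ae (hf.ae_mem_chartBall.mono h2), integral_const_mul, integral_complex_ofReal]
  congr 2
  rw [integral_eq_lintegral_of_nonneg_ae (ae_of_all _ fun _ => sq_nonneg _)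
    (hpm.norm.pow_const 2).aestronglyMeasurable]
  congr 1
  refine lintegral_congr fun p => ?_
  rw [ENNReal.ofReal_pow (norm_nonneg _), ofReal_norm, zpow_natCast]

/-- Let N_m be the squared norm of ξ^m and γ_m the Laurent coefficients of G(·, 0). If N_m is
infinite, in particular for m < 0, Bessel gives γ_m = 0; otherwise reproducing ξ^m gives w^m =
conj(γ_m) N_m. So the Laurent series of G(·, 0) at w has the stated terms. -/
theorem hasSum_kernel (hf : IsRadialProfile f) (hGm : Measurable G)
    (hG : DifferentiableOn ℂ G chartBall)
    (hG2 : ∫⁻ p, ‖G p‖ₑ ^ 2 ∂(chartMeasure f) ≠ ⊤) {w : ℂ} (hw : (w, (0 : ℂ)) ∈ chartBall)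
    (hrep : ∀ m : ℕ, ∫⁻ p, ‖p.1 ^ (m : ℤ)‖ₑ ^ 2 ∂(chartMeasure f) ≠ ⊤ →
      w ^ m = ∫ p, p.1 ^ m * conj (G p) ∂(chartMeasure f)) :
    HasSum (fun m : ℕ => (((‖w‖ ^ 2) ^ m
      / (∫⁻ p, ‖p.1 ^ (m : ℤ)‖ₑ ^ 2 ∂(chartMeasure f)).toReal : ℝ) : ℂ)) (G (w, 0)) := by
  obtain ⟨γ, hγ⟩ := exists_fourierCoeff_eq_mul_zpow (differentiableOn_mk_zero hG)
  set N : ℤ → ENNReal := fun m => ∫⁻ p, ‖p.1 ^ m‖ₑ ^ 2 ∂(chartMeasure f) with hN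
  have hS := hf.sum_enorm_sq_mul_lintegral_le hGm hG hγ
  have hw0 := mk_zero_mem_chartBall_iff.1 hw
  have hγ0 : ∀ m, N m = ⊤ → γ m = 0 := fun m hm => by
    by_contra h
    have h1 := hS {m}
    rw [Finset.sum_singleton, show ∫⁻ p, ‖p.1 ^ m‖ₑ ^ 2 ∂(chartMeasure f) = ⊤ from hm,
      ENNReal.mul_top (by simpa using h), top_le_iff] at h1
    exact hG2 h1
  have hγ1 : ∀ m : ℕ, N m ≠ ⊤ → w ^ m = conj (γ m) * ((N m).toReal : ℂ) := fun m hm => by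
    rw [hrep m hm, hf.integral_pow_mul_conj hGm hG hG2 hγ hm]
  have hneg : ∀ m : ℤ, m < 0 → γ m = 0 := fun m hm => hγ0 m (hf.lintegral_zpow_fst_of_neg hm)
  -- Thus the terms at w are the Bessel terms, and the series converges absolutely.
  have hterm : ∀ m : ℤ, ‖γ m * w ^ m‖ₑ = ‖γ m‖ₑ ^ 2 * N m := fun m => by
    by_cases hm : N m = ⊤
    · simp [hγ0 m hm]
    rcases lt_or_ge m 0 with hm0 | hm0
    · simp [hneg m hm0]
    lift m to ℕ using hm0
    rw [zpow_natCast, enorm_mul, hγ1 m hm, enorm_mul, pow_two, mul_assoc]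
    congr 2
    · rw [← ofReal_norm, RCLike.norm_conj, ofReal_norm]
    · rw [← ofReal_norm, Complex.norm_real, Real.norm_of_nonneg ENNReal.toReal_nonneg,
        ENNReal.ofReal_toReal hm]
  have hsum : Summable fun m : ℤ => γ m * w ^ m := by
    refine Summable.of_norm (summable_of_sum_le
      (c := (∫⁻ p, ‖G p‖ₑ ^ 2 ∂(chartMeasure f)).toReal) (fun _ => norm_nonneg _) fun S => ?_)
    refine (ENNReal.ofReal_le_iff_le_toReal hG2).1 ?_
    rw [ENNReal.ofReal_sum_of_nonneg fun _ _ => norm_nonneg _]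
    simp only [ofReal_norm, hterm]
    exact hS S
  let φ : C(AddCircle (2 * π), ℂ) := ⟨_, continuous_comp_rotateFst hG hw⟩
  have hφ : fourierCoeff φ = fun m => γ m * w ^ m := funext fun m => hγ m w hw0.1 hw0.2
  -- At angle 0 the Fourier series of the rotated function sums to G(w, 0).
  have h1 := has_pointwise_sum_fourier_series_of_summable (f := φ) (by rw [hφ]; exact hsum) 0
  have h2 : φ 0 = G (w, 0) := by simp [φ, rotateFst]
  simp only [hφ, h2, fourier_eval_zero, smul_eq_mul, mul_one] at h1
  rw [← Function.Injective.hasSum_iff Nat.cast_injective fun m hm => ?_] at h1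
  · convert! h1 using 1
    ext m
    change (((‖w‖ ^ 2) ^ m / (N m).toReal : ℝ) : ℂ) = γ m * w ^ (m : ℤ)
    rw [zpow_natCast]
    by_cases hm : N m = ⊤
    · rw [hγ0 m hm]; simp [hm]
    have hpos : 0 < (N m).toReal := by
      refine ENNReal.toReal_pos ?_ hm
      rw [hN]
      simp only
      rw [hf.lintegral_pow_fst]
      refine mul_ne_zero ?_ (hf.radialMoment_pos m).ne'
      rw [Ne, ENNReal.ofReal_eq_zero, not_le]
      positivity
    have h3 : γ m = conj (w ^ m) / ((N m).toReal : ℂ) := by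
      rw [hγ1 m hm, map_mul, Complex.conj_conj, Complex.conj_ofReal,
        mul_div_cancel_right₀ _ (by exact_mod_cast hpos.ne')]
    rw [h3, div_mul_eq_mul_div, Complex.conj_mul', norm_pow]
    push_cast
    ring
  · rw [hneg m (by
      by_contra h
      exact hm ⟨m.toNat, Int.toNat_of_nonneg (not_lt.1 h)⟩), zero_mul]

end IsRadialProfile

end Kernel

/-! ### The balanced condition and the conclusion. -/

section Balanced

open Real
open scoped ComplexConjugate

theorem vec_mem_keplerDomain_iff {p : ℂ × ℂ} : ![p.1, p.2] ∈ keplerDomain ↔ p ∈ chartBall :=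
  mem_keplerDomain_iff_chartNormSq

theorem IsHolomorphicOn.differentiableOn_keplerChartProd {g : EuclideanSpace ℂ (Fin 3) → ℂ}
    (hg : IsHolomorphicOn 2 (keplerBall 2) g) :
    DifferentiableOn ℂ (fun p => g (keplerChartProd p)) chartBall := by
  refine (hg _ _ isHolParam_keplerChart).comp (t := keplerDomain)
    (f := fun p : ℂ × ℂ => ![p.1, p.2]) ?_ fun p hp => vec_mem_keplerDomain_iff.2 hp
  rw [differentiableOn_pi]
  intro i
  fin_cases i
  · exact differentiableOn_fst
  · exact differentiableOn_snd

theorem differentiable_nullForm_pow (m : ℕ) : Differentiable ℂ fun z => (nullForm z / 2) ^ m :=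
  by
  simpa only [div_eq_mul_inv] using (differentiable_nullForm.mul_const (2 : ℂ)⁻¹).fun_pow m

theorem isHolomorphicOn_nullForm_pow (m : ℕ) :
    IsHolomorphicOn 2 (keplerBall 2) fun z => (nullForm z / 2) ^ m := fun _ _ hψ =>
  (differentiable_nullForm_pow m).comp_differentiableOn hψ.holomorphic

theorem nullForm_keplerChartProd (p : ℂ × ℂ) : nullForm (keplerChartProd p) / 2 = p.1 := by
  rw [keplerChartProd, nullForm_keplerChart]
  simp

theorem memLp_two_iff_lintegral_enorm_sq_ne_top {X : Type*} [MeasurableSpace X] {μ : Measure X} {F : X → ℂ}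
    (hF : AEStronglyMeasurable F μ) : MemLp F 2 μ ↔ ∫⁻ x, ‖F x‖ₑ ^ 2 ∂μ ≠ ⊤ := by
  rw [MemLp, and_iff_right hF, eLpNorm_lt_top_iff_lintegral_rpow_enorm_lt_top two_ne_zero
    ENNReal.ofNat_ne_top, lt_top_iff_ne_top]
  simp

/-- The test functions are powers of `nullForm`/2, holomorphic on all of M and equal to ξ^m in the
chart. -/
theorem IsRadialProfile.hasSum_bergmanKernel {f : ℝ → ℝ} (hf : IsRadialProfile f)
    {u : EuclideanSpace ℂ (Fin 3) → ℝ} (hu : ∀ z ∈ keplerBall 2, u z = f (‖z‖ ^ 2))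
    {K : EuclideanSpace ℂ (Fin 3) → EuclideanSpace ℂ (Fin 3) → ℂ}
    (hK : IsBergmanKernel 2 (keplerBall 2) (balancedWeight 2 (keplerBall 2) u) K)
    {w : ℂ} (hw : (w, (0 : ℂ)) ∈ chartBall) :
    HasSum (fun m : ℕ => (((‖w‖ ^ 2) ^ m
      / (∫⁻ p, ‖p.1 ^ (m : ℤ)‖ₑ ^ 2 ∂(chartMeasure f)).toReal : ℝ) : ℂ))
      (K (keplerChartProd (w, 0)) (keplerChartProd (w, 0))) := by
  classical
  set y := keplerChartProd (w, 0) with hy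
  have hE : Measurable keplerChartProd := continuous_keplerChartProd.measurable
  have hyM : y ∈ keplerBall 2 := keplerChart_mem_keplerBall (vec_mem_keplerDomain_iff.2 hw)
  obtain ⟨⟨hhol, hLp⟩, hrep⟩ := hK y hyM
  rw [hf.balancedWeight_eq_map hu] at hLp hrep
  have hd := hhol.differentiableOn_keplerChartProd
  have hGe : EqOn (chartBall.indicator fun p => K (keplerChartProd p) y)
    (fun p => K (keplerChartProd p) y) chartBall := fun p hp => indicator_of_mem hp _
  have hae : (chartBall.indicator fun p => K (keplerChartProd p) y)
      =ᵐ[chartMeasure f] fun p => K (keplerChartProd p) y := hf.ae_mem_chartBall.mono hGe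
  have hGm : Measurable (chartBall.indicator fun p => K (keplerChartProd p) y) := by
    rw [← piecewise_eq_indicator]
    exact ContinuousOn.measurable_piecewise hd.continuousOn
      (continuousOn_const (c := (0 : ℂ))) isOpen_chartBall.measurableSet
  have hLp' := (memLp_map_measure_iff hLp.aestronglyMeasurable hE.aemeasurable).1 hLp
  have hG2 := (memLp_two_iff_lintegral_enorm_sq_ne_top hGm.aestronglyMeasurable).1 (hLp'.ae_eq hae.symm)
  have h := hf.hasSum_kernel hGm (hd.congr hGe) hG2 hw fun m hm => ?_
  · rwa [hGe hw] at h
  · have hem : (fun z => (nullForm z / 2) ^ m) ∘ keplerChartProd = fun p => p.1 ^ m :=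
      funext fun p => by rw [Function.comp, nullForm_keplerChartProd]
    have hmem : MemBergman 2 (keplerBall 2) ((chartMeasure f).map keplerChartProd)
        fun z => (nullForm z / 2) ^ m := by
      refine ⟨isHolomorphicOn_nullForm_pow m, ?_⟩
      rw [memLp_map_measure_iff (differentiable_nullForm_pow m).continuous.aestronglyMeasurable
        hE.aemeasurable, hem, memLp_two_iff_lintegral_enorm_sq_ne_top
          (measurable_fst.pow_const m).aestronglyMeasurable]
      simpa using hm
    have h1 := hrep _ hmem
    have hm2 : AEStronglyMeasurable (fun z => (nullForm z / 2) ^ m * conj (K z y))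
        ((chartMeasure f).map keplerChartProd) :=
      (differentiable_nullForm_pow m).continuous.aestronglyMeasurable.mul
        hLp.aestronglyMeasurable.star
    simp only [hy, nullForm_keplerChartProd] at h1
    rw [← hy] at h1
    refine (h1.trans (integral_map hE.aemeasurable hm2)).trans ?_
    refine integral_congr_ae (hae.mono fun p hp => ?_)
    simp only [hp, nullForm_keplerChartProd]

theorem not_isBalanced_of_analyticAt {u : EuclideanSpace ℂ (Fin 3) → ℝ} {f F : ℝ → ℝ}
    (hu : ∀ z ∈ keplerBall 2, u z = f (‖z‖ ^ 2)) (hF : AnalyticAt ℝ F 1) (hF1 : F 1 = 0)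
    (hF' : deriv F 1 ≠ 0) (hfF : f =ᶠ[𝓝[<] 1] F) : ¬ IsBalanced 2 (keplerBall 2) u := by
  rintro ⟨hpos, hsm, hpsh, K, hK, c, hc⟩
  have hf := isRadialProfile_of_strictlyPsh hu hpos hsm hpsh
  -- At w = √(t/2) the factor 2^m of the norms turns (t/2)^m into t^m, and π² moves to the constant.
  refine hf.not_balanced hF hF1 hF' hfF (c * π ^ 2) fun t ht => ?_
  obtain ⟨h1, h2⟩ := exists_keplerDomain_norm_sq ht
  have hw : (((√(t / 2) : ℝ) : ℂ), (0 : ℂ)) ∈ chartBall := vec_mem_keplerDomain_iff.1 h1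
  have hsum := hf.hasSum_bergmanKernel hu hK hw
  have hM := keplerChart_mem_keplerBall h1
  have hval : K (keplerChartProd (((√(t / 2) : ℝ) : ℂ), 0)) (keplerChartProd (((√(t / 2) : ℝ) : ℂ), 0))
      = ((c / f t ^ 3 : ℝ) : ℂ) := by
    have := hc _ hM
    rwa [hu _ hM, h2] at this
  rw [hval, Complex.hasSum_ofReal] at hsum
  have ht2 : ‖((√(t / 2) : ℝ) : ℂ)‖ ^ 2 = t / 2 := by
    rw [Complex.norm_real, Real.norm_of_nonneg (Real.sqrt_nonneg _),
      Real.sq_sqrt (by linarith [ht.1])]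
  convert! hsum.mul_left (π ^ 2) using 1
  · ext m
    rw [ht2, hf.lintegral_pow_fst, ENNReal.toReal_mul, ENNReal.toReal_ofReal (by positivity),
      div_pow]
    field_simp
  · ring

theorem corollary2 :
    (∀ f : ℝ → ℝ, AnalyticAt ℝ f 1 → f 1 = 0 → deriv f 1 = -1 →
      ¬ IsBalanced 2 (keplerBall 2) (fun z => f (‖z‖ ^ 2))) ∧
    (∀ (u : EuclideanSpace ℂ (Fin 3) → ℝ) (f : ℝ → ℝ) (d : ℝ),
      (∀ z ∈ keplerBall 2, u z = f (‖z‖ ^ 2)) →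
      Tendsto f (𝓝[<] 1) (𝓝 0) → Tendsto (deriv f) (𝓝[<] 1) (𝓝 d) → d ≠ 0 →
      IsAnalyticUpToBoundary 2 u → ¬ IsBalanced 2 (keplerBall 2) u) := by
  refine ⟨fun f hf hf1 hf' => not_isBalanced_of_analyticAt (fun _ _ => rfl) hf hf1
    (by rw [hf']; norm_num) EventuallyEq.rfl, fun u f d hu hlim hlim' hd hbd => ?_⟩
  -- A boundary point. On the ray √t p one has |z|² = t, so t ↦ G(√t p) is analytic at 1 and agrees
  -- with f to the left of 1. The limits of f and f' give its value 0 and derivative d there.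
  set p : EuclideanSpace ℂ (Fin 3) := keplerChart ![((√(1 / 2) : ℝ) : ℂ), 0] with hp
  have hhalf : ‖((√(1 / 2) : ℝ) : ℂ)‖ ^ 2 = 1 / 2 := by
    rw [Complex.norm_real, Real.norm_of_nonneg (Real.sqrt_nonneg _), Real.sq_sqrt (by norm_num)]
  have hpn : ‖p‖ ^ 2 = 1 := by
    rw [hp, norm_sq_keplerChart]
    simp only [Matrix.cons_val_zero, Matrix.cons_val_one, norm_zero, hhalf]
    norm_num
  have hpn1 : ‖p‖ = 1 := by nlinarith [norm_nonneg p]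
  obtain ⟨G, hG, hGu⟩ := hbd p ⟨sum_sq_keplerChart _, hpn1⟩
  have hp1 : (√1 : ℝ) • p = p := by simp
  have hsqrt : AnalyticAt ℝ (fun t : ℝ => √t) 1 := (Real.contDiffAt_sqrt one_ne_zero).analyticAt
  have hF : AnalyticAt ℝ (fun t : ℝ => G (√t • p)) 1 :=
    AnalyticAt.fun_comp (by rwa [hp1]) (hsqrt.smul analyticAt_const)
  have hray : Tendsto (fun t : ℝ => √t • p) (𝓝[<] 1) (𝓝[keplerBall 2] p) := by
    refine tendsto_nhdsWithin_iff.2 ⟨?_, ?_⟩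
    · have : ContinuousAt (fun t : ℝ => √t • p) 1 := by fun_prop
      have h := this.tendsto
      rw [hp1] at h
      exact h.mono_left nhdsWithin_le_nhds
    · filter_upwards [Ioo_mem_nhdsLT (zero_lt_one' ℝ)] with t ht
      have h0 : 0 < √t := Real.sqrt_pos.2 ht.1
      refine ⟨?_, ?_, ?_⟩
      · have h1 := sum_sq_keplerChart ![((√(1 / 2) : ℝ) : ℂ), 0]
        rw [← hp] at h1
        calc ∑ j, (√t • p) j ^ 2 = (√t : ℂ) ^ 2 * ∑ j, p j ^ 2 := by
              rw [Finset.mul_sum]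
              exact Finset.sum_congr rfl fun j _ => by simp [mul_pow]
          _ = 0 := by rw [h1, mul_zero]
      · refine smul_ne_zero h0.ne' fun h => ?_
        rw [h, norm_zero] at hpn1
        exact zero_ne_one hpn1
      · rw [norm_smul, hpn1, mul_one, Real.norm_of_nonneg h0.le, Real.sqrt_lt' one_pos]
        linarith [ht.2]
  have hfF : f =ᶠ[𝓝[<] 1] fun t : ℝ => G (√t • p) := by
    filter_upwards [hray.eventually hGu, hray.eventually self_mem_nhdsWithin,
      Ioo_mem_nhdsLT (zero_lt_one' ℝ)] with t h1 h2 ht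
    rw [← h1, hu _ h2, norm_smul, mul_pow, hpn, Real.norm_of_nonneg (Real.sqrt_nonneg t),
      Real.sq_sqrt ht.1.le, mul_one]
  have hF1 : (fun t : ℝ => G (√t • p)) 1 = 0 :=
    tendsto_nhds_unique (hF.continuousAt.tendsto.mono_left nhdsWithin_le_nhds)
      (hlim.congr' hfF)
  have hder : deriv f =ᶠ[𝓝[<] 1] deriv fun t : ℝ => G (√t • p) := by
    obtain ⟨a, ha, h⟩ := (mem_nhdsLT_iff_exists_Ioo_subset).1 hfF
    filter_upwards [Ioo_mem_nhdsLT ha] with t ht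
    exact EventuallyEq.deriv_eq (mem_of_superset (Ioo_mem_nhds ht.1 ht.2) h)
  have hF' : deriv (fun t : ℝ => G (√t • p)) 1 = d :=
    tendsto_nhds_unique (hF.deriv.continuousAt.tendsto.mono_left nhdsWithin_le_nhds)
      (hlim'.congr' hder)
  exact not_isBalanced_of_analyticAt hu hF hF1 (by rwa [hF']) hfF

end Balanced
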